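/- **Proposition (Harrison).** Let $k$ be a field of characteristic zero. For a graded $k$-vector space $W=\bigoplus_{i\in\mathbb Z}W_i$ and $n\ge 1$, let $\mathrm{Gr}(n)$ be the vector space freely generated by the trees with vertex set $\{1,\dots,n\}$ in which every edge carries a direction, and let $$\mathbb E^n W=\bigl(\mathrm{Gr}(n)\otimes W^{\otimes n}\bigr)/\!\sim ,$$ where $\sim$ consists of the following relations. * $\sigma G\otimes\sigma x\sim G\otimes x$ for $\sigma\in\Sigma_n$, which acts on $W^{\otimes n}$ with Koszul signs. * Arrow-reversing: $G\otimes x+G'\otimes x\sim 0$ if $G'$ is $G$ with one edge reversed. * Arnold: $G_1\otimes x+G_2\otimes x+G_3\otimes x\sim 0$ for graphs that agree except that they contain, respectively, the pairs of edges $a\to b\to c$, $\ b\to c\to a$, $\ c\to a\to b$ between three vertices $a,b,c$. Put $\mathbb E(W)=\bigoplus_{n\ge1}\mathbb E^nW$, graded by total degree, and let the bar generator $w_1|w_2|\cdots|w_n$ be the class of $(1\to2\to\cdots\to n)\otimes w_1\otimes\cdots\otimes w_n$. **(1)** For every $W$ and every $n\ge1$, the bar generators span $\mathbb E^nW$, and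 the kernel of the map $W^{\otimes n}\to\mathbb E^nW$, $w_1\otimes\cdots\otimes w_n\mapsto w_1|\cdots|w_n$, is exactly the span $\mathrm{Sh}^n(W)$ of the Harrison shuffles $$\sum_{\sigma\text{ a shuffle of }(1,\dots,p)\text{ into }(p+1,\dots,n)}\pm\, w_{\sigma(1)}\otimes\cdots\otimes w_{\sigma(n)},\qquad 1\le p\le n-1,$$ with Koszul signs $\pm$. **(2)** Let $A$ be an augmented differential graded-commutative $k$-algebra ($\mathbb Z$-graded, with differential of degree $+1$) with augmentation ideal $\bar A$, and let $(s^{-1}\bar A)_i=\bar A_{i+1}$. Define the following operations on representatives $G\otimes x$ of elements of $\mathbb E(s^{-1}\bar A)$. * The differential $d=d_A+d_\mu$: here $d_A$ applies $s^{-1}a\mapsto -s^{-1}(d_Aa)$ termwise with Koszul signs, and $d_\mu$ is the sum over all edges $e$ of $G$ of the contractions of $e$; if $e$ goes from the first to the second vertex, with labels $s^{-1}a$ and $s^{-1}b$, the merged vertex is the first vertex and has the label $(-1)^{|a|}s^{-1}(ab)$, and the general case is reduced to this one by a permutation. * The cobracket $]\,G\otimes x\,[$, the sum over all edges $e$ of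 $G$ of $G_1^{\hat e}\otimes G_2^{\hat e}-G_2^{\hat e}\otimes G_1^{\hat e}$ with labels distributed with Koszul signs, where $e$ points from the component $G_1^{\hat e}$ of $G\setminus e$ to the component $G_2^{\hat e}$. Then these descend to $\mathbb E(s^{-1}\bar A)$ and make it a differential graded Lie coalgebra $\mathcal E(A)$. Likewise the bar differential $$s^{-1}a_1|\cdots|s^{-1}a_n\mapsto\sum_i(-1)^{\epsilon_{i}}\Bigl(-\,\cdots|s^{-1}(d_Aa_i)|\cdots\Bigr)+\sum_{i<n}(-1)^{\epsilon_{i}+|a_i|}\,\cdots|s^{-1}(a_ia_{i+1})|\cdots,\qquad \epsilon_i=\sum_{j<i}|s^{-1}a_j|,$$ and the anti-cocommutative coproduct $\Delta-\tau\Delta$ ($\Delta$ the reduced deconcatenation $w_1|\cdots|w_n\mapsto\sum_{p=1}^{n-1}(w_1|\cdots|w_p)\otimes(w_{p+1}|\cdots|w_n)$, $\tau$ the graded twist) descend to the Harrison complex $\bigoplus_{n\ge1}(s^{-1}\bar A)^{\otimes n}/\mathrm{Sh}^n(s^{-1}\bar A)$ and make it a differential graded Lie coalgebra (Schlessinger–Stasheff).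 The map that sends the class of a word $w_1\otimes\cdots\otimes w_n$ to the bar generator $w_1|\cdots|w_n$ is an isomorphism from the Harrison complex to $\mathcal E(A)$ that respects the gradings, the differentials and the cobrackets. -/

import Mathlib

open scoped TensorProduct DirectSum

noncomputable section

namespace GraphLie

universe u v

/-! ### Graded vector spaces and Koszul signs -/

section Koszul

variable {k : Type u} [Field k] {W : Type v} [AddCommGroup W] [Module k W]
  (𝒲 : ℤ → Submodule k W) [DirectSum.Decomposition 𝒲]

open scoped Classical in
/-- The projection of a graded vector space onto its part of parity `ε`
(the sum of all components whose degree is congruent to `ε` modulo 2). -/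
def parityProj (ε : ZMod 2) : W →ₗ[k] W :=
  DirectSum.toModule k ℤ W (fun i => if (i : ZMod 2) = ε then (𝒲 i).subtype else 0) ∘ₗ
    (DirectSum.decomposeLinearEquiv 𝒲).toLinearMap

/-- The degree involution `w ↦ (-1)^|w| w`. -/
def degInvol : W →ₗ[k] W := parityProj 𝒲 0 - parityProj 𝒲 1

/-- The graded twist `x ⊗ y ↦ (-1)^(|x||y|) y ⊗ x`. -/
def gradedSwap : W ⊗[k] W →ₗ[k] W ⊗[k] W :=
  ∑ ε : ZMod 2, ∑ δ : ZMod 2, (if ε = 1 ∧ δ = 1 then (-1 : k) else 1) •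
    ((TensorProduct.comm k W W).toLinearMap ∘ₗ
      TensorProduct.map (parityProj 𝒲 ε) (parityProj 𝒲 δ))

/-- The graded cyclic permutation `x ⊗ y ⊗ z ↦ (-1)^(|x|(|y|+|z|)) y ⊗ z ⊗ x`. -/
def gradedCycle : W ⊗[k] (W ⊗[k] W) →ₗ[k] W ⊗[k] (W ⊗[k] W) :=
  TensorProduct.map LinearMap.id (gradedSwap 𝒲) ∘ₗ
    (TensorProduct.assoc k W W W).toLinearMap ∘ₗ
    TensorProduct.map (gradedSwap 𝒲) LinearMap.id ∘ₗ
    (TensorProduct.assoc k W W W).symm.toLinearMap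

variable {I J : Type} [Fintype I] [LinearOrder I] [LinearOrder J]

/-- The Koszul sign of the reordering `e` of homogeneous factors with parities `ε`: every pair
of odd factors whose order is reversed contributes `-1`. -/
def koszulSign (e : I ≃ J) (ε : I → ZMod 2) : k :=
  ∏ i : I, ∏ j : I, if i < j ∧ e j < e i ∧ ε i = 1 ∧ ε j = 1 then -1 else 1

/-- Reordering of tensor factors with Koszul sign: the factor in position `i` moves to
position `e i`. -/
def koszul (e : I ≃ J) : (⨂[k] _ : I, W) →ₗ[k] (⨂[k] _ : J, W) :=
  ∑ ε : I → ZMod 2, (koszulSign e ε : k) •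
    ((PiTensorProduct.reindex k (fun _ : I => W) e).toLinearMap ∘ₗ
      PiTensorProduct.map (fun i => parityProj 𝒲 (ε i)))

open scoped Classical in
/-- Unshuffling of the tensor factors into those in `T`, followed by those outside `T`, with
Koszul sign. -/
def unshuffle (T : Set I) :
    (⨂[k] _ : I, W) →ₗ[k] (⨂[k] _ : {i // i ∈ T}, W) ⊗[k] (⨂[k] _ : {i // ¬ i ∈ T}, W) :=
  (PiTensorProduct.tmulEquiv k W).symm.toLinearMap ∘ₗ
    (PiTensorProduct.reindex k (fun _ : {i // i ∈ T} ⊕ₗ {i // ¬ i ∈ T} => W) ofLex).toLinearMap ∘ₗ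
      koszul 𝒲 ((Equiv.sumCompl (fun i => i ∈ T)).symm.trans toLex)

/-- The extension of an operator `D` of degree one to tensors, termwise with Koszul signs:
`w₁ ⊗ ⋯ ⊗ wₙ ↦ ∑ᵢ (-1)^(|w₁|+⋯+|wᵢ₋₁|) w₁ ⊗ ⋯ ⊗ D wᵢ ⊗ ⋯ ⊗ wₙ`. -/
def termwise (D : W →ₗ[k] W) : (⨂[k] _ : I, W) →ₗ[k] (⨂[k] _ : I, W) :=
  ∑ i : I, PiTensorProduct.map
    (fun j => if j < i then degInvol 𝒲 else if j = i then D else LinearMap.id)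

/-- The letters of a word after merging the letters `i` and `i + 1` by a bilinear operation `m`
and applying the operator `L` to all letters before them. -/
def mergeFun (L : W →ₗ[k] W) (m : W →ₗ[k] W →ₗ[k] W) {n : ℕ} (i : Fin (n + 1))
    (w : Fin (n + 2) → W) (j : Fin (n + 1)) : W :=
  if j < i then L (w j.castSucc)
  else if j = i then m (w i.castSucc) (w i.succ) else w j.succ

theorem mergeFun_update (L : W →ₗ[k] W) (m : W →ₗ[k] W →ₗ[k] W) {n : ℕ} (i : Fin (n + 1))
    (w : Fin (n + 2) → W) (a : Fin (n + 2)) :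
    ∃ (b : Fin (n + 1)) (T : W →ₗ[k] W), ∀ x,
      mergeFun L m i (Function.update w a x) = Function.update (mergeFun L m i w) b (T x) := by
  rcases lt_trichotomy a i.castSucc with h | h | h
  · refine ⟨⟨a, by have := a.2; have := i.2; simp [Fin.lt_def] at h; omega⟩, L, fun x => ?_⟩
    funext j
    simp only [mergeFun, Function.update_apply, Fin.ext_iff, Fin.lt_def, Fin.val_castSucc,
      Fin.val_succ] at h ⊢
    split_ifs <;> first | rfl | omega
  · subst h
    refine ⟨i, m.flip (w i.succ), fun x => ?_⟩
    funext j
    simp only [mergeFun, Function.update_apply, Fin.ext_iff, Fin.lt_def, Fin.val_castSucc,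
      Fin.val_succ]
    split_ifs <;> first | rfl | omega
  · rcases eq_or_ne a i.succ with h' | h'
    · subst h'
      refine ⟨i, m (w i.castSucc), fun x => ?_⟩
      funext j
      simp only [mergeFun, Function.update_apply, Fin.ext_iff, Fin.lt_def, Fin.val_castSucc,
        Fin.val_succ]
      split_ifs <;> first | rfl | omega
    · refine ⟨⟨a - 1, by have := a.2; simp [Fin.lt_def] at h; omega⟩, LinearMap.id, fun x => ?_⟩
      funext j
      simp only [mergeFun, Function.update_apply, Fin.ext_iff, Fin.lt_def, Fin.val_castSucc,
        Fin.val_succ, ne_eq] at h h' ⊢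
      split_ifs <;> first | rfl | omega

/-- Merging of the adjacent tensor factors `i` and `i + 1` by a bilinear operation `m`, with the
operator `L` applied to all factors before them:
`w₀ ⊗ ⋯ ⊗ wₙ₊₁ ↦ L w₀ ⊗ ⋯ ⊗ L wᵢ₋₁ ⊗ m wᵢ wᵢ₊₁ ⊗ wᵢ₊₂ ⊗ ⋯ ⊗ wₙ₊₁`. -/
def merge (L : W →ₗ[k] W) (m : W →ₗ[k] W →ₗ[k] W) {n : ℕ} (i : Fin (n + 1)) :
    (⨂[k] _ : Fin (n + 2), W) →ₗ[k] (⨂[k] _ : Fin (n + 1), W) :=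
  PiTensorProduct.lift
    { toFun := fun w => PiTensorProduct.tprod k (mergeFun L m i w)
      map_update_add' := by
        intro inst w a x y
        obtain rfl : inst = instDecidableEqFin _ := Subsingleton.elim _ _
        obtain ⟨b, T, h⟩ := mergeFun_update L m i w a
        simp only [h, map_add, MultilinearMap.map_update_add]
      map_update_smul' := by
        intro inst w a c x
        obtain rfl : inst = instDecidableEqFin _ := Subsingleton.elim _ _
        obtain ⟨b, T, h⟩ := mergeFun_update L m i w a
        simp only [h, map_smul, MultilinearMap.map_update_smul] }

end Koszul

/-! ### Graphs -/

/-- `S`-graphs: connected, oriented, acyclic graphs with vertex set `S`, that is, trees with a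
direction on every edge. -/
def IsSGraph {S : Type} (G : Digraph S) : Prop :=
  (∀ a b, G.Adj a b → ¬ G.Adj b a) ∧ G.toSimpleGraphInclusive.IsTree

/-- The `S`-graphs with vertex set `{0, …, n-1}`. -/
abbrev SGr (n : ℕ) : Type := {G : Digraph (Fin n) // IsSGraph G}

/-- The graph pulled back along a map of vertex sets: the full subgraph when `f` is the inclusion
of a subset, a relabelled graph when `f` is a bijection. -/
def pullback {I J : Type} (f : I → J) (G : Digraph J) : Digraph I :=
  ⟨fun x y => G.Adj (f x) (f y)⟩

/-- The graph obtained from `H` by adding an edge from `a` to `b`. -/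
def addEdge {I : Type} (H : Digraph I) (a b : I) : Digraph I :=
  ⟨fun x y => H.Adj x y ∨ (x = a ∧ y = b)⟩

/-- The graph obtained from `G` by removing the edge from `a` to `b`. -/
def delEdge {I : Type} (G : Digraph I) (a b : I) : Digraph I :=
  ⟨fun x y => G.Adj x y ∧ ¬ (x = a ∧ y = b)⟩

/-- The vertices of the component of `a` after the edge from `a` to `b` has been cut. -/
def cutSide {I : Type} (G : Digraph I) (a b : I) : Set I :=
  {v | (delEdge G a b).toSimpleGraphInclusive.Reachable a v}

open scoped Classical in
/-- The edges of a finite graph, as pairs (source, target). -/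
def edges {I : Type} [Fintype I] (G : Digraph I) : Finset (I × I) :=
  Finset.univ.filter (fun e => G.Adj e.1 e.2)

/-- The long graph `0 → 1 → ⋯ → n-1`. -/
def longGraph (n : ℕ) : Digraph (Fin n) := ⟨fun x y => (x : ℕ) + 1 = y⟩

/-- The image of a graph under a map of vertex sets, with loops discarded. -/
def pushforward {I J : Type} (f : I → J) (G : Digraph I) : Digraph J :=
  ⟨fun x y => x ≠ y ∧ ∃ a b, G.Adj a b ∧ f a = x ∧ f b = y⟩

/-- A permutation that moves `a` to `0` and `b` to `1` (for `a ≠ b`). -/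
def toFront {n : ℕ} (a b : Fin (n + 2)) : Equiv.Perm (Fin (n + 2)) :=
  Equiv.swap 1 (Equiv.swap 0 a b) * Equiv.swap 0 a

/-- The map of vertices that identifies `0` and `1` and shifts all other vertices down by one. -/
def collapse {n : ℕ} : Fin (n + 2) → Fin (n + 1) := Fin.predAbove 0

/-! ### The graph model `E(W)` of the cofree Lie coalgebra -/

section Model

variable {k : Type u} [Field k] {W : Type v} [AddCommGroup W] [Module k W]
  (𝒲 : ℤ → Submodule k W) [DirectSum.Decomposition 𝒲]

variable (k W) in
/-- `Gr(n) ⊗ W^{⊗ n}`, where `Gr(n)` is the vector space freely generated by the `S`-graphs with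
`S = {0, …, n-1}`; the tensor `G ⊗ x` is `Finsupp.single G x`. -/
abbrev GrTensor (n : ℕ) : Type (max u v) := SGr n →₀ (⨂[k] _ : Fin n, W)

/-- The relations `σ G ⊗ σ x = G ⊗ x` of the coinvariants under the symmetric group, which acts on
tensors with Koszul signs. -/
def symmRel (n : ℕ) : Submodule k (GrTensor k W n) :=
  Submodule.span k {y | ∃ (σ : Equiv.Perm (Fin n)) (G G' : SGr n) (x : ⨂[k] _ : Fin n, W),
    G'.1 = pullback σ.symm G.1 ∧
    y = Finsupp.single G' (koszul 𝒲 σ x) - Finsupp.single G x}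

variable (k W) in
/-- The arrow-reversing relations. -/
def arrowRel (n : ℕ) : Submodule k (GrTensor k W n) :=
  Submodule.span k {y | ∃ (H : Digraph (Fin n)) (a b : Fin n) (G G' : SGr n)
      (x : ⨂[k] _ : Fin n, W),
    G.1 = addEdge H a b ∧ G'.1 = addEdge H b a ∧
    y = Finsupp.single G x + Finsupp.single G' x}

variable (k W) in
/-- The Arnold relations: three graphs that agree except that the first has the edges
`a → b → c`, the second `b → c → a`, the third `c → a → b`, add up to zero. -/
def arnoldRel (n : ℕ) : Submodule k (GrTensor k W n) :=
  Submodule.span k {y | ∃ (H : Digraph (Fin n)) (a b c : Fin n) (G₁ G₂ G₃ : SGr n)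
      (x : ⨂[k] _ : Fin n, W),
    G₁.1 = addEdge (addEdge H a b) b c ∧
    G₂.1 = addEdge (addEdge H b c) c a ∧
    G₃.1 = addEdge (addEdge H c a) a b ∧
    y = Finsupp.single G₁ x + Finsupp.single G₂ x + Finsupp.single G₃ x}

/-- All relations that define the weight `n` part of `E(W)`. -/
def eilRel (n : ℕ) : Submodule k (GrTensor k W n) :=
  symmRel 𝒲 n ⊔ arrowRel k W n ⊔ arnoldRel k W n

/-- `E^n(W)`: the quotient of `Gr(n) ⊗ W^{⊗ n}` by the symmetric group action, the
arrow-reversing relations and the Arnold relations. -/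
abbrev EilWeight (n : ℕ) : Type (max u v) := GrTensor k W n ⧸ eilRel 𝒲 n

/-- `E(W)`, the direct sum of the `E^n(W)` over `n ≥ 1`. -/
def Eil : Type (max u v) := ⨁ n : ℕ+, EilWeight 𝒲 (n : ℕ)

instance : AddCommGroup (Eil 𝒲) :=
  inferInstanceAs (AddCommGroup (⨁ n : ℕ+, EilWeight 𝒲 (n : ℕ)))

instance : Module k (Eil 𝒲) :=
  inferInstanceAs (Module k (⨁ n : ℕ+, EilWeight 𝒲 (n : ℕ)))

/-- The inclusion of `E^n(W)` into `E(W)`. -/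
def eilIncl (n : ℕ+) : EilWeight 𝒲 (n : ℕ) →ₗ[k] Eil 𝒲 :=
  DirectSum.lof k ℕ+ (fun n : ℕ+ => EilWeight 𝒲 (n : ℕ)) n

open scoped Classical in
/-- The class of `G ⊗ x` in `E^n(W)`, as a linear function of `x`
(zero if `G` is not an `S`-graph). -/
def eilWeightClass (n : ℕ) (G : Digraph (Fin n)) :
    (⨂[k] _ : Fin n, W) →ₗ[k] EilWeight 𝒲 n :=
  if h : IsSGraph G then (eilRel 𝒲 n).mkQ ∘ₗ Finsupp.lsingle (⟨G, h⟩ : SGr n) else 0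

/-- The class of `G ⊗ x` in `E(W)`, for a graph with vertex set `{0, …, n-1}`. -/
def eilClass (n : ℕ+) (G : Digraph (Fin n)) : (⨂[k] _ : Fin n, W) →ₗ[k] Eil 𝒲 :=
  eilIncl 𝒲 n ∘ₗ eilWeightClass 𝒲 n G

/-- The class of `G ⊗ x` in `E(W)`, for a graph `G` on a nonempty linearly ordered finite vertex
set, whose vertices are renumbered in their order. -/
def eilClassOf {I : Type} [Fintype I] [LinearOrder I] (G : Digraph I) :
    (⨂[k] _ : I, W) →ₗ[k] Eil 𝒲 :=
  if h : 0 < Fintype.card I then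
    eilClass 𝒲 ⟨Fintype.card I, h⟩
        (pullback (Fintype.orderIsoFinOfCardEq I rfl) G) ∘ₗ
      (PiTensorProduct.reindex k (fun _ : I => W)
        (Fintype.orderIsoFinOfCardEq I rfl).symm.toEquiv).toLinearMap
  else 0

/-- The bar generators `w₁|w₂|⋯|wₙ` of `E^n(W)`: the classes of the long graph. -/
def bar (n : ℕ) : (⨂[k] _ : Fin n, W) →ₗ[k] EilWeight 𝒲 n :=
  eilWeightClass 𝒲 n (longGraph n)

/-- The degree `i` part of `E(W)`. -/
def eilDegree (i : ℤ) : Submodule k (Eil 𝒲) :=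
  Submodule.span k {y | ∃ (n : ℕ+) (G : SGr n) (p : Fin n → ℤ) (w : Fin n → W),
    (∀ j, w j ∈ 𝒲 (p j)) ∧ ∑ j, p j = i ∧ y = eilClass 𝒲 n G.1 (PiTensorProduct.tprod k w)}

open scoped Classical in
/-- For a set `T` of vertices: `(G restricted to T) ⊗ (G restricted to the complement of T)`,
with the tensor factors unshuffled accordingly. -/
def eilSplit {n : ℕ} (G : Digraph (Fin n)) (T : Set (Fin n)) :
    (⨂[k] _ : Fin n, W) →ₗ[k] Eil 𝒲 ⊗[k] Eil 𝒲 :=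
  TensorProduct.map
      (eilClassOf 𝒲 (pullback (Subtype.val : {i // i ∈ T} → Fin n) G))
      (eilClassOf 𝒲 (pullback (Subtype.val : {i // ¬ i ∈ T} → Fin n) G)) ∘ₗ
    unshuffle 𝒲 T

/-- The anti-commutative graph cobracket on representatives: every edge is cut in turn, and the
two components are tensored in the order given by the direction of the edge, minus the opposite
order. -/
def eilCobracket {n : ℕ} (G : Digraph (Fin n)) :
    (⨂[k] _ : Fin n, W) →ₗ[k] Eil 𝒲 ⊗[k] Eil 𝒲 :=
  ∑ e ∈ edges G, (eilSplit 𝒲 G (cutSide G e.1 e.2) - eilSplit 𝒲 G (cutSide G e.1 e.2)ᶜ)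

/-- The edge-contracting differential on representatives, for a bilinear operation `m`: for every
edge, the representative is permuted so that the edge goes from the first to the second vertex,
which are then merged, as are their labels, by `m`. -/
def eilContract (m : W →ₗ[k] W →ₗ[k] W) :
    (n : ℕ) → (G : Digraph (Fin n)) → (⨂[k] _ : Fin n, W) →ₗ[k] Eil 𝒲
  | 0, _ => 0
  | 1, _ => 0
  | n + 2, G => ∑ e ∈ edges G,
      eilClass 𝒲 n.succPNat (pushforward (collapse ∘ toFront e.1 e.2) G) ∘ₗ
        merge LinearMap.id m 0 ∘ₗ koszul 𝒲 (toFront e.1 e.2)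

/-! ### The Harrison complex -/

/-- `ρ` is the reordering of a shuffle of the first `p` letters into the remaining ones: the
letter in position `i` moves to position `ρ i`, and the order within the first `p` letters and the
order within the remaining letters are kept. -/
def IsShuffle {n : ℕ} (p : ℕ) (ρ : Equiv.Perm (Fin n)) : Prop :=
  (∀ i j : Fin n, i < j → (j : ℕ) < p → ρ i < ρ j) ∧
  (∀ i j : Fin n, i < j → p ≤ (i : ℕ) → ρ i < ρ j)

open scoped Classical in
/-- The sum over all shuffles of the first `p` letters into the remaining ones, with Koszul
signs. -/
def shuffleSum (n p : ℕ) : (⨂[k] _ : Fin n, W) →ₗ[k] (⨂[k] _ : Fin n, W) :=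
  ∑ ρ ∈ Finset.univ.filter (fun ρ : Equiv.Perm (Fin n) => IsShuffle p ρ), koszul 𝒲 ρ

/-- The span in `W^{⊗ n}` of all Harrison shuffles, for `1 ≤ p ≤ n - 1`. -/
def harrisonShuffles (n : ℕ) : Submodule k (⨂[k] _ : Fin n, W) :=
  ⨆ p ∈ Finset.Ioo 0 n, LinearMap.range (shuffleSum 𝒲 n p)

/-- The weight `n` part of the Harrison complex. -/
abbrev HarrWeight (n : ℕ) : Type (max u v) := (⨂[k] _ : Fin n, W) ⧸ harrisonShuffles 𝒲 n

/-- The vector space underlying the Harrison complex: the quotient of the reduced cotensor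
coalgebra `⨁_{n ≥ 1} W^{⊗ n}` by the shuffles. -/
def Harr : Type (max u v) := ⨁ n : ℕ+, HarrWeight 𝒲 (n : ℕ)

instance : AddCommGroup (Harr 𝒲) :=
  inferInstanceAs (AddCommGroup (⨁ n : ℕ+, HarrWeight 𝒲 (n : ℕ)))

instance : Module k (Harr 𝒲) :=
  inferInstanceAs (Module k (⨁ n : ℕ+, HarrWeight 𝒲 (n : ℕ)))

/-- The inclusion of the weight `n` part into the Harrison complex. -/
def harrIncl (n : ℕ+) : HarrWeight 𝒲 (n : ℕ) →ₗ[k] Harr 𝒲 :=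
  DirectSum.lof k ℕ+ (fun n : ℕ+ => HarrWeight 𝒲 (n : ℕ)) n

/-- The class in the Harrison complex of a word of length `n`. -/
def harrClass (n : ℕ+) : (⨂[k] _ : Fin n, W) →ₗ[k] Harr 𝒲 :=
  harrIncl 𝒲 n ∘ₗ (harrisonShuffles 𝒲 n).mkQ

/-- The class in the Harrison complex of a word with letters indexed by a nonempty linearly
ordered finite set. -/
def harrClassOf {I : Type} [Fintype I] [LinearOrder I] : (⨂[k] _ : I, W) →ₗ[k] Harr 𝒲 :=
  if h : 0 < Fintype.card I then
    harrClass 𝒲 ⟨Fintype.card I, h⟩ ∘ₗ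
      (PiTensorProduct.reindex k (fun _ : I => W)
        (Fintype.orderIsoFinOfCardEq I rfl).symm.toEquiv).toLinearMap
  else 0

/-- The degree `i` part of the Harrison complex. -/
def harrDegree (i : ℤ) : Submodule k (Harr 𝒲) :=
  Submodule.span k {y | ∃ (n : ℕ+) (p : Fin n → ℤ) (w : Fin n → W),
    (∀ j, w j ∈ 𝒲 (p j)) ∧ ∑ j, p j = i ∧ y = harrClass 𝒲 n (PiTensorProduct.tprod k w)}

open scoped Classical in
/-- The subword in the positions `T`, tensored with the subword in the other positions, with
Koszul sign. -/
def harrSplit {n : ℕ} (T : Set (Fin n)) : (⨂[k] _ : Fin n, W) →ₗ[k] Harr 𝒲 ⊗[k] Harr 𝒲 :=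
  TensorProduct.map (harrClassOf 𝒲 (I := {i // i ∈ T})) (harrClassOf 𝒲 (I := {i // ¬ i ∈ T})) ∘ₗ
    unshuffle 𝒲 T

/-- The Schlessinger–Stasheff cobracket on words: the anti-cocommutative coproduct
`Δ - τ Δ`, where `Δ` is the reduced deconcatenation `∑ₚ (w₁|⋯|wₚ) ⊗ (wₚ₊₁|⋯|wₙ)`, `1 ≤ p ≤ n-1`,
and `τ` is the graded twist. -/
def harrCobracket (n : ℕ) : (⨂[k] _ : Fin n, W) →ₗ[k] Harr 𝒲 ⊗[k] Harr 𝒲 :=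
  ∑ p ∈ Finset.Ioo 0 n,
    (harrSplit 𝒲 {i : Fin n | (i : ℕ) < p} - harrSplit 𝒲 {i : Fin n | (i : ℕ) < p}ᶜ)

/-- The part of the bar differential given by a bilinear operation `m`:
`w₁|⋯|wₙ ↦ ∑ᵢ (-1)^(|w₁|+⋯+|wᵢ₋₁|) w₁|⋯|m wᵢ wᵢ₊₁|⋯|wₙ`. -/
def harrContract (m : W →ₗ[k] W →ₗ[k] W) : (n : ℕ) → (⨂[k] _ : Fin n, W) →ₗ[k] Harr 𝒲
  | 0 => 0
  | 1 => 0
  | n + 2 => ∑ i : Fin (n + 1), harrClass 𝒲 n.succPNat ∘ₗ merge (degInvol 𝒲) m i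

end Model

/-! ### Differential graded Lie coalgebras -/

/-- A differential graded Lie coalgebra structure on a vector space (cohomological grading). -/
structure DGLieCoalgebra (k : Type u) [Field k] (M : Type v) [AddCommGroup M] [Module k M] where
  /-- the grading -/
  gr : ℤ → Submodule k M
  /-- the space is the direct sum of its graded parts -/
  decomp : DirectSum.Decomposition gr
  /-- the differential -/
  d : M →ₗ[k] M
  /-- the cobracket -/
  cobracket : M →ₗ[k] M ⊗[k] M
  d_mem : ∀ i, ∀ x ∈ gr i, d x ∈ gr (i + 1)
  d_comp_d : d ∘ₗ d = 0
  cobracket_mem : ∀ i, ∀ x ∈ gr i, cobracket x ∈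
    ⨆ p : ℤ, LinearMap.range (TensorProduct.map (gr p).subtype (gr (i - p)).subtype)
  anticomm : gradedSwap gr ∘ₗ cobracket = -cobracket
  coJacobi : (LinearMap.id + gradedCycle gr + gradedCycle gr ∘ₗ gradedCycle gr) ∘ₗ
    TensorProduct.map LinearMap.id cobracket ∘ₗ cobracket = 0
  coLeibniz : cobracket ∘ₗ d =
    (TensorProduct.map d LinearMap.id + TensorProduct.map (degInvol gr) d) ∘ₗ cobracket

/-! ### Differential graded commutative algebras -/

/-- The structure of an augmented differential graded commutative algebra on a graded algebra. -/
structure AugCDGA {k : Type u} [Field k] {A : Type v} [Ring A] [Algebra k A]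
    (𝒜 : ℤ → Submodule k A) [GradedAlgebra 𝒜] where
  comm : ∀ i j : ℤ, ∀ a ∈ 𝒜 i, ∀ b ∈ 𝒜 j, a * b = (i * j).negOnePow • (b * a)
  /-- the differential -/
  d : A →ₗ[k] A
  d_mem : ∀ i, ∀ a ∈ 𝒜 i, d a ∈ 𝒜 (i + 1)
  d_comp_d : d ∘ₗ d = 0
  leibniz : ∀ i, ∀ a ∈ 𝒜 i, ∀ b, d (a * b) = d a * b + i.negOnePow • (a * d b)
  /-- the augmentation -/
  aug : A →ₐ[k] k
  aug_of_ne : ∀ i, i ≠ 0 → ∀ a ∈ 𝒜 i, aug a = 0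
  aug_d : ∀ a, aug (d a) = 0

namespace AugCDGA

variable {k : Type u} [Field k] {A : Type v} [Ring A] [Algebra k A]
  {𝒜 : ℤ → Submodule k A} [GradedAlgebra 𝒜] (S : AugCDGA 𝒜)

/-- The augmentation ideal. The desuspension `s⁻¹Ā` has the same underlying vector space. -/
def augIdeal : Submodule k A := LinearMap.ker S.aug.toLinearMap

/-- The grading of the desuspension `s⁻¹Ā`: its degree `i` part is the degree `i + 1` part of the
augmentation ideal. -/
def desusp (i : ℤ) : Submodule k S.augIdeal := (𝒜 (i + 1)).comap S.augIdeal.subtype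

theorem coe_decompose_mem (x : S.augIdeal) (i : ℤ) :
    (DirectSum.decompose 𝒜 (x : A) i : A) ∈ S.augIdeal := by
  classical
  have hx : S.aug (x : A) = 0 := x.2
  change S.aug _ = 0
  rcases eq_or_ne i 0 with rfl | hi
  · rw [← DirectSum.sum_support_decompose 𝒜 (x : A), map_sum] at hx
    by_cases h0 : (0 : ℤ) ∈ (DirectSum.decompose 𝒜 (x : A)).support
    · rwa [Finset.sum_eq_single_of_mem 0 h0
        (fun j _ hj => S.aug_of_ne j hj _ (SetLike.coe_mem _))] at hx
    · rw [DFinsupp.notMem_support_iff.mp h0]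
      simp
  · exact S.aug_of_ne i hi _ (SetLike.coe_mem _)

theorem isInternal_desusp : DirectSum.IsInternal S.desusp := by
  classical
  rw [DirectSum.isInternal_submodule_iff_iSupIndep_and_iSup_eq_top]
  constructor
  · have h1 : iSupIndep (fun i : ℤ => 𝒜 (i + 1)) :=
      (DirectSum.Decomposition.isInternal 𝒜).submodule_iSupIndep.comp (add_left_injective 1)
    intro i
    rw [Submodule.disjoint_def]
    intro x hx hx'
    refine Subtype.ext (Submodule.disjoint_def.mp (h1 i) (x : A) hx ?_)
    have h2 := Submodule.mem_map_of_mem (f := S.augIdeal.subtype) hx'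
    simp only [Submodule.map_iSup] at h2
    exact SetLike.le_def.mp (iSup₂_mono fun j _ => Submodule.map_comap_le _ _) h2
  · rw [eq_top_iff]
    rintro x -
    have hx : x = ∑ i ∈ (DirectSum.decompose 𝒜 (x : A)).support,
        (⟨_, S.coe_decompose_mem x i⟩ : S.augIdeal) := by
      apply Subtype.ext
      rw [Submodule.coe_sum]
      exact (DirectSum.sum_support_decompose 𝒜 (x : A)).symm
    rw [hx]
    refine Submodule.sum_mem _ (fun i _ => Submodule.mem_iSup_of_mem (i - 1) ?_)
    simp [desusp]

instance : DirectSum.Decomposition S.desusp :=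
  S.isInternal_desusp.chooseDecomposition

/-- The differential of `s⁻¹Ā`, which is `s⁻¹a ↦ - s⁻¹(d a)`. -/
def desuspD : S.augIdeal →ₗ[k] S.augIdeal :=
  -(S.d.restrict (p := S.augIdeal) (q := S.augIdeal) (fun x _ => S.aug_d x))

theorem mul_mem_augIdeal (x : A) (y : S.augIdeal) : x * (y : A) ∈ S.augIdeal := by
  have h : S.aug (y : A) = 0 := y.2
  simp [augIdeal, h]

/-- The operation `s⁻¹a, s⁻¹b ↦ (-1)^|a| s⁻¹(ab)`; note that `(-1)^|a| = -(-1)^|s⁻¹a|`. -/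
def desuspMul : S.augIdeal →ₗ[k] S.augIdeal →ₗ[k] S.augIdeal :=
  LinearMap.mk₂ k
    (fun x y => -⟨(degInvol S.desusp x : A) * (y : A), S.mul_mem_augIdeal _ y⟩)
    (fun x x' y => Subtype.ext (by
      simp only [map_add, Submodule.coe_neg, Submodule.coe_add, add_mul, neg_add]))
    (fun c x y => Subtype.ext (by
      simp only [map_smul, Submodule.coe_neg, Submodule.coe_smul, smul_mul_assoc, smul_neg]))
    (fun x y y' => Subtype.ext (by
      simp only [Submodule.coe_neg, Submodule.coe_add, mul_add, neg_add]))
    (fun c x y => Subtype.ext (by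
      simp only [Submodule.coe_neg, Submodule.coe_smul, mul_smul_comm, smul_neg]))

/-- The total differential of `𝓔(A)`, on representatives. -/
def eilD (n : ℕ+) (G : Digraph (Fin n)) :
    (⨂[k] _ : Fin n, S.augIdeal) →ₗ[k] Eil S.desusp :=
  eilClass S.desusp n G ∘ₗ termwise S.desusp S.desuspD +
    eilContract S.desusp S.desuspMul n G

/-- The total differential of the Harrison complex of `A`, on words. -/
def harrD (n : ℕ+) : (⨂[k] _ : Fin n, S.augIdeal) →ₗ[k] Harr S.desusp :=
  harrClass S.desusp n ∘ₗ termwise S.desusp S.desuspD +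
    harrContract S.desusp S.desuspMul n

end AugCDGA

end GraphLie

end

/-! Everything rests on one construction: to a digraph `G` on the positions of a word, assign the
sum `leSum` of all reorderings of the word, with Koszul signs, by linear extensions of `G`. Three
facts make it work. A disconnected digraph gives an element of the span of shuffles, because a
linear extension is a linear extension of two separate pieces followed by a shuffle of them
(`leSum_mem_harrisonShuffles`); the shuffle sums themselves belong to two disjoint chains. A linear
extension decides the order of any two vertices, so adding `a → b` and adding `b → a` to `H` gives
two sums with total `leSum H` (`leSum_addEdge_add`). A fork `a → b`, `a → c` splits into the chains
`a → b → c` and `a → c → b` (`leSum_fork`).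

Modulo shuffles, the second fact is the arrow-reversing relation, since a tree without one edge is
disconnected, and the third is then the Arnold relation. So `leSum` induces a map `graphToHarr` from
the graph model to the shuffle quotient. The long graph has only the identity as linear extension,
so `graphToHarr` undoes `bar`, and the kernel of `bar` lies in the shuffles. Conversely, the fork
identity holds in the graph model, so that every arborescence is the sum of the bar generators of
its linear extensions (`eilWeightClass_of_isArborescence`). Any tree becomes an arborescence, up to
sign, when its edges are turned away from a root; hence bar generators span. Two chains with their
first vertices joined in one direction or the other are arborescences that differ by an arrow
reversal; hence `bar` kills shuffles. Altogether the class of any tree is `bar` of its `leSum`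
(`eilWeightClass_eq_bar`).

For the second part, the bar construction is a differential graded coassociative coalgebra under
deconcatenation, so `Δ - τΔ` makes it a differential graded Lie coalgebra. Its structure passes to
the Harrison complex once the operations are known on sums over linear extensions. In the bar
differential of `leSum G`, adjacent letters not joined by an edge cancel in pairs by graded
commutativity, and the remaining terms are the sums over linear extensions of the contractions of
`G` (`sum_merge_leSum`). The cobracket of `leSum G` is a sum over cuts of `G`, where only cuts into
two connected parts survive (`harrCobracket_leSum`). For two disjoint chains both formulas give
zero, so the operations descend to the shuffle quotient. For a tree both formulas are the graph
operations, edge by edge.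

The structure on the graph model is therefore defined by transport along the isomorphism, and the
graph formulas are verified afterwards on all representatives; this includes their compatibility
with the relations. Characteristic zero enters through the directness of the gradings, which are
separated as eigenspaces of an operator that is `2 ^ i` in degree `i`. -/

noncomputable section

namespace GraphLie

universe u v

/-! ### Parities and Koszul signs -/

section Signs

variable (k : Type u) [Field k]

/-- The sign `(-1)^(εδ)` of the exchange of two factors of parities `ε` and `δ`. -/
def ksign (ε δ : ZMod 2) : k := if ε = 1 ∧ δ = 1 then -1 else 1

theorem ksign_comm (ε δ : ZMod 2) : ksign k ε δ = ksign k δ ε := by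
  simp only [ksign, and_comm]

theorem ksign_add_left (ε ε' δ : ZMod 2) :
    ksign k (ε + ε') δ = ksign k ε δ * ksign k ε' δ := by
  have h : ∀ x : ZMod 2, x = 0 ∨ x = 1 := by decide
  rcases h ε with rfl | rfl <;> rcases h ε' with rfl | rfl <;> rcases h δ with rfl | rfl <;>
    simp [ksign, show (1 : ZMod 2) + 1 = 0 by decide]

theorem ksign_add_right (ε δ δ' : ZMod 2) :
    ksign k ε (δ + δ') = ksign k ε δ * ksign k ε δ' := by
  simp only [ksign_comm k ε, ksign_add_left]

@[simp] theorem ksign_mul_self (ε δ : ZMod 2) : ksign k ε δ * ksign k ε δ = 1 := by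
  unfold ksign; split_ifs <;> simp

@[simp] theorem ksign_zero_left (δ : ZMod 2) : ksign k 0 δ = 1 := by simp [ksign]

@[simp] theorem ksign_zero_right (δ : ZMod 2) : ksign k δ 0 = 1 := by simp [ksign]

@[simp] theorem ksign_one_one : ksign k 1 1 = -1 := by simp [ksign]

theorem ksign_sum_left {ι : Type*} (s : Finset ι) (ε : ι → ZMod 2) (δ : ZMod 2) :
    ksign k (∑ i ∈ s, ε i) δ = ∏ i ∈ s, ksign k (ε i) δ := by
  classical
  induction s using Finset.induction_on with
  | empty => simp
  | insert a s ha ih => rw [Finset.sum_insert ha, Finset.prod_insert ha, ksign_add_left, ih]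

theorem ksign_sum_right {ι : Type*} (s : Finset ι) (ε : ι → ZMod 2) (δ : ZMod 2) :
    ksign k δ (∑ i ∈ s, ε i) = ∏ i ∈ s, ksign k δ (ε i) := by
  simp only [ksign_comm k δ, ksign_sum_left]

variable {I J K : Type} [Fintype I] [LinearOrder I] [LinearOrder J] [LinearOrder K]

theorem koszulSign_eq (e : I ≃ J) (ε : I → ZMod 2) :
    (koszulSign e ε : k) =
      ∏ i, ∏ j, if i < j ∧ e j < e i then ksign k (ε i) (ε j) else 1 := by
  unfold koszulSign ksign
  refine Finset.prod_congr rfl fun i _ => Finset.prod_congr rfl fun j _ => ?_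
  split_ifs <;> first | rfl | (exfalso; tauto)

/-- A product over ordered pairs as a product over unordered pairs. -/
theorem prod_prod_eq_prod_lt {M : Type*} [CommMonoid M] (g : I → I → M) (hg : ∀ i, g i i = 1) :
    ∏ i, ∏ j, g i j = ∏ i, ∏ j, if i < j then g i j * g j i else 1 := by
  have h1 : ∀ i j, g i j = (if i < j then g i j else 1) * (if j < i then g i j else 1) := by
    intro i j
    rcases lt_trichotomy i j with h | rfl | h
    · simp [h, h.asymm]
    · simp [hg]
    · simp [h, h.asymm]
  calc ∏ i, ∏ j, g i j
      = ∏ i, ∏ j, (if i < j then g i j else 1) * (if j < i then g i j else 1) :=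
        Finset.prod_congr rfl fun i _ => Finset.prod_congr rfl fun j _ => h1 i j
    _ = (∏ i, ∏ j, if i < j then g i j else 1) * ∏ j, ∏ i, (if j < i then g i j else 1) := by
        simp only [Finset.prod_mul_distrib]
        congr 1
        exact Finset.prod_comm
    _ = _ := by
        simp only [← Finset.prod_mul_distrib]
        refine Finset.prod_congr rfl fun i _ => Finset.prod_congr rfl fun j _ => ?_
        split_ifs <;> simp

/-- A pair of factors is inverted by the composite exactly when one of the two reorderings inverts
it and the other does not; a pair inverted by both contributes the square of a sign. -/
theorem koszulSign_trans [Fintype J] (e : I ≃ J) (f : J ≃ K) (ε : I → ZMod 2) :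
    (koszulSign (e.trans f) ε : k) = koszulSign e ε * koszulSign f (fun j => ε (e.symm j)) := by
  rw [koszulSign_eq, koszulSign_eq, koszulSign_eq]
  have h : (∏ i, ∏ j, if i < j ∧ f j < f i then
      ksign k (ε (e.symm i)) (ε (e.symm j)) else 1) =
      ∏ i, ∏ j, if e i < e j ∧ f (e j) < f (e i) then ksign k (ε i) (ε j) else 1 := by
    rw [← Equiv.prod_comp e]
    refine Finset.prod_congr rfl fun i _ => ?_
    rw [← Equiv.prod_comp e]
    simp only [Equiv.symm_apply_apply]
  rw [h]
  rw [prod_prod_eq_prod_lt (fun i j => if e i < e j ∧ f (e j) < f (e i) then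
    ksign k (ε i) (ε j) else 1) (by simp)]
  simp only [← Finset.prod_mul_distrib, Equiv.trans_apply]
  refine Finset.prod_congr rfl fun i _ => Finset.prod_congr rfl fun j _ => ?_
  by_cases hij : i < j
  · have h1 : e i ≠ e j := fun h => hij.ne (e.injective h)
    have h2 : f (e i) ≠ f (e j) := fun h => h1 (f.injective h)
    rcases lt_or_gt_of_ne h1 with h1 | h1 <;> rcases lt_or_gt_of_ne h2 with h2 | h2 <;>
      simp [hij, h1, h1.asymm, h2, h2.asymm, ksign_comm k (ε j) (ε i)]
  · simp [hij]

theorem koszulSign_of_strictMono (e : I ≃ J) (he : ∀ i j, i < j → e i < e j) (ε : I → ZMod 2) :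
    (koszulSign e ε : k) = 1 := by
  rw [koszulSign_eq]
  refine Finset.prod_eq_one fun i _ => Finset.prod_eq_one fun j _ => ?_
  rw [if_neg]
  rintro ⟨h1, h2⟩
  exact (he i j h1).asymm h2

/-- Change of the Koszul sign when the parity of one factor changes. -/
theorem koszulSign_update (e : I ≃ J) (ε : I → ZMod 2) (i : I) :
    (koszulSign e (Function.update ε i (ε i + 1)) : k) =
      koszulSign e ε * ∏ j, if (i < j ∧ e j < e i) ∨ (j < i ∧ e i < e j) then
        ksign k 1 (ε j) else 1 := by
  rw [koszulSign_eq, koszulSign_eq]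
  have h1 : ∀ a b : I, (if a < b ∧ e b < e a then
      ksign k (Function.update ε i (ε i + 1) a) (Function.update ε i (ε i + 1) b) else 1) =
      (if a < b ∧ e b < e a then ksign k (ε a) (ε b) else 1) *
      ((if a = i then (if i < b ∧ e b < e i then ksign k 1 (ε b) else 1) else 1) *
       (if b = i then (if a < i ∧ e i < e a then ksign k 1 (ε a) else 1) else 1)) := by
    intro a b
    by_cases hab : a < b ∧ e b < e a
    · by_cases ha : a = i
      · subst ha
        have hb : b ≠ a := hab.1.ne'
        simp [hab, hb, ksign_add_left]
      · by_cases hb : b = i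
        · subst hb
          simp [hab, ha, ksign_add_right, ksign_comm k _ 1]
        · simp [hab, ha, hb]
    · rw [if_neg hab, if_neg hab, one_mul]
      by_cases ha : a = i
      · subst ha
        rw [if_pos rfl, if_neg hab, one_mul]
        split_ifs with h2 h3
        · subst h2
          exact absurd h3.1 (lt_irrefl _)
        · rfl
        · rfl
      · rw [if_neg ha, one_mul]
        split_ifs with h2 h3
        · subst h2
          exact absurd h3 hab
        · rfl
        · rfl
  simp only [h1, Finset.prod_mul_distrib]
  congr 1
  have h2 : ∏ a, ∏ b, (if a = i then (if i < b ∧ e b < e i then ksign k 1 (ε b) else 1) else 1) =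
      ∏ b, if i < b ∧ e b < e i then ksign k 1 (ε b) else 1 := by
    rw [Finset.prod_comm]
    simp only [Finset.prod_ite_eq', Finset.mem_univ, if_true]
  rw [h2]
  simp only [Finset.prod_ite_eq', Finset.mem_univ, if_true]
  rw [← Finset.prod_mul_distrib]
  refine Finset.prod_congr rfl fun j _ => ?_
  rcases lt_trichotomy i j with h | rfl | h
  · simp [h, h.asymm]
  · simp
  · simp [h, h.asymm]

end Signs

/-! ### Homogeneous tensors -/

theorem tprod_smul {k : Type u} [Field k] {W : Type v} [AddCommGroup W] [Module k W] {I : Type}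
    [Fintype I] (c : I → k) (w : I → W) :
    PiTensorProduct.tprod k (fun i => c i • w i) = (∏ i, c i) • PiTensorProduct.tprod k w :=
  (PiTensorProduct.tprod k).map_smul_univ c w

section Homogeneous

variable {k : Type u} [Field k] {W : Type v} [AddCommGroup W] [Module k W]
  (𝒲 : ℤ → Submodule k W) [DirectSum.Decomposition 𝒲]

theorem parityProj_of_mem {i : ℤ} {x : W} (hx : x ∈ 𝒲 i) (ε : ZMod 2) :
    parityProj 𝒲 ε x = if (i : ZMod 2) = ε then x else 0 := by
  unfold parityProj
  rw [LinearMap.comp_apply, LinearEquiv.coe_coe, DirectSum.decomposeLinearEquiv_apply,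
    DirectSum.decompose_of_mem 𝒲 hx]
  erw [DirectSum.toModule_lof]
  split_ifs <;> simp

theorem degInvol_of_mem {i : ℤ} {x : W} (hx : x ∈ 𝒲 i) :
    degInvol 𝒲 x = ksign k 1 i • x := by
  unfold degInvol
  rw [LinearMap.sub_apply, parityProj_of_mem 𝒲 hx, parityProj_of_mem 𝒲 hx]
  have h : ∀ x : ZMod 2, x = 0 ∨ x = 1 := by decide
  rcases h i with h | h <;> simp [h, ksign]

theorem span_homogeneous :
    Submodule.span k (Set.range (fun x : Σ i, 𝒲 i => (x.2 : W))) = ⊤ := by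
  classical
  rw [eq_top_iff]
  rintro x -
  rw [← DirectSum.sum_support_decompose 𝒲 x]
  exact Submodule.sum_mem _ fun i _ => Submodule.subset_span ⟨⟨i, _⟩, rfl⟩

theorem linearMap_ext_homogeneous {N : Type*} [AddCommGroup N] [Module k N] {f g : W →ₗ[k] N}
    (h : ∀ i, ∀ x ∈ 𝒲 i, f x = g x) : f = g := by
  refine LinearMap.ext_on_range (span_homogeneous 𝒲) fun x => h x.1 _ x.2.2

/-- Identities between operators on tensors are checked on words with homogeneous letters, where
every Koszul sign is an explicit scalar. -/
theorem tensor_ext_homogeneous {I : Type} [Finite I] {N : Type*} [AddCommGroup N] [Module k N]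
    {f g : (⨂[k] _ : I, W) →ₗ[k] N}
    (h : ∀ (p : I → ℤ) (w : I → W), (∀ i, w i ∈ 𝒲 (p i)) →
      f (PiTensorProduct.tprod k w) = g (PiTensorProduct.tprod k w)) : f = g := by
  refine PiTensorProduct.ext_of_span_eq_top (γ := fun _ : I => Σ i, 𝒲 i)
    (g := fun _ (x : Σ i, 𝒲 i) => (x.2 : W)) (fun _ => span_homogeneous 𝒲) fun j => ?_
  exact h (fun i => (j i).1) _ fun i => (j i).2.2

variable {I J K : Type} [Fintype I] [LinearOrder I] [LinearOrder J] [LinearOrder K]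

/-- In the sum over all parity vectors that defines `koszul`, only the actual parity vector of the
word survives the projections. -/
theorem koszul_tprod (e : I ≃ J) {p : I → ℤ} {w : I → W} (hw : ∀ i, w i ∈ 𝒲 (p i)) :
    koszul 𝒲 e (PiTensorProduct.tprod k w) =
      (koszulSign e (fun i => (p i : ZMod 2)) : k) •
        PiTensorProduct.tprod k (fun j => w (e.symm j)) := by
  unfold koszul
  rw [LinearMap.sum_apply, Finset.sum_eq_single (fun i => (p i : ZMod 2))]
  · rw [LinearMap.smul_apply, LinearMap.comp_apply, PiTensorProduct.map_tprod,
      LinearEquiv.coe_coe, PiTensorProduct.reindex_tprod]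
    simp [parityProj_of_mem 𝒲 (hw _)]
  · intro ε _ hε
    obtain ⟨i, hi⟩ := Function.ne_iff.mp hε
    rw [LinearMap.smul_apply, LinearMap.comp_apply, PiTensorProduct.map_tprod,
      (PiTensorProduct.tprod k).map_coord_zero i]
    · simp
    · rw [parityProj_of_mem 𝒲 (hw i), if_neg (Ne.symm hi)]
  · simp

theorem koszul_trans [Fintype J] (e : I ≃ J) (f : J ≃ K) :
    koszul 𝒲 (e.trans f) = koszul 𝒲 f ∘ₗ koszul 𝒲 e := by
  refine tensor_ext_homogeneous 𝒲 fun p w hw => ?_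
  rw [LinearMap.comp_apply, koszul_tprod 𝒲 _ hw, koszul_tprod 𝒲 _ hw, map_smul,
    koszul_tprod 𝒲 f (p := fun j => p (e.symm j)) (fun j => hw _), smul_smul, koszulSign_trans]
  rfl

/-- Order-preserving renumberings carry no sign. This brings them under the functoriality
`koszul_trans`. -/
theorem koszul_of_strictMono (e : I ≃ J) (he : ∀ i j, i < j → e i < e j) :
    koszul 𝒲 e = (PiTensorProduct.reindex k (fun _ : I => W) e).toLinearMap := by
  refine tensor_ext_homogeneous 𝒲 fun p w hw => ?_
  rw [koszul_tprod 𝒲 _ hw, koszulSign_of_strictMono k e he, one_smul, LinearEquiv.coe_coe,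
    PiTensorProduct.reindex_tprod]

@[simp] theorem koszul_refl : koszul 𝒲 (Equiv.refl I) = LinearMap.id := by
  rw [koszul_of_strictMono 𝒲 _ (fun _ _ h => h), PiTensorProduct.reindex_refl]
  rfl

end Homogeneous

/-! ### Operators of degree one and the Koszul action -/

section Operators

variable {k : Type u} [Field k] {W : Type v} [AddCommGroup W] [Module k W]
  (𝒲 : ℤ → Submodule k W) [DirectSum.Decomposition 𝒲]

theorem termwise_tprod {I : Type} [Fintype I] [LinearOrder I] (D : W →ₗ[k] W) {p : I → ℤ}
    {w : I → W} (hw : ∀ i, w i ∈ 𝒲 (p i)) :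
    termwise 𝒲 D (PiTensorProduct.tprod k w) =
      ∑ i, (∏ j, if j < i then ksign k 1 (p j) else 1) •
        PiTensorProduct.tprod k (Function.update w i (D (w i))) := by
  unfold termwise
  rw [LinearMap.sum_apply]
  refine Finset.sum_congr rfl fun i _ => ?_
  rw [PiTensorProduct.map_tprod, ← tprod_smul]
  congr 1
  funext j
  rcases lt_trichotomy j i with h | rfl | h
  · rw [if_pos h, if_pos h, degInvol_of_mem 𝒲 (hw j), Function.update_of_ne h.ne]
  · simp
  · simp [h.not_gt, h.ne']

/-- Raising the degree of one letter changes the sign of the reordering by the odd letters that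
change sides with it. The same letters make the difference between the signs of `D` passing what
stands before it in the source and in the target. -/
theorem termwise_koszul {I J : Type} [Fintype I] [LinearOrder I] [Fintype J] [LinearOrder J]
    (D : W →ₗ[k] W) (hD : ∀ i, ∀ x ∈ 𝒲 i, D x ∈ 𝒲 (i + 1)) (e : I ≃ J) :
    termwise 𝒲 D ∘ₗ koszul 𝒲 e = koszul 𝒲 e ∘ₗ termwise 𝒲 D := by
  refine tensor_ext_homogeneous 𝒲 fun p w hw => ?_
  rw [LinearMap.comp_apply, LinearMap.comp_apply, koszul_tprod 𝒲 e hw, map_smul,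
    termwise_tprod 𝒲 D (p := fun j => p (e.symm j)) (fun j => hw _), termwise_tprod 𝒲 D hw,
    map_sum, Finset.smul_sum, ← Equiv.sum_comp e]
  refine Finset.sum_congr rfl fun i _ => ?_
  have h1 : ∀ j, Function.update w i (D (w i)) j ∈ 𝒲 (Function.update p i (p i + 1) j) := by
    intro j
    rcases eq_or_ne j i with rfl | h
    · simpa using hD _ _ (hw j)
    · simpa [h] using hw j
  have h2 : (fun j => ((Function.update p i (p i + 1) j : ℤ) : ZMod 2)) =
      Function.update (fun j => (p j : ZMod 2)) i ((p i : ZMod 2) + 1) := by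
    funext j
    rcases eq_or_ne j i with rfl | h
    · simp
    · simp [h]
  rw [map_smul, koszul_tprod 𝒲 e h1, smul_smul, smul_smul, h2,
    koszulSign_update k e (fun j => (p j : ZMod 2)) i]
  congr 1
  · rw [mul_left_comm]
    congr 1
    rw [← Equiv.prod_comp e, ← Finset.prod_mul_distrib]
    refine Finset.prod_congr rfl fun j _ => ?_
    simp only [Equiv.symm_apply_apply]
    rcases lt_trichotomy i j with h | rfl | h
    · have h3 : e i ≠ e j := fun h' => h.ne (e.injective h')
      rcases lt_or_gt_of_ne h3 with h3 | h3 <;> simp [h, h.asymm, h3, h3.asymm]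
    · simp
    · have h3 : e i ≠ e j := fun h' => h.ne' (e.injective h')
      rcases lt_or_gt_of_ne h3 with h3 | h3 <;> simp [h, h.asymm, h3, h3.asymm]
  · congr 1
    funext j
    rcases eq_or_ne j (e i) with rfl | h
    · simp
    · have h' : e.symm j ≠ i := fun h' => h (by rw [← h', Equiv.apply_symm_apply])
      simp [h, h']

/-- The permutation that moves the block `0, 1` as `σ` moves `0`, and the other letters as `σ`
moves them. -/
def expandPerm {n : ℕ} (σ : Equiv.Perm (Fin (n + 1))) : Equiv.Perm (Fin (n + 2)) :=
  (finSuccEquiv (n + 1)).trans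
    ((Equiv.optionCongr σ).trans (finSuccEquiv' (σ 0).castSucc).symm)

variable {n : ℕ}

@[simp] theorem expandPerm_zero (σ : Equiv.Perm (Fin (n + 1))) :
    expandPerm σ 0 = (σ 0).castSucc := by simp [expandPerm]

@[simp] theorem expandPerm_succ (σ : Equiv.Perm (Fin (n + 1))) (j : Fin (n + 1)) :
    expandPerm σ j.succ = (σ 0).castSucc.succAbove (σ j) := by simp [expandPerm]

theorem expandPerm_one (σ : Equiv.Perm (Fin (n + 1))) :
    expandPerm σ 1 = (σ 0).succ := by
  have h := expandPerm_succ σ 0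
  rwa [Fin.succ_zero_eq_one, Fin.succAbove_castSucc_self] at h

theorem merge_tprod (L : W →ₗ[k] W) (m : W →ₗ[k] W →ₗ[k] W) (i : Fin (n + 1))
    (w : Fin (n + 2) → W) :
    merge L m i (PiTensorProduct.tprod k w) = PiTensorProduct.tprod k (mergeFun L m i w) := by
  unfold merge
  rw [PiTensorProduct.lift.tprod]
  rfl

theorem mergeFun_zero (L : W →ₗ[k] W) (m : W →ₗ[k] W →ₗ[k] W) (w : Fin (n + 2) → W) :
    mergeFun L m 0 w = Fin.cons (m (w 0) (w 1)) (fun j : Fin n => w j.succ.succ) := by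
  funext j
  refine Fin.cases ?_ (fun j => ?_) j
  · simp [mergeFun]
  · simp [mergeFun]

theorem merge_degInvol_tprod (m : W →ₗ[k] W →ₗ[k] W) (i : Fin (n + 1)) {p : Fin (n + 2) → ℤ}
    {w : Fin (n + 2) → W} (hw : ∀ i, w i ∈ 𝒲 (p i)) :
    merge (degInvol 𝒲) m i (PiTensorProduct.tprod k w) =
      (∏ j, if j < i.castSucc then ksign k 1 (p j) else 1) •
        PiTensorProduct.tprod k (mergeFun LinearMap.id m i w) := by
  rw [merge_tprod]
  have h : mergeFun (degInvol 𝒲) m i w = fun j : Fin (n + 1) =>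
      (if j < i then ksign k 1 (p j.castSucc) else 1) • mergeFun LinearMap.id m i w j := by
    funext j
    simp only [mergeFun]
    split_ifs
    · rw [degInvol_of_mem 𝒲 (hw _)]; rfl
    · rw [one_smul]
    · rw [one_smul]
  rw [h, tprod_smul, Fin.prod_univ_castSucc (n := n + 1)]
  congr 1
  rw [if_neg (not_lt.mpr (Fin.le_last _)), mul_one]
  simp only [Fin.castSucc_lt_castSucc_iff]

theorem expandPerm_succ_lt_iff (σ : Equiv.Perm (Fin (n + 1))) (j : Fin n) :
    expandPerm σ j.succ.succ < (σ 0).castSucc ↔ σ j.succ < σ 0 := by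
  rw [expandPerm_succ, Fin.succAbove_lt_iff_castSucc_lt, Fin.castSucc_lt_castSucc_iff]

/-- The two letters of the block are adjacent, so any other letter comes before both or after both.
-/
theorem expandPerm_lt_succ_iff (σ : Equiv.Perm (Fin (n + 1))) (j : Fin n) :
    expandPerm σ j.succ.succ < (σ 0).succ ↔ σ j.succ < σ 0 := by
  have h : expandPerm σ j.succ.succ ≠ (σ 0).castSucc := by
    rw [← expandPerm_zero]
    exact fun h => absurd ((expandPerm σ).injective h) (Fin.succ_ne_zero _)
  rw [← expandPerm_succ_lt_iff, Fin.lt_def, Fin.lt_def]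
  have h' : (expandPerm σ j.succ.succ : ℕ) ≠ σ 0 := fun h' => h (Fin.ext h')
  simp only [Fin.val_succ, Fin.val_castSucc]
  omega

/-- The merged letter has parity `ε 0 + ε 1 + 1`, since the merging operation has degree one.
Letters that overtake the block give the part `ε 0 + ε 1` in the first factor, and the summand `1`
in the second factor, where the operation passes them. -/
theorem koszulSign_expandPerm (σ : Equiv.Perm (Fin (n + 1))) (ε : Fin (n + 2) → ZMod 2) :
    (koszulSign (expandPerm σ) ε : k) *
      (∏ j, if expandPerm σ j < (σ 0).castSucc then ksign k 1 (ε j) else 1) =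
      koszulSign σ (Fin.cons (ε 0 + ε 1 + 1) (fun j : Fin n => ε j.succ.succ)) := by
  rw [koszulSign_eq, koszulSign_eq]
  have e1 := expandPerm_one σ
  have h1 : (σ 0).castSucc < (σ 0).succ := Fin.castSucc_lt_succ
  have h3 : ∀ i : Fin n, ¬ i.succ.succ < (1 : Fin (n + 2)) := fun i => by simp [Fin.lt_def]
  have h2 : ∀ i j : Fin n, expandPerm σ i.succ.succ < expandPerm σ j.succ.succ ↔
      σ i.succ < σ j.succ := by
    intro i j
    rw [expandPerm_succ, expandPerm_succ, Fin.succAbove_lt_succAbove_iff]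
  simp only [Fin.prod_univ_succ, Fin.cons_zero, Fin.cons_succ, expandPerm_succ_lt_iff,
    expandPerm_lt_succ_iff, h2, e1, expandPerm_zero, lt_irrefl, false_and, and_false, if_false,
    Fin.succ_pos, true_and, h1.asymm, h3, one_mul, Fin.succ_lt_succ_iff,
    Fin.not_lt_zero, Fin.succ_zero_eq_one]
  rw [mul_comm]
  simp only [← mul_assoc, ← Finset.prod_mul_distrib]
  refine Finset.prod_congr rfl fun j _ => ?_
  congr 1
  split_ifs
  · rw [ksign_add_left, ksign_add_left]; ring
  · simp

variable {m : W →ₗ[k] W →ₗ[k] W}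

/-- This trades a merging in the middle of a word, as in the bar differential, for a merging at the
front, as in the contraction of an edge. -/
theorem merge_koszul_expandPerm (hm : ∀ i j, ∀ x ∈ 𝒲 i, ∀ y ∈ 𝒲 j, m x y ∈ 𝒲 (i + j + 1))
    (σ : Equiv.Perm (Fin (n + 1))) :
    merge (degInvol 𝒲) m (σ 0) ∘ₗ koszul 𝒲 (expandPerm σ) =
      koszul 𝒲 σ ∘ₗ merge LinearMap.id m 0 := by
  refine tensor_ext_homogeneous 𝒲 fun p w hw => ?_
  rw [LinearMap.comp_apply, LinearMap.comp_apply, koszul_tprod 𝒲 _ hw, map_smul,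
    merge_degInvol_tprod 𝒲 m (σ 0) (p := fun j => p ((expandPerm σ).symm j)) (fun j => hw _),
    smul_smul, merge_tprod]
  have h1 : ∀ j, mergeFun LinearMap.id m 0 w j ∈
      𝒲 ((Fin.cons (p 0 + p 1 + 1) (fun j : Fin n => p j.succ.succ) : Fin (n + 1) → ℤ) j) := by
    rw [mergeFun_zero]
    intro j
    refine Fin.cases ?_ (fun j => ?_) j
    · exact hm _ _ _ (hw 0) _ (hw 1)
    · exact hw _
  rw [koszul_tprod 𝒲 σ h1]
  congr 1
  · rw [← Equiv.prod_comp (expandPerm σ)]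
    simp only [Equiv.symm_apply_apply]
    rw [koszulSign_expandPerm]
    congr 1
    funext j
    refine Fin.cases ?_ (fun j => ?_) j
    · simp
    · simp
  · congr 1
    funext j
    obtain ⟨x, rfl⟩ := σ.surjective j
    rw [Equiv.symm_apply_apply, mergeFun_zero]
    refine Fin.cases ?_ (fun y => ?_) x
    · have h3 : (expandPerm σ).symm (σ 0).castSucc = 0 := by
        rw [← expandPerm_zero, Equiv.symm_apply_apply]
      have h4 : (expandPerm σ).symm (σ 0).succ = 1 := by
        rw [← expandPerm_one, Equiv.symm_apply_apply]
      simp [mergeFun, h3, h4]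
    · have h3 : σ y.succ ≠ σ 0 := fun h => Fin.succ_ne_zero _ (σ.injective h)
      have h5 := expandPerm_succ σ y.succ
      rcases lt_or_gt_of_ne h3 with h4 | h4
      · rw [Fin.succAbove_of_castSucc_lt _ _ (Fin.castSucc_lt_castSucc_iff.mpr h4)] at h5
        have h6 : (expandPerm σ).symm (σ y.succ).castSucc = y.succ.succ := by
          rw [← h5, Equiv.symm_apply_apply]
        simp [mergeFun, h4, h6]
      · rw [Fin.succAbove_of_le_castSucc _ _ (Fin.castSucc_le_castSucc_iff.mpr h4.le)] at h5
        have h6 : (expandPerm σ).symm (σ y.succ).succ = y.succ.succ := by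
          rw [← h5, Equiv.symm_apply_apply]
        simp [mergeFun, h4.asymm, h3, h6]

/-- The Koszul sign of the exchange cancels the one in `hms`, and the extra `-1` of a commutative
product after desuspension remains. -/
theorem merge_koszul_swap_zero_one
    (hms : ∀ i j, ∀ x ∈ 𝒲 i, ∀ y ∈ 𝒲 j, m x y = -(ksign k i j • m y x)) :
    merge LinearMap.id m 0 ∘ₗ koszul 𝒲 (Equiv.swap (0 : Fin (n + 2)) 1) =
      -merge LinearMap.id m 0 := by
  refine tensor_ext_homogeneous 𝒲 fun p w hw => ?_
  rw [LinearMap.comp_apply, LinearMap.neg_apply, koszul_tprod 𝒲 _ hw, map_smul, merge_tprod,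
    merge_tprod, mergeFun_zero, mergeFun_zero]
  have h1 : (koszulSign (Equiv.swap (0 : Fin (n + 2)) 1) (fun i => (p i : ZMod 2)) : k) =
      ksign k (p 0) (p 1) := by
    have h3 : ∀ i : Fin n, Equiv.swap (0 : Fin (n + 2)) 1 i.succ.succ = i.succ.succ := fun i =>
      Equiv.swap_apply_of_ne_of_ne (Fin.succ_ne_zero _) (by simp [Fin.ext_iff])
    have h4 : ∀ i : Fin n, ¬ i.succ.succ < (1 : Fin (n + 2)) := by
      intro i; simp [Fin.lt_def]
    rw [koszulSign_eq]
    simp only [Fin.prod_univ_succ, Fin.succ_zero_eq_one, h3, Equiv.swap_apply_left,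
      Equiv.swap_apply_right, h4, Fin.not_lt_zero, and_false, false_and, if_false, one_mul, mul_one,
      Finset.prod_const_one, Fin.succ_pos, and_true, Fin.succ_lt_succ_iff]
    have h5 : ∀ i j : Fin n, ¬ (i < j ∧ j < i) := fun i j h => h.1.asymm h.2
    simp [h5]
  have h2 : (Fin.cons (m (w 0) (w 1)) (fun j : Fin n => w j.succ.succ) : Fin (n + 1) → W) =
      Function.update (Fin.cons (m (w 1) (w 0)) (fun j : Fin n => w j.succ.succ)) 0
        ((-ksign k (p 0) (p 1)) • m (w 1) (w 0)) := by
    rw [hms _ _ _ (hw 0) _ (hw 1), neg_smul, Fin.update_cons_zero]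
  have h3 : (fun j : Fin n => w ((Equiv.swap (0 : Fin (n + 2)) 1).symm j.succ.succ)) =
      fun j => w j.succ.succ := by
    funext j
    rw [Equiv.symm_swap, Equiv.swap_apply_of_ne_of_ne (Fin.succ_ne_zero _)
      (by simp [Fin.ext_iff])]
  rw [h1, h2, (PiTensorProduct.tprod k).map_update_smul, Fin.update_cons_zero, h3]
  simp

/-- Conjugation by `expandPerm σ` with `σ 0 = i` moves the two letters to the front. This sign is
the source of the cancellations in `sum_merge_leSum`. -/
theorem merge_koszul_swap (hm : ∀ i j, ∀ x ∈ 𝒲 i, ∀ y ∈ 𝒲 j, m x y ∈ 𝒲 (i + j + 1))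
    (hms : ∀ i j, ∀ x ∈ 𝒲 i, ∀ y ∈ 𝒲 j, m x y = -(ksign k i j • m y x)) (i : Fin (n + 1)) :
    merge (degInvol 𝒲) m i ∘ₗ koszul 𝒲 (Equiv.swap i.castSucc i.succ) =
      -merge (degInvol 𝒲) m i := by
  obtain ⟨σ, hσ⟩ : ∃ σ : Equiv.Perm (Fin (n + 1)), σ 0 = i := ⟨Equiv.swap 0 i, by simp⟩
  have h1 := merge_koszul_expandPerm 𝒲 hm σ
  rw [hσ] at h1
  set e := expandPerm σ
  have h2 : Equiv.swap i.castSucc i.succ = e.symm.trans ((Equiv.swap 0 1).trans e) := by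
    have h := Equiv.symm_trans_swap_trans (0 : Fin (n + 2)) 1 e
    rw [show e 0 = i.castSucc by rw [← hσ]; exact expandPerm_zero σ,
      show e 1 = i.succ by rw [← hσ]; exact expandPerm_one σ] at h
    rw [← h]; rfl
  have h3 : merge (degInvol 𝒲) m i = (koszul 𝒲 σ ∘ₗ merge LinearMap.id m 0) ∘ₗ koszul 𝒲 e.symm := by
    rw [← h1, LinearMap.comp_assoc, ← koszul_trans]
    simp
  rw [h2, koszul_trans, koszul_trans, ← LinearMap.comp_assoc, ← LinearMap.comp_assoc, h1,
    LinearMap.comp_assoc _ _ (koszul 𝒲 σ), merge_koszul_swap_zero_one 𝒲 hms, h3]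
  simp only [LinearMap.comp_neg, LinearMap.neg_comp]

end Operators

/-! ### Unshuffles and the Koszul action -/

section Unshuffle

open scoped Classical in
theorem prod_subtype_mul_prod_subtype {I : Type} [Fintype I] {M : Type*} [CommMonoid M] (T : Set I) (f : I → M) :
    ∏ i, f i = (∏ i : {i // i ∈ T}, f i) * ∏ i : {i // ¬ i ∈ T}, f i :=
  (Fintype.prod_subtype_mul_prod_subtype (fun i => i ∈ T) f).symm

variable {k : Type u} [Field k] {W : Type v} [AddCommGroup W] [Module k W]
  (𝒲 : ℤ → Submodule k W) [DirectSum.Decomposition 𝒲]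

variable {I J : Type} [Fintype I] [LinearOrder I] [Fintype J] [LinearOrder J]

/-- The Koszul sign of an unshuffle. -/
def unshuffleSign (T : Set I) (ε : I → ZMod 2) : k :=
  open scoped Classical in
  koszulSign ((Equiv.sumCompl (fun i => i ∈ T)).symm.trans toLex) ε

open scoped Classical in
theorem unshuffle_tprod (T : Set I) {p : I → ℤ} {w : I → W} (hw : ∀ i, w i ∈ 𝒲 (p i)) :
    unshuffle 𝒲 T (PiTensorProduct.tprod k w) =
      (unshuffleSign T (fun i => (p i : ZMod 2)) : k) •
        (PiTensorProduct.tprod k (fun i : {i // i ∈ T} => w i) ⊗ₜ[k]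
          PiTensorProduct.tprod k (fun i : {i // ¬ i ∈ T} => w i)) := by
  unfold unshuffle
  rw [LinearMap.comp_apply, LinearMap.comp_apply, koszul_tprod 𝒲 _ hw, map_smul, map_smul]
  congr 1
  rw [LinearEquiv.coe_coe, LinearEquiv.coe_coe, PiTensorProduct.reindex_tprod,
    LinearEquiv.symm_apply_eq, PiTensorProduct.tmulEquiv_apply]
  congr 1
  funext i
  rcases i with i | i <;> rfl

open scoped Classical in
theorem unshuffleSign_eq (T : Set I) (ε : I → ZMod 2) :
    (unshuffleSign T ε : k) =
      ∏ i, ∏ j, if i < j ∧ j ∈ T ∧ i ∉ T then ksign k (ε i) (ε j) else 1 := by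
  unfold unshuffleSign
  rw [koszulSign_eq]
  refine Finset.prod_congr rfl fun i _ => Finset.prod_congr rfl fun j _ => ?_
  refine if_congr (and_congr_right fun hij => ?_) rfl rfl
  simp only [Equiv.trans_apply]
  by_cases hi : i ∈ T <;> by_cases hj : j ∈ T
  · rw [Equiv.sumCompl_symm_apply_of_pos hi, Equiv.sumCompl_symm_apply_of_pos hj]
    simp [hi, hij.le]
  · rw [Equiv.sumCompl_symm_apply_of_pos hi, Equiv.sumCompl_symm_apply_of_neg hj]
    simp [hi]
  · rw [Equiv.sumCompl_symm_apply_of_neg hi, Equiv.sumCompl_symm_apply_of_pos hj]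
    simp [hi, hj]
  · rw [Equiv.sumCompl_symm_apply_of_neg hi, Equiv.sumCompl_symm_apply_of_neg hj]
    simp [hj, hij.le]

-- An inversion caused by `e` concerns two letters of `T`, two letters outside `T`, or a mixed pair.
-- The first two kinds are the signs of the restricted reorderings, the mixed ones are the
-- difference between the two unshuffle signs.
open scoped Classical in
theorem unshuffle_koszul (e : I ≃ J) {S : Set J} {T : Set I} (h : ∀ i, i ∈ T ↔ e i ∈ S) :
    unshuffle 𝒲 S ∘ₗ koszul 𝒲 e =
      TensorProduct.map (koszul 𝒲 (e.subtypeEquiv h))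
        (koszul 𝒲 (e.subtypeEquiv fun i => not_congr (h i))) ∘ₗ unshuffle 𝒲 T := by
  refine tensor_ext_homogeneous 𝒲 fun p w hw => ?_
  rw [LinearMap.comp_apply, LinearMap.comp_apply, koszul_tprod 𝒲 e hw, map_smul,
    unshuffle_tprod 𝒲 S (p := fun j => p (e.symm j)) (fun j => hw _), unshuffle_tprod 𝒲 T hw,
    map_smul, TensorProduct.map_tmul, 
    koszul_tprod 𝒲 _ (p := fun i : {i // i ∈ T} => p i) (w := fun i => w i) (fun i => hw _),
    koszul_tprod 𝒲 _ (p := fun i : {i // ¬ i ∈ T} => p i) (w := fun i => w i) (fun i => hw _),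
    TensorProduct.smul_tmul_smul,
    smul_smul, smul_smul]
  congr 1
  have key : (unshuffleSign S (fun j => ((p (e.symm j) : ℤ) : ZMod 2)) : k) =
      ∏ i, ∏ j, if e i < e j ∧ j ∈ T ∧ i ∉ T then ksign k (p i) (p j) else 1 := by
    rw [unshuffleSign_eq, ← Equiv.prod_comp e]
    refine Finset.prod_congr rfl fun i _ => ?_
    rw [← Equiv.prod_comp e]
    simp only [Equiv.symm_apply_apply, h]
  rw [key, unshuffleSign_eq, koszulSign_eq, koszulSign_eq, koszulSign_eq]
  -- Products over pairs in `T` or outside `T` become products over all pairs, so that the signs can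
  -- be compared pair by pair.
  have h1 : ∀ (f : I → I → k), (∏ i : {i // i ∈ T}, ∏ j : {i // i ∈ T}, f i j) =
      ∏ i, ∏ j, if i ∈ T ∧ j ∈ T then f i j else 1 := by
    intro f
    rw [prod_subtype_mul_prod_subtype T (fun i => ∏ j, if i ∈ T ∧ j ∈ T then f i j else 1)]
    rw [Finset.prod_eq_one (s := (Finset.univ : Finset {i // ¬ i ∈ T}))
      (fun i _ => Finset.prod_eq_one fun j _ => if_neg fun h => i.2 h.1), mul_one]
    refine Finset.prod_congr rfl fun i _ => ?_
    rw [prod_subtype_mul_prod_subtype T (fun j => if (i : I) ∈ T ∧ j ∈ T then f i j else 1)]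
    rw [Finset.prod_eq_one (s := (Finset.univ : Finset {i // ¬ i ∈ T}))
      (fun j _ => if_neg fun h => j.2 h.2), mul_one]
    exact Finset.prod_congr rfl fun j _ => (if_pos ⟨i.2, j.2⟩).symm
  have h2 : ∀ (f : I → I → k), (∏ i : {i // ¬ i ∈ T}, ∏ j : {i // ¬ i ∈ T}, f i j) =
      ∏ i, ∏ j, if i ∉ T ∧ j ∉ T then f i j else 1 := by
    intro f
    rw [prod_subtype_mul_prod_subtype T (fun i => ∏ j, if i ∉ T ∧ j ∉ T then f i j else 1)]
    rw [Finset.prod_eq_one (s := (Finset.univ : Finset {i // i ∈ T}))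
      (fun i _ => Finset.prod_eq_one fun j _ => if_neg fun h => h.1 i.2), one_mul]
    refine Finset.prod_congr rfl fun i _ => ?_
    rw [prod_subtype_mul_prod_subtype T (fun j => if (i : I) ∉ T ∧ j ∉ T then f i j else 1)]
    rw [Finset.prod_eq_one (s := (Finset.univ : Finset {i // i ∈ T}))
      (fun j _ => if_neg fun h => h.2 j.2), one_mul]
    exact Finset.prod_congr rfl fun j _ => (if_pos ⟨i.2, j.2⟩).symm
  have h3 := h1 (fun i j => if i < j ∧ e j < e i then ksign k (p i) (p j) else 1)
  have h4 := h2 (fun i j => if i < j ∧ e j < e i then ksign k (p i) (p j) else 1)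
  have h5 : (∏ i : {i // i ∈ T}, ∏ j : {i // i ∈ T}, if i < j ∧
      (e.subtypeEquiv h) j < (e.subtypeEquiv h) i then ksign k (p i) (p j) else 1) = _ := h3
  have h6 : (∏ i : {i // ¬ i ∈ T}, ∏ j : {i // ¬ i ∈ T}, if i < j ∧
      (e.subtypeEquiv (q := fun j => ¬ j ∈ S) fun i => not_congr (h i)) j <
        (e.subtypeEquiv (q := fun j => ¬ j ∈ S) fun i => not_congr (h i)) i then
      ksign k (p i) (p j) else 1) = _ := h4
  rw [h5, h6]
  rw [prod_prod_eq_prod_lt (fun i j => if e i < e j ∧ j ∈ T ∧ i ∉ T then ksign k (p i) (p j) else 1)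
    (by simp)]
  simp only [← Finset.prod_mul_distrib]
  refine Finset.prod_congr rfl fun i _ => Finset.prod_congr rfl fun j _ => ?_
  by_cases hij : i < j
  · have h7 : e i ≠ e j := fun h => hij.ne (e.injective h)
    rcases lt_or_gt_of_ne h7 with h7 | h7 <;> by_cases hi : i ∈ T <;> by_cases hj : j ∈ T <;>
      simp [hij, h7, h7.asymm, hi, hj, ksign_comm k (p j) (p i)]
  · simp [hij]

end Unshuffle

/-! ### Connected digraphs and trees -/

section Connected

variable {I J : Type}

/-- A set of vertices without edges to its complement. -/
def Separating (G : Digraph I) (S : Set I) : Prop := ∀ a b, G.Adj a b → (a ∈ S ↔ b ∈ S)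

/-- A digraph without nontrivial separating sets of vertices. -/
def Conn (G : Digraph I) : Prop := ∀ S, Separating G S → S.Nonempty → S = Set.univ

theorem Separating.compl {G : Digraph I} {S : Set I} (h : Separating G S) : Separating G Sᶜ :=
  fun a b hab => not_congr (h a b hab)

/-- A separating set may be replaced by its complement, so sets containing a base point suffice. -/
theorem conn_of_forall_mem {G : Digraph I} (a : I)
    (h : ∀ S, Separating G S → a ∈ S → S = Set.univ) : Conn G := by
  intro S hS hne
  by_cases ha : a ∈ S
  · exact h S hS ha
  · have h1 := h Sᶜ hS.compl ha
    rw [Set.compl_univ_iff] at h1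
    exact absurd h1 hne.ne_empty

theorem toSimpleGraphInclusive_adj {G : Digraph I} {a b : I} :
    G.toSimpleGraphInclusive.Adj a b ↔ a ≠ b ∧ (G.Adj a b ∨ G.Adj b a) := Iff.rfl

theorem Separating.mem_of_reachable {G : Digraph I} {S : Set I} (h : Separating G S) {a b : I}
    (hab : G.toSimpleGraphInclusive.Reachable a b) (ha : a ∈ S) : b ∈ S := by
  obtain ⟨p⟩ := hab
  induction p with
  | nil => exact ha
  | cons hadj _ ih =>
    refine ih ?_
    rcases hadj.2 with h1 | h1
    · exact (h _ _ h1).mp ha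
    · exact (h _ _ h1).mpr ha

theorem separating_setOf_reachable (G : Digraph I) (a : I) :
    Separating G {v | G.toSimpleGraphInclusive.Reachable a v} := by
  intro x y hxy
  rcases eq_or_ne x y with rfl | hne
  · rfl
  · have h1 : G.toSimpleGraphInclusive.Adj x y := ⟨hne, Or.inl hxy⟩
    exact ⟨fun h => h.trans h1.reachable, fun h => h.trans h1.symm.reachable⟩

theorem conn_iff_connected [Nonempty I] {G : Digraph I} :
    Conn G ↔ G.toSimpleGraphInclusive.Connected := by
  constructor
  · intro h
    refine ⟨fun a b => ?_⟩
    have h1 := h _ (separating_setOf_reachable G a) ⟨a, SimpleGraph.Reachable.refl a⟩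
    exact (Set.ext_iff.mp h1 b).mpr trivial
  · rintro h S hS ⟨a, ha⟩
    exact Set.eq_univ_of_forall fun b => hS.mem_of_reachable (h.preconnected a b) ha

@[simp] theorem mem_edges [Fintype I] {G : Digraph I} {e : I × I} :
    e ∈ edges G ↔ G.Adj e.1 e.2 := by simp [edges]

theorem edgeSet_eq_image_edges [Fintype I] (G : Digraph I) (hG : ∀ a, ¬ G.Adj a a) :
    G.toSimpleGraphInclusive.edgeSet = (fun e : I × I => s(e.1, e.2)) '' (edges G : Set (I × I)) := by
  ext e
  induction e with | _ a b
  rw [SimpleGraph.mem_edgeSet, toSimpleGraphInclusive_adj]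
  constructor
  · rintro ⟨_, h | h⟩
    · exact ⟨(a, b), by simpa using h, rfl⟩
    · exact ⟨(b, a), by simpa using h, Sym2.eq_swap⟩
  · rintro ⟨⟨c, d⟩, h, h'⟩
    have h1 : G.Adj c d := by simpa using h
    have hne : c ≠ d := by rintro rfl; exact hG _ h1
    rcases Sym2.eq_iff.mp h' with ⟨rfl, rfl⟩ | ⟨rfl, rfl⟩
    · exact ⟨hne, Or.inl h1⟩
    · exact ⟨hne.symm, Or.inr h1⟩

/-- The digraph without its loops. -/
def removeLoops (G : Digraph I) : Digraph I := ⟨fun a b => a ≠ b ∧ G.Adj a b⟩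

theorem conn_removeLoops {G : Digraph I} : Conn (removeLoops G) ↔ Conn G := by
  have h : ∀ S, Separating (removeLoops G) S ↔ Separating G S := by
    refine fun S => ⟨fun h a b hab => ?_, fun h a b hab => h a b hab.2⟩
    rcases eq_or_ne a b with rfl | hne
    · rfl
    · exact h a b ⟨hne, hab⟩
  simp only [Conn, h]

/-- Removing loops does not affect connectedness, and the undirected graph that remains has at most
as many edges as the digraph. -/
theorem Conn.card_le [Fintype I] [Nonempty I] {G : Digraph I} (h : Conn G) :
    Fintype.card I ≤ (edges G).card + 1 := by
  have h1 := (conn_iff_connected.mp (conn_removeLoops.mpr h)).card_vert_le_card_edgeSet_add_one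
  rw [edgeSet_eq_image_edges (removeLoops G) (fun a h => h.1 rfl),
    Nat.card_eq_fintype_card (α := I)] at h1
  refine h1.trans (Nat.add_le_add_right ?_ 1)
  rw [Nat.card_coe_set_eq]
  refine (Set.ncard_image_le (Finset.finite_toSet _)).trans ?_
  rw [Set.ncard_coe_finset]
  refine Finset.card_le_card fun e he => ?_
  rw [mem_edges] at he ⊢
  exact he.2

open scoped Classical in
theorem edges_addEdge [Fintype I] (H : Digraph I) (a b : I) :
    edges (addEdge H a b) = insert (a, b) (edges H) := by
  ext ⟨x, y⟩
  simp [addEdge, or_comm]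

open scoped Classical in
theorem edges_delEdge [Fintype I] (G : Digraph I) (a b : I) :
    edges (delEdge G a b) = (edges G).erase (a, b) := by
  ext ⟨x, y⟩
  simp [delEdge, and_comm]

theorem addEdge_delEdge {G : Digraph I} {a b : I} (h : G.Adj a b) :
    addEdge (delEdge G a b) a b = G := by
  ext x y
  simp only [addEdge, delEdge]
  constructor
  · rintro (h' | ⟨rfl, rfl⟩)
    · exact h'.1
    · exact h
  · tauto

theorem delEdge_addEdge {H : Digraph I} {a b : I} (h : ¬ H.Adj a b) :
    delEdge (addEdge H a b) a b = H := by
  ext x y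
  simp only [addEdge, delEdge]
  constructor
  · tauto
  · intro h'
    refine ⟨Or.inl h', ?_⟩
    rintro ⟨rfl, rfl⟩
    exact h h'

theorem card_edges_delEdge [Fintype I] {G : Digraph I} {a b : I} (h : G.Adj a b) :
    (edges (delEdge G a b)).card + 1 = (edges G).card := by
  classical
  rw [edges_delEdge]
  exact Finset.card_erase_add_one (by simpa using h)

/-- From here on trees are handled by separating sets and an edge count, without paths. That no edge
has an opposite is automatic: one of two opposite edges could be deleted without disconnecting the
graph, which would leave too few edges. -/
theorem isSGraph_iff [Fintype I] {G : Digraph I} :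
    IsSGraph G ↔ Nonempty I ∧ Conn G ∧ (edges G).card + 1 ≤ Fintype.card I := by
  constructor
  · rintro ⟨h1, h2⟩
    have hne : Nonempty I := h2.connected.nonempty
    refine ⟨hne, conn_iff_connected.mpr h2.connected, ?_⟩
    have h3 := (SimpleGraph.isTree_iff_connected_and_card.mp h2).2
    rw [edgeSet_eq_image_edges _ (fun a h => h1 a a h h),
      Nat.card_eq_fintype_card (α := I),
      Nat.card_coe_set_eq, Set.InjOn.ncard_image, Set.ncard_coe_finset] at h3
    · exact h3.le
    · rintro ⟨a, b⟩ hab ⟨c, d⟩ hcd h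
      rcases Sym2.eq_iff.mp h with ⟨h4, h5⟩ | ⟨h4, h5⟩
      · exact Prod.ext h4 h5
      · simp only at h4 h5
        subst h4; subst h5
        simp only [Finset.mem_coe, mem_edges] at hab hcd
        exact absurd hcd (h1 _ _ hab)
  · rintro ⟨hne, hc, hcard⟩
    have hasymm : ∀ a b, G.Adj a b → ¬ G.Adj b a := by
      intro a b hab hba
      have h1 : Conn (delEdge G a b) := by
        intro S hS
        refine hc S fun x y hxy => ?_
        by_cases h : x = a ∧ y = b
        · obtain ⟨rfl, rfl⟩ := h
          rcases eq_or_ne x y with rfl | hne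
          · rfl
          · exact (hS y x ⟨hba, fun h => hne h.2⟩).symm
        · exact hS x y ⟨hxy, h⟩
      have h2 := h1.card_le
      have h3 := card_edges_delEdge hab
      omega
    refine ⟨hasymm, ?_⟩
    rw [SimpleGraph.isTree_iff_connected_and_card]
    have h1 := conn_iff_connected.mp hc
    refine ⟨h1, ?_⟩
    have h2 := h1.card_vert_le_card_edgeSet_add_one
    rw [edgeSet_eq_image_edges _ (fun a h => hasymm a a h h),
      Nat.card_eq_fintype_card (α := I),
      Nat.card_coe_set_eq] at *
    have h3 := Set.ncard_image_le (f := fun e : I × I => s(e.1, e.2)) (Finset.finite_toSet (edges G))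
    rw [Set.ncard_coe_finset] at h3
    omega

theorem IsSGraph.conn [Fintype I] {G : Digraph I} (h : IsSGraph G) : Conn G :=
  (isSGraph_iff.mp h).2.1

theorem IsSGraph.asymm {G : Digraph I} (h : IsSGraph G) {a b : I} (hab : G.Adj a b) :
    ¬ G.Adj b a := h.1 a b hab

theorem IsSGraph.ne {G : Digraph I} (h : IsSGraph G) {a b : I} (hab : G.Adj a b) : a ≠ b := by
  rintro rfl
  exact h.1 a a hab hab

theorem IsSGraph.not_conn_delEdge [Fintype I] {G : Digraph I} (h : IsSGraph G) {a b : I}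
    (hab : G.Adj a b) : ¬ Conn (delEdge G a b) := by
  obtain ⟨hne, _, h2⟩ := isSGraph_iff.mp h
  intro h1
  have h3 := h1.card_le
  have h4 := card_edges_delEdge hab
  omega

/-- By the edge count the graph without the edge is disconnected. A separating set of it must tell
the ends of the edge apart, since otherwise it would separate the tree itself. -/
theorem IsSGraph.exists_separating [Fintype I] {G : Digraph I} (h : IsSGraph G) {a b : I}
    (hab : G.Adj a b) : ∃ S, Separating (delEdge G a b) S ∧ a ∈ S ∧ b ∉ S := by
  have h1 := h.not_conn_delEdge hab
  simp only [Conn, not_forall] at h1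
  obtain ⟨S, hS, hne, hS'⟩ := h1
  have h2 : ¬ (a ∈ S ↔ b ∈ S) := by
    intro h3
    refine hS' (h.conn S (fun x y hxy => ?_) hne)
    by_cases h4 : x = a ∧ y = b
    · rw [h4.1, h4.2]; exact h3
    · exact hS x y ⟨hxy, h4⟩
  by_cases ha : a ∈ S
  · exact ⟨S, hS, ha, fun hb => h2 ⟨fun _ => hb, fun _ => ha⟩⟩
  · exact ⟨Sᶜ, hS.compl, ha, fun hb => h2 ⟨fun h => absurd h ha, fun h => absurd h hb⟩⟩

/-! ### Cutting edges -/

theorem separating_cutSide (G : Digraph I) (a b : I) :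
    Separating (delEdge G a b) (cutSide G a b) := separating_setOf_reachable _ a

theorem mem_cutSide (G : Digraph I) (a b : I) : a ∈ cutSide G a b := SimpleGraph.Reachable.refl a

theorem IsSGraph.notMem_cutSide [Fintype I] {G : Digraph I} (h : IsSGraph G) {a b : I}
    (hab : G.Adj a b) : b ∉ cutSide G a b := by
  obtain ⟨S, hS, ha, hb⟩ := h.exists_separating hab
  exact fun h' => hb (hS.mem_of_reachable h' ha)

theorem eq_of_cross {G : Digraph I} {a b : I} {S : Set I} (hS : Separating (delEdge G a b) S)
    {x y : I} (hxy : G.Adj x y) (h : ¬ (x ∈ S ↔ y ∈ S)) : x = a ∧ y = b := by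
  by_contra h'
  exact h (hS x y ⟨hxy, h'⟩)

/-- The restriction of a connected digraph to a set of vertices is connected if all edges to the
outside end in the same vertex of the set. -/
theorem Conn.restrict {G : Digraph I} (hG : Conn G) {P : I → Prop} (b : I) (hb : P b)
    (h1 : ∀ x y, G.Adj x y → P x → ¬ P y → x = b) (h2 : ∀ x y, G.Adj x y → ¬ P x → P y → y = b) :
    Conn (pullback (Subtype.val : {i // P i} → I) G) := by
  refine conn_of_forall_mem ⟨b, hb⟩ fun S hS hbS => ?_
  -- The set `S` is enlarged by all vertices outside `P`; edges between the inside and the outside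
  -- respect it because their inner end is `b`, which lies in `S`.
  have h3 := hG {v | ∀ h : P v, (⟨v, h⟩ : {i // P i}) ∈ S} (fun x y hxy => ?_) ⟨b, fun _ => hbS⟩
  · refine Set.eq_univ_of_forall fun x => ?_
    have h4 : (x : I) ∈ {v | ∀ h : P v, (⟨v, h⟩ : {i // P i}) ∈ S} := by rw [h3]; trivial
    exact h4 x.2
  · simp only [Set.mem_ofPred_eq]
    by_cases hx : P x <;> by_cases hy : P y
    · have := hS ⟨x, hx⟩ ⟨y, hy⟩ hxy
      simpa [hx, hy] using this
    · obtain rfl := h1 x y hxy hx hy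
      simpa [hy, hx] using hbS
    · obtain rfl := h2 x y hxy hx hy
      simpa [hy, hx] using hbS
    · simp [hx, hy]

open scoped Classical in
theorem card_edges_eq_add [Fintype I] (G : Digraph I) (P : I → Prop) :
    (edges G).card = (edges (pullback (Subtype.val : {i // P i} → I) G)).card +
      (edges (pullback (Subtype.val : {i // ¬ P i} → I) G)).card +
      ((edges G).filter fun e => ¬ (P e.1 ↔ P e.2)).card := by
  have h : ∀ (Q : I → Prop) [Fintype {i // Q i}], (edges (pullback (Subtype.val : {i // Q i} → I) G)).card =
      ((edges G).filter fun e => Q e.1 ∧ Q e.2).card := by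
    intro Q _
    refine Finset.card_bij (fun e _ => ((e.1 : I), (e.2 : I))) ?_ ?_ ?_
    · rintro ⟨a, b⟩ h
      simp only [mem_edges, Finset.mem_filter] at h ⊢
      exact ⟨h, a.2, b.2⟩
    · rintro ⟨a, b⟩ _ ⟨c, d⟩ _ h
      simp only [Prod.mk.injEq] at h
      exact Prod.ext (Subtype.ext h.1) (Subtype.ext h.2)
    · rintro ⟨a, b⟩ h
      simp only [mem_edges, Finset.mem_filter] at h
      exact ⟨(⟨a, h.2.1⟩, ⟨b, h.2.2⟩), by simpa [pullback] using h.1, rfl⟩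
  rw [h P, h (fun i => ¬ P i),
    ← Finset.card_filter_add_card_filter_not (fun e : I × I => (P e.1 ↔ P e.2))]
  congr 1
  rw [← Finset.card_union_of_disjoint]
  · congr 1
    ext e
    simp only [Finset.mem_filter, Finset.mem_union]
    tauto
  · rw [Finset.disjoint_left]
    intro e
    simp only [Finset.mem_filter]
    tauto

theorem IsSGraph.conn_cutSide [Fintype I] {G : Digraph I} (h : IsSGraph G) {a b : I}
    (hab : G.Adj a b) : Conn (pullback (Subtype.val : {i // i ∈ cutSide G a b} → I) G) := by
  refine h.conn.restrict a (mem_cutSide G a b) (fun x y hxy hx hy => ?_) (fun x y hxy hx hy => ?_)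
  · exact (eq_of_cross (separating_cutSide G a b) hxy fun h => hy (h.mp hx)).1
  · obtain ⟨rfl, rfl⟩ := eq_of_cross (separating_cutSide G a b) hxy fun h => hx (h.mpr hy)
    exact absurd (mem_cutSide G x y) hx

theorem IsSGraph.conn_not_cutSide [Fintype I] {G : Digraph I} (h : IsSGraph G) {a b : I}
    (hab : G.Adj a b) : Conn (pullback (Subtype.val : {i // ¬ i ∈ cutSide G a b} → I) G) := by
  refine h.conn.restrict b (h.notMem_cutSide hab) (fun x y hxy hx hy => ?_)
    (fun x y hxy hx hy => ?_)
  · obtain ⟨rfl, rfl⟩ := eq_of_cross (separating_cutSide G a b) hxy fun h => hy fun h' =>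
      hx (h.mpr h')
    exact absurd (mem_cutSide G x y) hx
  · exact (eq_of_cross (separating_cutSide G a b) hxy fun h => hy (h.mp (not_not.mp hx))).2

/-- If a tree is cut into two connected parts, both parts are trees, and at most one edge is cut. -/
theorem IsSGraph.restrict [Fintype I] {G : Digraph I} (h : IsSGraph G) {P : I → Prop}
    {a b : I} (ha : P a) (hb : ¬ P b) 
    (h1 : Conn (pullback (Subtype.val : {i // P i} → I) G))
    (h2 : Conn (pullback (Subtype.val : {i // ¬ P i} → I) G)) :
    IsSGraph (pullback (Subtype.val : {i // P i} → I) G) ∧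
    IsSGraph (pullback (Subtype.val : {i // ¬ P i} → I) G) ∧
    ∃ x y, G.Adj x y ∧ ¬ (P x ↔ P y) ∧
      ∀ x' y', G.Adj x' y' → ¬ (P x' ↔ P y') → x' = x ∧ y' = y := by
  classical
  have hne1 : Nonempty {i // P i} := ⟨⟨a, ha⟩⟩
  have hne2 : Nonempty {i // ¬ P i} := ⟨⟨b, hb⟩⟩
  -- Each connected part needs at least one edge less than it has vertices, so the count for the
  -- tree leaves at most one edge across; connectedness of `G` provides one.
  have h3 := card_edges_eq_add G P
  have h4 := h1.card_le
  have h5 := h2.card_le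
  have h6 := (isSGraph_iff.mp h).2.2
  have h7 : Fintype.card I = Fintype.card {i // P i} + Fintype.card {i // ¬ P i} := by
    rw [Fintype.card_subtype_compl]
    have := Fintype.card_subtype_le P
    omega
  have h8 : ((edges G).filter fun e => ¬ (P e.1 ↔ P e.2)).Nonempty := by
    by_contra h9
    rw [Finset.not_nonempty_iff_eq_empty] at h9
    have h10 := h.conn {v | P v} (fun x y hxy => by
      by_contra h11
      have : (x, y) ∈ (edges G).filter fun e => ¬ (P e.1 ↔ P e.2) := by
        rw [Finset.mem_filter, mem_edges]; exact ⟨hxy, h11⟩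
      rw [h9] at this
      simp at this) ⟨a, ha⟩
    have h11 : b ∈ {v | P v} := by rw [h10]; trivial
    exact hb h11
  have h9 := h8.card_pos
  refine ⟨isSGraph_iff.mpr ⟨hne1, h1, by omega⟩, isSGraph_iff.mpr ⟨hne2, h2, by omega⟩, ?_⟩
  obtain ⟨e, he⟩ := Finset.card_eq_one.mp
    (show ((edges G).filter fun e => ¬ (P e.1 ↔ P e.2)).card = 1 by omega)
  have h10 : ∀ x, x ∈ (edges G).filter (fun e => ¬ (P e.1 ↔ P e.2)) ↔ x = e := by simp [he]
  simp only [Finset.mem_filter, mem_edges] at h10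
  have h11 := (h10 e).mpr rfl
  refine ⟨e.1, e.2, h11.1, h11.2, fun x' y' h12 h13 => ?_⟩
  have h14 := (h10 (x', y')).mp ⟨h12, h13⟩
  exact ⟨congrArg Prod.fst h14, congrArg Prod.snd h14⟩

theorem IsSGraph.isSGraph_cutSide [Fintype I] {G : Digraph I} (h : IsSGraph G) {a b : I}
    (hab : G.Adj a b) :
    IsSGraph (pullback (Subtype.val : {i // i ∈ cutSide G a b} → I) G) ∧
    IsSGraph (pullback (Subtype.val : {i // ¬ i ∈ cutSide G a b} → I) G) := by
  have h1 := h.restrict (P := fun i => i ∈ cutSide G a b) (mem_cutSide G a b)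
    (h.notMem_cutSide hab) (h.conn_cutSide hab) (h.conn_not_cutSide hab)
  exact ⟨h1.1, h1.2.1⟩

/-- The cuts of a tree into two connected parts, without edges from the second part to the first,
are given by the edges. -/
theorem IsSGraph.eq_cutSide [Fintype I] {G : Digraph I} (h : IsSGraph G) {T : Set I}
    {a b : I} (ha : a ∈ T) (hb : b ∉ T) (hT : ∀ x y, G.Adj x y → y ∈ T → x ∈ T)
    (h1 : Conn (pullback (Subtype.val : {i // i ∈ T} → I) G))
    (h2 : Conn (pullback (Subtype.val : {i // ¬ i ∈ T} → I) G)) :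
    ∃ x y, G.Adj x y ∧ T = cutSide G x y := by
  obtain ⟨_, _, x, y, hxy, h3, h4⟩ := h.restrict (P := fun i => i ∈ T) ha hb h1 h2
  refine ⟨x, y, hxy, ?_⟩
  have hx : x ∈ T := by
    by_contra hx
    exact h3 ⟨fun h => absurd h hx, fun h => hT x y hxy h⟩
  have hS : Separating (delEdge G x y) T := by
    intro c d hcd
    by_contra h5
    exact hcd.2 (h4 c d hcd.1 h5)
  refine Set.Subset.antisymm (fun v hv => ?_) (fun v hv => hS.mem_of_reachable hv hx)
  -- Since the restriction to `T` is connected and its edges avoid the cut edge, all of `T` lies on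
  -- the side of `x`.
  have h5 := h1 {v | (v : I) ∈ cutSide G x y} (fun c d _ => ?_) ⟨⟨x, hx⟩, mem_cutSide G x y⟩
  · have h6 : (⟨v, hv⟩ : {i // i ∈ T}) ∈ {v : {i // i ∈ T} | (v : I) ∈ cutSide G x y} := by
      rw [h5]; trivial
    exact h6
  · refine separating_cutSide G x y c d ⟨‹_›, ?_⟩
    rintro ⟨_, h6⟩
    exact h3 ⟨fun _ => h6 ▸ d.2, fun _ => hx⟩

/-- The edge `a → b` crosses the boundary of its own side, and only `c → d` crosses the boundary of
the side of `c`. -/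
theorem IsSGraph.cutSide_injective [Fintype I] {G : Digraph I} (h : IsSGraph G) {a b c d : I}
    (hab : G.Adj a b) (he : cutSide G a b = cutSide G c d) :
    a = c ∧ b = d := by
  refine eq_of_cross (separating_cutSide G c d) hab fun h' => ?_
  rw [← he] at h'
  exact h.notMem_cutSide hab (h'.mp (mem_cutSide G a b))

/-! ### Contraction of edges, orientations and linear extensions -/

/-- Preimages of separating sets are separating, so connectedness passes to the image. The edge `a →
b` becomes a loop and is discarded, so the edge count drops with the vertex count. -/
theorem IsSGraph.pushforward [Fintype I] [Fintype J] {G : Digraph I} (h : IsSGraph G)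
    {f : I → J} (hf : Function.Surjective f) (hcard : Fintype.card I ≤ Fintype.card J + 1)
    {a b : I} (hab : G.Adj a b) (hfab : f a = f b) : IsSGraph (pushforward f G) := by
  classical
  obtain ⟨⟨i⟩, hc, h1⟩ := isSGraph_iff.mp h
  refine isSGraph_iff.mpr ⟨⟨f i⟩, ?_, ?_⟩
  · rintro S hS ⟨y, hy⟩
    obtain ⟨x, rfl⟩ := hf y
    have h2 := hc (f ⁻¹' S) (fun c d hcd => ?_) ⟨x, hy⟩
    · exact Set.eq_univ_of_forall fun z => by
        obtain ⟨w, rfl⟩ := hf z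
        have : w ∈ f ⁻¹' S := h2 ▸ Set.mem_univ w
        exact this
    · by_cases h3 : f c = f d
      · simp [h3]
      · exact hS (f c) (f d) ⟨h3, c, d, hcd, rfl, rfl⟩
  · have h2 : edges (GraphLie.pushforward f G) ⊆
        (edges (delEdge G a b)).image (Prod.map f f) := by
      rintro ⟨x, y⟩ hxy
      simp only [mem_edges] at hxy
      obtain ⟨hne, c, d, hcd, rfl, rfl⟩ := hxy
      refine Finset.mem_image.mpr ⟨(c, d), ?_, rfl⟩
      simp only [mem_edges]
      refine ⟨hcd, ?_⟩
      rintro ⟨rfl, rfl⟩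
      exact hne hfab
    have h3 := (Finset.card_le_card h2).trans Finset.card_image_le
    have h4 := card_edges_delEdge hab
    omega

/-- The orientation of a tree in which all edges point away from `r`. -/
def orientFrom (G : Digraph I) (r : I) : Digraph I :=
  ⟨fun a b => (G.Adj a b ∨ G.Adj b a) ∧
    ∃ S : Set I, Separating (delEdge (delEdge G a b) b a) S ∧ r ∈ S ∧ a ∈ S ∧ b ∉ S⟩

theorem orientFrom_or [Fintype I] {G : Digraph I} (h : IsSGraph G) (r : I) {a b : I}
    (hab : G.Adj a b) : (orientFrom G r).Adj a b ∨ (orientFrom G r).Adj b a := by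
  obtain ⟨S, hS, ha, hb⟩ := h.exists_separating hab
  by_cases hr : r ∈ S
  · exact Or.inl ⟨Or.inl hab, S, fun x y h => hS x y h.1, hr, ha, hb⟩
  · refine Or.inr ⟨Or.inr hab, Sᶜ, fun x y h => hS.compl x y ⟨h.1.1, h.2⟩, hr, hb, not_not.mpr ha⟩

/-- In the orientation away from `r`, every vertex has at most one incoming edge, and no edge
carries both directions. -/
theorem orientFrom_unique [Fintype I] {G : Digraph I} (h : IsSGraph G) {r a b c : I}
    (hab : (orientFrom G r).Adj a b) (hc : (orientFrom G r).Adj c b ∨ ((orientFrom G r).Adj b c)) :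
    (orientFrom G r).Adj c b → c = a := by
  intro hcb
  by_contra hne
  obtain ⟨h1, S, hS, hrS, haS, hbS⟩ := hab
  obtain ⟨h2, S', hS', hrS', hcS', hbS'⟩ := hcb
  have haS' : a ∉ S' := by
    have h3 : a ≠ b := by rintro rfl; exact hbS haS
    rcases h1 with h1 | h1
    · have := hS' a b ⟨⟨h1, fun h => hne h.1.symm⟩, fun h => h3 h.1⟩
      tauto
    · have := hS' b a ⟨⟨h1, fun h => h3 h.2⟩, fun h => hne h.2.symm⟩
      tauto
  have hcS : c ∉ S := by
    have h3 : c ≠ b := by rintro rfl; exact hbS' hcS'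
    rcases h2 with h2 | h2
    · have := hS c b ⟨⟨h2, fun h => hne h.1⟩, fun h => h3 h.1⟩
      tauto
    · have := hS b c ⟨⟨h2, fun h => h3 h.2⟩, fun h => hne h.2⟩
      tauto
  -- With two different parents of `b`, no edge would cross `S ∩ S'`, although it contains the root
  -- and not `b`.
  have h3 := h.conn (S ∩ S') (fun x y hxy => ?_) ⟨r, hrS, hrS'⟩
  · have : b ∈ S ∩ S' := by rw [h3]; trivial
    exact hbS this.1
  · by_cases h4 : (x = a ∧ y = b) ∨ (x = b ∧ y = a)
    · rcases h4 with ⟨rfl, rfl⟩ | ⟨rfl, rfl⟩ <;> simp [haS', hbS]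
    · by_cases h5 : (x = c ∧ y = b) ∨ (x = b ∧ y = c)
      · rcases h5 with ⟨rfl, rfl⟩ | ⟨rfl, rfl⟩ <;> simp [hcS, hbS']
      · have h6 := hS x y ⟨⟨hxy, fun h => h4 (Or.inl h)⟩, fun h => h4 (Or.inr h)⟩
        have h7 := hS' x y ⟨⟨hxy, fun h => h5 (Or.inl h)⟩, fun h => h5 (Or.inr h)⟩
        simp only [Set.mem_inter_iff, h6, h7]

theorem orientFrom_asymm [Fintype I] {G : Digraph I} (h : IsSGraph G) {r a b : I}
    (hab : (orientFrom G r).Adj a b) : ¬ (orientFrom G r).Adj b a := by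
  intro hba
  obtain ⟨h1, S, hS, hrS, haS, hbS⟩ := hab
  obtain ⟨h2, S', hS', hrS', hbS', haS'⟩ := hba
  have h3 := h.conn (S ∩ S') (fun x y hxy => ?_) ⟨r, hrS, hrS'⟩
  · have : b ∈ S ∩ S' := by rw [h3]; trivial
    exact hbS this.1
  · by_cases h4 : (x = a ∧ y = b) ∨ (x = b ∧ y = a)
    · rcases h4 with ⟨rfl, rfl⟩ | ⟨rfl, rfl⟩ <;> simp [haS', hbS]
    · have h6 := hS x y ⟨⟨hxy, fun h => h4 (Or.inl h)⟩, fun h => h4 (Or.inr h)⟩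
      have h7 := hS' x y ⟨⟨hxy, fun h => h4 (Or.inr h)⟩, fun h => h4 (Or.inl h)⟩
      simp only [Set.mem_inter_iff, h6, h7]

theorem toSimpleGraphInclusive_orientFrom [Fintype I] {G : Digraph I} (h : IsSGraph G) (r : I) :
    (orientFrom G r).toSimpleGraphInclusive = G.toSimpleGraphInclusive := by
  ext a b
  simp only [toSimpleGraphInclusive_adj]
  refine and_congr_right fun _ => ⟨?_, ?_⟩
  · rintro (h1 | h1)
    · exact h1.1
    · exact h1.1.symm
  · rintro (h1 | h1)
    · exact orientFrom_or h r h1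
    · exact (orientFrom_or h r h1).symm

theorem isSGraph_orientFrom [Fintype I] {G : Digraph I} (h : IsSGraph G) (r : I) :
    IsSGraph (orientFrom G r) :=
  ⟨fun _ _ hab => orientFrom_asymm h hab, by
    rw [toSimpleGraphInclusive_orientFrom h r]; exact h.2⟩

/-- Induction on the number of edges. A height function without `a → b` stays one when a constant is
added on the side of `b`, and the constant can be chosen to lift `b` above `a`. -/
theorem exists_strictMono_of_separating [Fintype I] (G : Digraph I)
    (h : ∀ a b, G.Adj a b → ∃ S, Separating (delEdge G a b) S ∧ a ∈ S ∧ b ∉ S) :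
    ∃ f : I → ℤ, ∀ a b, G.Adj a b → f a < f b := by
  classical
  obtain ⟨n, hn⟩ : ∃ n, (edges G).card = n := ⟨_, rfl⟩
  induction n generalizing G with
  | zero =>
    refine ⟨0, fun a b hab => ?_⟩
    have : (a, b) ∈ edges G := by simpa using hab
    rw [Finset.card_eq_zero.mp hn] at this
    simp at this
  | succ n ih =>
    obtain ⟨⟨a, b⟩, hab⟩ := Finset.card_pos.mp (by omega : 0 < (edges G).card)
    rw [mem_edges] at hab
    have h1 := card_edges_delEdge hab
    obtain ⟨f, hf⟩ := ih (delEdge G a b) (fun c d hcd => by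
      obtain ⟨S, hS, h2⟩ := h c d hcd.1
      exact ⟨S, fun x y h => hS x y ⟨h.1.1, h.2⟩, h2⟩)
      (by simp only at h1; omega)
    obtain ⟨S, hS, ha, hb⟩ := h a b hab
    -- The shift gives `b` the height `f a + 1`.
    refine ⟨fun v => if v ∈ S then f v else f v + (f a - f b + 1), fun c d hcd => ?_⟩
    by_cases h2 : c = a ∧ d = b
    · obtain ⟨rfl, rfl⟩ := h2
      simp only [ha, hb, if_true, if_false]
      omega
    · have h3 := hS c d ⟨hcd, h2⟩
      have h4 := hf c d ⟨hcd, h2⟩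
      by_cases hc : c ∈ S
      · simp only [hc, h3.mp hc, if_true, h4]
      · simp only [hc, mt h3.mpr hc, if_false]
        omega

end Connected

/-! ### Sums over linear extensions -/

section LinExt

variable {I J : Type} [LinearOrder J]

/-- `π` is a linear extension of `G`: every edge goes from a smaller to a larger position. -/
def IsLinExt (G : Digraph I) (π : I ≃ J) : Prop := ∀ a b, G.Adj a b → π a < π b

theorem isLinExt_addEdge {H : Digraph I} {a b : I} {π : I ≃ J} :
    IsLinExt (addEdge H a b) π ↔ IsLinExt H π ∧ π a < π b := by
  constructor
  · exact fun h => ⟨fun x y hxy => h x y (Or.inl hxy), h a b (Or.inr ⟨rfl, rfl⟩)⟩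
  · rintro ⟨h1, h2⟩ x y (h | ⟨rfl, rfl⟩)
    · exact h1 x y h
    · exact h2

theorem exists_equiv_lt_iff [Fintype I] {n : ℕ} (hn : Fintype.card I = n) {K : Type*} [LinearOrder K]
    (f : I → K) (hf : Function.Injective f) : ∃ τ : I ≃ Fin n, ∀ a b, τ a < τ b ↔ f a < f b := by
  let _ : LinearOrder I := LinearOrder.lift' f hf
  refine ⟨(Fintype.orderIsoFinOfCardEq I hn).symm.toEquiv, fun a b => ?_⟩
  exact (Fintype.orderIsoFinOfCardEq I hn).symm.lt_iff_lt

/-- The identity is the only order automorphism of `Fin n`. -/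
theorem equiv_eq_of_lt_iff {n : ℕ} {τ τ' : I ≃ Fin n} (h : ∀ a b, τ a < τ b ↔ τ' a < τ' b) :
    τ = τ' := by
  have h1 : StrictMono (τ.symm.trans τ') := fun x y hxy => by
    simpa using (h (τ.symm x) (τ.symm y)).mp (by simpa using hxy)
  have h2 : (StrictMono.orderIsoOfSurjective _ h1 (Equiv.surjective _)) = OrderIso.refl (Fin n) :=
    Subsingleton.elim _ _
  ext a
  have h3 := congrArg (fun e : Fin n ≃o Fin n => e (τ a)) h2
  have h4 : τ' a = τ a := by simpa using h3
  rw [h4]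

theorem isLinExt_longGraph {n : ℕ} {π : Equiv.Perm (Fin n)} :
    IsLinExt (longGraph n) π ↔ π = Equiv.refl _ := by
  constructor
  · intro h
    have h0 : ∀ j : ℕ, ∀ i : Fin n, ∀ hj : j < n, (i : ℕ) < j → π i < π ⟨j, hj⟩ := by
      intro j
      induction j with
      | zero => intro i _ hi; omega
      | succ j ih =>
        intro i hj hi
        have h1 : π ⟨j, by omega⟩ < π ⟨j + 1, hj⟩ := h _ _ rfl
        rcases Nat.lt_or_ge i j with h2 | h2
        · exact (ih i (by omega) h2).trans h1
        · have h3 : i = ⟨j, by omega⟩ := Fin.ext (by simp only; omega)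
          rw [h3]; exact h1
    have h1 : StrictMono π := fun i j hij => h0 j i j.2 hij
    exact equiv_eq_of_lt_iff fun a b => by simpa using h1.lt_iff_lt
  · rintro rfl a b hab
    have : (a : ℕ) + 1 = b := hab
    rw [Fin.lt_def]
    simp only [Equiv.refl_apply]
    omega

theorem IsSGraph.exists_isLinExt [Fintype I] {G : Digraph I} (h : IsSGraph G) {n : ℕ}
    (hn : Fintype.card I = n) : ∃ π : I ≃ Fin n, IsLinExt G π := by
  obtain ⟨f, hf⟩ := exists_strictMono_of_separating G fun a b hab => h.exists_separating hab
  let e := Fintype.equivFinOfCardEq hn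
  -- Vertices of equal height are ordered by an arbitrary numbering `e`.
  obtain ⟨τ, hτ⟩ := exists_equiv_lt_iff hn (fun i => toLex (f i, e i)) (fun a b hab =>
    e.injective (congrArg (fun x => (ofLex x).2) hab))
  refine ⟨τ, fun a b hab => (hτ a b).mpr ?_⟩
  rw [Prod.Lex.toLex_lt_toLex]
  exact Or.inl (hf a b hab)

/-- Two consecutive chains: the long graph without its edge from `p - 1` to `p`. -/
def twoChains (n p : ℕ) : Digraph (Fin n) := ⟨fun x y => (x : ℕ) + 1 = y ∧ (y : ℕ) ≠ p⟩

/-- The two chains record the order inside the two words that are shuffled. This makes the shuffle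
sums instances of `leSum`. -/
theorem isShuffle_iff_isLinExt {n p : ℕ} {ρ : Equiv.Perm (Fin n)} :
    IsShuffle p ρ ↔ IsLinExt (twoChains n p) ρ := by
  constructor
  · rintro ⟨h1, h2⟩ a b ⟨hab, hb⟩
    have h3 : a < b := by rw [Fin.lt_def]; omega
    rcases Nat.lt_or_ge b p with h4 | h4
    · exact h1 a b h3 h4
    · exact h2 a b h3 (by omega)
  · intro h
    have h0 : ∀ j : ℕ, ∀ i : Fin n, ∀ hj : j < n, (i : ℕ) < j → (j < p ∨ p ≤ i) →
        ρ i < ρ ⟨j, hj⟩ := by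
      intro j
      induction j with
      | zero => intro i _ hi; omega
      | succ j ih =>
        intro i hj hi hp
        have h1 : ρ ⟨j, by omega⟩ < ρ ⟨j + 1, hj⟩ := h _ _ ⟨rfl, by simp only; omega⟩
        rcases Nat.lt_or_ge i j with h2 | h2
        · exact (ih i (by omega) h2 (by omega)).trans h1
        · have h3 : i = ⟨j, by omega⟩ := Fin.ext (by simp only; omega)
          rw [h3]; exact h1
    exact ⟨fun i j hij hj => h0 j i j.2 hij (Or.inl hj), fun i j hij hi => h0 j i j.2 hij (Or.inr hi)⟩

theorem separating_twoChains (n p : ℕ) : Separating (twoChains n p) {i | (i : ℕ) < p} := by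
  rintro a b ⟨h1, h2⟩
  simp only [Set.mem_ofPred_eq]
  omega

theorem not_conn_twoChains {n p : ℕ} (hp : p ∈ Finset.Ioo 0 n) : ¬ Conn (twoChains n p) := by
  rw [Finset.mem_Ioo] at hp
  intro h
  have h1 := h _ (separating_twoChains n p) ⟨⟨0, by omega⟩, hp.1⟩
  have h2 : (⟨p, hp.2⟩ : Fin n) ∈ {i : Fin n | (i : ℕ) < p} := by rw [h1]; trivial
  simp at h2

/-- A linear order decides which of the two upper ends of the fork comes first. This is the
combinatorial form of the Arnold relation. -/
theorem isLinExt_fork_iff (n : ℕ) (H : Digraph I) {a b c : I} (hbc : b ≠ c) (π : I ≃ Fin n) :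
    IsLinExt (addEdge (addEdge H a c) a b) π ↔ IsLinExt (addEdge (addEdge H a b) b c) π ∨
      IsLinExt (addEdge (addEdge H a c) c b) π := by
  simp only [isLinExt_addEdge]
  constructor
  · rintro ⟨⟨h1, h2⟩, h3⟩
    rcases lt_or_gt_of_ne (fun h => hbc (π.injective h)) with h | h
    · exact Or.inl ⟨⟨h1, h3⟩, h⟩
    · exact Or.inr ⟨⟨h1, h2⟩, h⟩
  · rintro (⟨⟨h1, h2⟩, h3⟩ | ⟨⟨h1, h2⟩, h3⟩)
    · exact ⟨⟨h1, h2.trans h3⟩, h2⟩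
    · exact ⟨⟨h1, h2⟩, h2.trans h3⟩

theorem not_isLinExt_fork (n : ℕ) (H : Digraph I) {a b c : I} (π : I ≃ Fin n)
    (h : IsLinExt (addEdge (addEdge H a b) b c) π) :
    ¬ IsLinExt (addEdge (addEdge H a c) c b) π := by
  simp only [isLinExt_addEdge] at h ⊢
  exact fun h' => h.2.asymm h'.2

-- The position of a vertex is the number of its predecessors; if `S` comes before its complement,
-- it fills the first positions.
open scoped Classical in
theorem lt_card_iff_of_initial [Fintype I] {n : ℕ} {S : Set I} {τ : I ≃ Fin n}
    (h : ∀ a b, a ∈ S → b ∉ S → τ a < τ b) (i : I) :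
    (τ i : ℕ) < Fintype.card {i // i ∈ S} ↔ i ∈ S := by
  have h1 : ((Finset.univ.filter fun j => τ j < τ i).card) = τ i := by
    rw [← Finset.card_map τ.toEmbedding]
    rw [show (Finset.univ.filter fun j => τ j < τ i).map τ.toEmbedding = Finset.Iio (τ i) by
      ext x
      simp only [Finset.mem_map, Finset.mem_filter, Finset.mem_univ, true_and, Finset.mem_Iio]
      exact ⟨by rintro ⟨a, h, rfl⟩; exact h, fun h => ⟨τ.symm x, by simpa using h, by simp⟩⟩]
    simp
  rw [Fintype.card_subtype]
  constructor
  · intro h2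
    by_contra hi
    refine absurd h2 (not_lt.mpr ?_)
    rw [← h1]
    refine Finset.card_le_card fun j hj => ?_
    simp only [Finset.mem_filter, Finset.mem_univ, true_and] at hj ⊢
    exact h j i hj hi
  · intro hi
    rw [← h1]
    refine Finset.card_lt_card ⟨fun j hj => ?_, fun h2 => ?_⟩
    · simp only [Finset.mem_filter, Finset.mem_univ, true_and] at hj ⊢
      by_contra h3
      exact hj.asymm (h i j hi h3)
    · have := h2 (Finset.mem_filter.mpr ⟨Finset.mem_univ i, hi⟩)
      simp at this

end LinExt

theorem linearMap_sum_comp {k : Type*} [CommSemiring k] {M N P : Type*} [AddCommMonoid M]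
    [AddCommMonoid N] [AddCommMonoid P] [Module k M] [Module k N] [Module k P] {ι : Type*}
    (s : Finset ι) (f : ι → N →ₗ[k] P) (g : M →ₗ[k] N) :
    (∑ i ∈ s, f i) ∘ₗ g = ∑ i ∈ s, f i ∘ₗ g := by
  ext x
  simp [LinearMap.sum_apply]

theorem linearMap_comp_sum {k : Type*} [CommSemiring k] {M N P : Type*} [AddCommMonoid M]
    [AddCommMonoid N] [AddCommMonoid P] [Module k M] [Module k N] [Module k P] {ι : Type*}
    (s : Finset ι) (f : ι → M →ₗ[k] N) (g : N →ₗ[k] P) :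
    g ∘ₗ (∑ i ∈ s, f i) = ∑ i ∈ s, g ∘ₗ f i := by
  ext x
  simp [LinearMap.sum_apply]

/-! ### Reorderings of tensors summed over linear extensions -/

section LeSum

variable {k : Type u} [Field k] {W : Type v} [AddCommGroup W] [Module k W]
  (𝒲 : ℤ → Submodule k W) [DirectSum.Decomposition 𝒲]
variable {I J : Type} [Fintype I] [LinearOrder I] [Fintype J] [LinearOrder J]

open scoped Classical in
/-- The sum of the reorderings of tensor factors by all linear extensions of a digraph. -/
def leSum (n : ℕ) (G : Digraph I) : (⨂[k] _ : I, W) →ₗ[k] (⨂[k] _ : Fin n, W) :=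
  ∑ π : I ≃ Fin n, if IsLinExt G π then koszul 𝒲 π else 0

theorem leSum_eq_add (n : ℕ) {G G₁ G₂ : Digraph I}
    (h : ∀ π : I ≃ Fin n, IsLinExt G π ↔ IsLinExt G₁ π ∨ IsLinExt G₂ π)
    (h' : ∀ π : I ≃ Fin n, IsLinExt G₁ π → ¬ IsLinExt G₂ π) :
    leSum 𝒲 n G = leSum 𝒲 n G₁ + leSum 𝒲 n G₂ := by
  classical
  simp only [leSum, ← Finset.sum_add_distrib]
  refine Finset.sum_congr rfl fun π _ => ?_
  have h1 := h π
  have h2 := h' π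
  by_cases h3 : IsLinExt G₁ π <;> by_cases h4 : IsLinExt G₂ π <;> simp_all

theorem leSum_addEdge_add (n : ℕ) (H : Digraph I) {a b : I} (hab : a ≠ b) :
    leSum 𝒲 n H = leSum 𝒲 n (addEdge H a b) + leSum 𝒲 n (addEdge H b a) := by
  refine leSum_eq_add 𝒲 n (fun π => ?_) (fun π => ?_)
  · simp only [isLinExt_addEdge]
    rcases lt_or_gt_of_ne (fun h => hab (π.injective h)) with h | h <;> simp [h, h.asymm]
  · simp only [isLinExt_addEdge]
    exact fun h1 h2 => h1.2.asymm h2.2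

theorem leSum_fork (n : ℕ) (H : Digraph I) {a b c : I} (hbc : b ≠ c) :
    leSum 𝒲 n (addEdge (addEdge H a c) a b) =
      leSum 𝒲 n (addEdge (addEdge H a b) b c) + leSum 𝒲 n (addEdge (addEdge H a c) c b) :=
  leSum_eq_add 𝒲 n (isLinExt_fork_iff n H hbc) (not_isLinExt_fork n H)

/-- Precomposition with `e` carries linear extensions of `G` to those of the relabelled graph. This
accounts for the symmetric group relations. -/
theorem leSum_koszul (n : ℕ) (e : I ≃ J) (G : Digraph J) :
    leSum 𝒲 n G ∘ₗ koszul 𝒲 e = leSum 𝒲 n (pullback e G) := by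
  classical
  simp only [leSum]
  rw [linearMap_sum_comp]
  refine Fintype.sum_equiv (e.symm.equivCongr (Equiv.refl _)) _ _ fun π => ?_
  have h : e.symm.equivCongr (Equiv.refl (Fin n)) π = e.trans π := by ext; simp
  have h1 : IsLinExt (pullback e G) (e.trans π) ↔ IsLinExt G π := by
    constructor
    · intro h a b hab
      have := h (e.symm a) (e.symm b) (by simpa [pullback] using hab)
      simpa using this
    · exact fun h a b hab => h _ _ hab
  rw [h]
  simp only [h1, koszul_trans]
  split_ifs <;> simp

theorem leSum_longGraph (n : ℕ) : leSum 𝒲 n (longGraph n) = LinearMap.id := by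
  classical
  simp only [leSum, isLinExt_longGraph]
  rw [Finset.sum_ite_eq']
  simp

theorem shuffleSum_eq_leSum (n p : ℕ) : shuffleSum 𝒲 n p = leSum 𝒲 n (twoChains n p) := by
  classical
  simp only [shuffleSum, leSum, isShuffle_iff_isLinExt]
  rw [Finset.sum_filter]

/-- Let `S` be a separating set with `p` elements. A linear extension factors uniquely as a linear
extension that puts `S` into the first `p` positions, followed by a shuffle of the first `p` letters
into the others. Hence the sum is a sum of elements in the image of `shuffleSum`. -/
theorem leSum_mem_harrisonShuffles {n : ℕ} (hn : Fintype.card I = n) {G : Digraph I}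
    (hG : ¬ Conn G) (x : ⨂[k] _ : I, W) : leSum 𝒲 n G x ∈ harrisonShuffles 𝒲 n := by
  classical
  simp only [Conn, not_forall] at hG
  obtain ⟨S, hS, ⟨s, hs⟩, hS'⟩ := hG
  obtain ⟨t, ht⟩ := (Set.ne_univ_iff_exists_notMem S).mp hS'
  set p := Fintype.card {i // i ∈ S} with hp
  have hp0 : 0 < p := Fintype.card_pos_iff.mpr ⟨⟨s, hs⟩⟩
  have hpn : p < n := hn ▸ Fintype.card_subtype_lt ht
  -- The numbering `τ` puts `S` first and keeps the order of `π` inside `S` and inside its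
  -- complement; the summand `n` pushes the complement behind `S`.
  have key : ∀ π : I ≃ Fin n, ∃ τ : I ≃ Fin n, ∀ a b, τ a < τ b ↔
      (if a ∈ S then (π a : ℕ) else n + π a) < (if b ∈ S then (π b : ℕ) else n + π b) := by
    intro π
    refine exists_equiv_lt_iff hn (fun a => if a ∈ S then (π a : ℕ) else n + π a) fun a b hab => ?_
    simp only at hab
    refine π.injective (Fin.ext ?_)
    have := (π a).2
    have := (π b).2
    split_ifs at hab <;> omega
  choose t ht' using key
  have hblock : ∀ π a b, a ∈ S → b ∉ S → t π a < t π b := by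
    intro π a b ha hb
    rw [ht', if_pos ha, if_neg hb]
    have := (π a).2
    omega
  have hsame : ∀ π a b, (a ∈ S ↔ b ∈ S) → (t π a < t π b ↔ π a < π b) := by
    intro π a b hab
    rw [ht', Fin.lt_def]
    by_cases ha : a ∈ S
    · simp [ha, hab.mp ha]
    · simp [ha, mt hab.mpr ha]
  have hlt : ∀ π a, ((t π a : ℕ) < p ↔ a ∈ S) := fun π => lt_card_iff_of_initial (hblock π)
  -- The factorization is the bijection `π ↦ (t π, (t π)⁻¹ π)`, with inverse composition.
  have hsum : leSum 𝒲 n G = ∑ τ : I ≃ Fin n, if IsLinExt G τ ∧ ∀ a, (τ a : ℕ) < p ↔ a ∈ S then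
      shuffleSum 𝒲 n p ∘ₗ koszul 𝒲 τ else 0 := by
    simp only [leSum, shuffleSum]
    rw [← Finset.sum_filter, ← Finset.sum_filter]
    simp only [linearMap_sum_comp]
    rw [Finset.sum_sigma']
    symm
    refine Finset.sum_bij' (fun x _ => x.1.trans x.2) (fun π _ => ⟨t π, (t π).symm.trans π⟩)
      ?_ ?_ ?_ ?_ ?_
    · rintro ⟨τ, ρ⟩ h
      simp only [Finset.mem_sigma, Finset.mem_filter, Finset.mem_univ, true_and] at h ⊢
      intro a b hab
      have h1 := h.1.1 a b hab
      have h2 := hS a b hab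
      simp only [Equiv.trans_apply]
      by_cases ha : a ∈ S
      · exact h.2.1 _ _ h1 ((h.1.2 b).mpr (h2.mp ha))
      · exact h.2.2 _ _ h1 (not_lt.mp fun h3 => ha ((h.1.2 a).mp h3))
    · intro π h
      simp only [Finset.mem_sigma, Finset.mem_filter, Finset.mem_univ, true_and] at h ⊢
      refine ⟨⟨fun a b hab => (hsame π a b (hS a b hab)).mpr (h a b hab), hlt π⟩, ?_, ?_⟩
      · intro i j hij hj
        have h1 := (hlt π ((t π).symm j)).mp (by simpa using hj)
        have h2 := (hlt π ((t π).symm i)).mp (by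
          rw [Equiv.apply_symm_apply]; exact lt_trans (Fin.lt_def.mp hij) hj)
        exact (hsame π _ _ (by simp [h1, h2])).mp (by simpa using hij)
      · intro i j hij hi
        have h1 := mt (hlt π ((t π).symm i)).mpr (by simpa using hi)
        have h2 := mt (hlt π ((t π).symm j)).mpr (by
          rw [Equiv.apply_symm_apply]; exact not_lt.mpr (hi.trans (Fin.lt_def.mp hij).le))
        exact (hsame π _ _ (by simp [h1, h2])).mp (by simpa using hij)
    · rintro ⟨τ, ρ⟩ h
      simp only [Finset.mem_sigma, Finset.mem_filter, Finset.mem_univ, true_and] at h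
      -- Uniqueness of the factorization: the shuffle `ρ` preserves the order inside each block, so
      -- `τ` can be read off from the composite.
      have h1 : t (τ.trans ρ) = τ := by
        refine equiv_eq_of_lt_iff fun a b => ?_
        by_cases hab : (a ∈ S ↔ b ∈ S)
        · rw [hsame _ a b hab]
          have h2 : ∀ a b, (a ∈ S ↔ b ∈ S) → τ a < τ b → (τ.trans ρ) a < (τ.trans ρ) b := by
            intro a b hab h3
            by_cases ha : a ∈ S
            · exact h.2.1 _ _ h3 ((h.1.2 b).mpr (hab.mp ha))
            · exact h.2.2 _ _ h3 (not_lt.mp fun h4 => ha ((h.1.2 a).mp h4))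
          refine ⟨fun h3 => ?_, h2 a b hab⟩
          by_contra h4
          rcases (not_lt.mp h4).lt_or_eq with h5 | h5
          · exact h3.asymm (h2 b a hab.symm h5)
          · rw [τ.injective h5] at h3
            exact lt_irrefl _ h3
        · by_cases ha : a ∈ S
          · have hb : b ∉ S := fun hb => hab ⟨fun _ => hb, fun _ => ha⟩
            have h3 := (h.1.2 a).mpr ha
            have h4 := mt (h.1.2 b).mp hb
            exact ⟨fun _ => by rw [Fin.lt_def]; omega, fun _ => hblock _ a b ha hb⟩
          · have hb : b ∈ S := by
              by_contra hb
              exact hab ⟨fun h => absurd h ha, fun h => absurd h hb⟩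
            have h3 := (h.1.2 b).mpr hb
            have h4 := mt (h.1.2 a).mp ha
            exact ⟨fun h5 => absurd h5 (hblock _ b a hb ha).asymm,
              fun h5 => by rw [Fin.lt_def] at h5; omega⟩
      simp only [h1]
      congr 1
      ext x
      simp
    · intro π _
      ext x
      simp
    · rintro ⟨τ, ρ⟩ _
      exact (koszul_trans 𝒲 τ ρ).symm
  rw [hsum, LinearMap.sum_apply]
  refine Submodule.sum_mem _ fun τ _ => ?_
  split_ifs
  · exact Submodule.mem_iSup_of_mem p (Submodule.mem_iSup_of_mem (Finset.mem_Ioo.mpr ⟨hp0, hpn⟩)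
      ⟨_, rfl⟩)
  · exact Submodule.zero_mem _

end LeSum

/-! ### Modifications of trees -/

section Trees

variable {I J : Type}

theorem addEdge_comm (H : Digraph I) (a b c d : I) :
    addEdge (addEdge H a b) c d = addEdge (addEdge H c d) a b := by
  ext x y
  simp only [addEdge]
  tauto

theorem separating_addEdge {H : Digraph I} {a b : I} {S : Set I} :
    Separating (addEdge H a b) S ↔ Separating H S ∧ (a ∈ S ↔ b ∈ S) := by
  constructor
  · exact fun h => ⟨fun x y hxy => h x y (Or.inl hxy), h a b (Or.inr ⟨rfl, rfl⟩)⟩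
  · rintro ⟨h1, h2⟩ x y (h | ⟨rfl, rfl⟩)
    · exact h1 x y h
    · exact h2

theorem conn_addEdge_swap {H : Digraph I} {a b : I} :
    Conn (addEdge H a b) ↔ Conn (addEdge H b a) := by
  simp only [Conn, separating_addEdge, iff_comm (a := a ∈ _)]

variable [Fintype I]

theorem card_edges_addEdge_le (H : Digraph I) (a b : I) :
    (edges (addEdge H a b)).card ≤ (edges H).card + 1 := by
  classical
  rw [edges_addEdge]
  exact Finset.card_insert_le _ _

theorem card_edges_addEdge {H : Digraph I} {a b : I} (h : ¬ H.Adj a b) :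
    (edges (addEdge H a b)).card = (edges H).card + 1 := by
  classical
  rw [edges_addEdge, Finset.card_insert_of_notMem (by simpa using h)]

theorem IsSGraph.reverse {H : Digraph I} {a b : I} (hab : ¬ H.Adj a b)
    (h : IsSGraph (addEdge H a b)) : IsSGraph (addEdge H b a) := by
  obtain ⟨h1, h2, h3⟩ := isSGraph_iff.mp h
  refine isSGraph_iff.mpr ⟨h1, conn_addEdge_swap.mp h2, ?_⟩
  have := card_edges_addEdge hab
  have := card_edges_addEdge_le H b a
  omega

theorem IsSGraph.not_conn {H : Digraph I} {a b : I} (hab : ¬ H.Adj a b)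
    (h : IsSGraph (addEdge H a b)) : ¬ Conn H := by
  have h1 := h.not_conn_delEdge (a := a) (b := b) (Or.inr ⟨rfl, rfl⟩)
  rwa [delEdge_addEdge hab] at h1

/-- As `a` and `b` are joined, moving the start of the other edge from `a` to `b` changes no
separating set, and it does not increase the number of edges. -/
theorem IsSGraph.slide {H : Digraph I} {a b c : I} (hab : ¬ H.Adj a b) (hac : ¬ H.Adj a c)
    (hbc : b ≠ c) (h : IsSGraph (addEdge (addEdge H a c) a b)) :
    IsSGraph (addEdge (addEdge H a b) b c) := by
  obtain ⟨h1, h2, h3⟩ := isSGraph_iff.mp h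
  refine isSGraph_iff.mpr ⟨h1, fun S hS hne => h2 S ?_ hne, ?_⟩
  · simp only [separating_addEdge] at hS ⊢
    tauto
  · have := card_edges_addEdge (H := addEdge H a c) (a := a) (b := b) (by
      rintro (h | h)
      · exact hab h
      · exact hbc h.2)
    have := card_edges_addEdge hac
    have := card_edges_addEdge_le (addEdge H a b) b c
    have := card_edges_addEdge_le H a b
    omega

theorem IsSGraph.pullback_equiv [Fintype J] {G : Digraph J} (h : IsSGraph G) (e : I ≃ J) :
    IsSGraph (pullback e G) := by
  obtain ⟨⟨x⟩, h2, h3⟩ := isSGraph_iff.mp h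
  refine isSGraph_iff.mpr ⟨⟨e.symm x⟩, ?_, ?_⟩
  · rintro S hS ⟨y, hy⟩
    have h4 := h2 (e.symm ⁻¹' S) (fun a b hab => hS _ _ (by simpa [pullback] using hab))
      ⟨e y, by simpa using hy⟩
    refine Set.eq_univ_of_forall fun z => ?_
    have h5 : e z ∈ e.symm ⁻¹' S := by rw [h4]; trivial
    simpa using h5
  · rw [Fintype.card_congr e]
    refine le_trans (Nat.add_le_add_right ?_ 1) h3
    refine Finset.card_le_card_of_injOn (fun x => (e x.1, e x.2)) (fun x hx => ?_) ?_
    · simpa [pullback] using hx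
    · rintro ⟨a, b⟩ _ ⟨c, d⟩ _ h
      simp only [Prod.mk.injEq, EmbeddingLike.apply_eq_iff_eq] at h
      exact Prod.ext h.1 h.2

theorem isSGraph_longGraph {n : ℕ} (hn : 1 ≤ n) : IsSGraph (longGraph n) := by
  refine isSGraph_iff.mpr ⟨⟨⟨0, hn⟩⟩, conn_of_forall_mem ⟨0, hn⟩ fun S hS h0 => ?_, ?_⟩
  · refine Set.eq_univ_of_forall fun x => ?_
    have h1 : ∀ j : ℕ, ∀ hj : j < n, (⟨j, hj⟩ : Fin n) ∈ S := by
      intro j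
      induction j with
      | zero => exact fun _ => h0
      | succ j ih => exact fun hj => (hS ⟨j, by omega⟩ ⟨j + 1, hj⟩ rfl).mp (ih (by omega))
    exact h1 x x.2
  · rw [Fintype.card_fin]
    have h1 : (edges (longGraph n)).card ≤ (Finset.range (n - 1)).card := by
      refine Finset.card_le_card_of_injOn (fun x => (x.1 : ℕ)) (fun x hx => ?_) ?_
      · have h2 : (x.1 : ℕ) + 1 = x.2 := by simpa [longGraph] using hx
        have := x.2.2
        simp only [Finset.coe_range, Set.mem_Iio]
        omega
      · rintro ⟨a, b⟩ h ⟨c, d⟩ h' hac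
        have h2 : (a : ℕ) + 1 = b := by simpa [longGraph] using h
        have h3 : (c : ℕ) + 1 = d := by simpa [longGraph] using h'
        simp only at hac
        exact Prod.ext (Fin.ext hac) (Fin.ext (by simp only; omega))
    rw [Finset.card_range] at h1
    omega

/-- A tree in which every vertex has at most one incoming edge. -/
def IsArborescence (D : Digraph I) : Prop :=
  IsSGraph D ∧ ∀ a b c, D.Adj a c → D.Adj b c → a = b

theorem isArborescence_orientFrom {G : Digraph I} (h : IsSGraph G) (r : I) :
    IsArborescence (orientFrom G r) :=
  ⟨isSGraph_orientFrom h r, fun _ _ _ hac hbc =>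
    (orientFrom_unique h hac (Or.inl hbc) hbc).symm⟩

/-- Only the parent of `c` changes, from `a` to `b`. -/
theorem IsArborescence.slide {H : Digraph I} {a b c : I} (hab : ¬ H.Adj a b) (hac : ¬ H.Adj a c)
    (hbc : b ≠ c) (h : IsArborescence (addEdge (addEdge H a c) a b)) :
    IsArborescence (addEdge (addEdge H a b) b c) := by
  have h1 := h.1.slide hab hac hbc
  refine ⟨h1, fun x y z hx hy => ?_⟩
  have h2 : ∀ x, (addEdge (addEdge H a b) b c).Adj x c → x = b := by
    rintro x' ((hx' | hx') | hx')
    · have := h.2 x' a c (Or.inl (Or.inl hx')) (Or.inl (Or.inr ⟨rfl, rfl⟩))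
      rw [this] at hx'
      exact absurd hx' hac
    · exact absurd hx'.2.symm hbc
    · exact hx'.1
  by_cases hz : z = c
  · subst hz
    rw [h2 x hx, h2 y hy]
  · refine h.2 x y z ?_ ?_
    · rcases hx with (hx | hx) | hx
      · exact Or.inl (Or.inl hx)
      · exact Or.inr hx
      · exact absurd hx.2 hz
    · rcases hy with (hy | hy) | hy
      · exact Or.inl (Or.inl hy)
      · exact Or.inr hy
      · exact absurd hy.2 hz

/-- An arborescence without branching is a path. -/
theorem IsArborescence.adj_iff_of_linear {n : ℕ} (hn : Fintype.card I = n) {D : Digraph I}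
    (h : IsArborescence D) (hout : ∀ a b c, D.Adj a b → D.Adj a c → b = c) {π : I ≃ Fin n}
    (hπ : IsLinExt D π) (x y : I) : D.Adj x y ↔ (π x : ℕ) + 1 = π y := by
  classical
  -- The first vertex has no parent. If `v` had none either, then edges, which are determined by
  -- their targets, would number at most `n - 2`, too few for a connected graph.
  have hpar : ∀ v, 0 < (π v : ℕ) → ∃ u, D.Adj u v := by
    intro v hv
    by_contra hno
    push Not at hno
    have hn0 : 0 < n := lt_of_lt_of_le hv (π v).2.le
    have h1 := (isSGraph_iff.mp h.1).2.1
    have hne : Nonempty I := ⟨v⟩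
    have h2 := h1.card_le
    have h3 : (edges D).card ≤ ((Finset.univ.erase v).erase (π.symm ⟨0, hn0⟩)).card := by
      refine Finset.card_le_card_of_injOn Prod.snd (fun e he => ?_) ?_
      · have he' : D.Adj e.1 e.2 := by simpa using he
        simp only [Finset.coe_erase, Set.mem_sdiff, Set.mem_singleton_iff, Finset.coe_univ,
          Set.mem_univ, true_and]
        refine ⟨?_, ?_⟩
        · rintro rfl
          exact hno _ he'
        · intro h4
          have := hπ _ _ he'
          rw [h4, Equiv.apply_symm_apply, Fin.lt_def] at this
          simp at this
      · rintro ⟨a, b⟩ hab ⟨c, d⟩ hcd hbd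
        simp only [Finset.mem_coe, mem_edges] at hab hcd hbd
        subst hbd
        rw [h.2 _ _ _ hab hcd]
    have hv' : π.symm ⟨0, hn0⟩ ≠ v := by
      rintro rfl
      simp at hv
    rw [Finset.card_erase_of_mem (Finset.mem_erase.mpr ⟨hv', Finset.mem_univ _⟩),
      Finset.card_erase_of_mem (Finset.mem_univ _), Finset.card_univ, hn] at h3
    have h4 := (π v).2
    omega
  -- The parent of the vertex at position `j + 1` is at position `j`: an earlier vertex already has
  -- its successor in the order as its child, and there is no second child.
  have hadj : ∀ j : ℕ, ∀ x y : I, (π x : ℕ) = j → (π y : ℕ) = j + 1 → D.Adj x y := by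
    intro j
    induction j using Nat.strong_induction_on with
    | _ j ih =>
      intro x y hx hy
      obtain ⟨u, hu⟩ := hpar y (by omega)
      have h1 := Fin.lt_def.mp (hπ _ _ hu)
      rcases Nat.lt_or_ge (π u) j with h2 | h2
      · have h3 := ih (π u) h2 u (π.symm ⟨π u + 1, by omega⟩) rfl (by simp)
        have h4 := hout _ _ _ hu h3
        have h5 : (π y : ℕ) = π u + 1 := by rw [h4]; simp
        omega
      · have h3 : u = x := π.injective (Fin.ext (by omega))
        rwa [h3] at hu
  refine ⟨fun hxy => ?_, fun hxy => hadj (π x) x y rfl hxy.symm⟩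
  have h1 := Fin.lt_def.mp (hπ _ _ hxy)
  have h2 := hadj (π x) x (π.symm ⟨π x + 1, by omega⟩) rfl (by simp)
  rw [hout _ _ _ hxy h2]
  simp

theorem twoChains_addEdge_isArborescence {n p : ℕ} (hp0 : 0 < p) (hpn : p < n) :
    IsArborescence (addEdge (twoChains n p) ⟨0, hp0.trans hpn⟩ ⟨p, hpn⟩) := by
  refine ⟨isSGraph_iff.mpr ⟨⟨⟨p, hpn⟩⟩, conn_of_forall_mem ⟨0, hp0.trans hpn⟩
    fun S hS h0 => ?_, ?_⟩, ?_⟩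
  · rw [separating_addEdge] at hS
    refine Set.eq_univ_of_forall fun x => ?_
    have h1 : ∀ j : ℕ, ∀ hj : j < n, (⟨j, hj⟩ : Fin n) ∈ S := by
      intro j
      induction j with
      | zero => exact fun _ => h0
      | succ j ih =>
        intro hj
        by_cases hjp : j + 1 = p
        · subst hjp
          exact hS.2.mp h0
        · exact (hS.1 ⟨j, by omega⟩ ⟨j + 1, hj⟩ ⟨rfl, hjp⟩).mp (ih (by omega))
    exact h1 x x.2
  -- The edge count is that of the long graph, whose edge from `p - 1` to `p` is exchanged for one
  -- from `0` to `p`.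
  · have h2 := card_edges_delEdge (G := longGraph n) (a := ⟨p - 1, by omega⟩) (b := ⟨p, hpn⟩)
      (Nat.sub_add_cancel hp0)
    have h3 : delEdge (longGraph n) ⟨p - 1, by omega⟩ ⟨p, hpn⟩ = twoChains n p := by
      ext x y
      simp only [delEdge, longGraph, twoChains, Fin.ext_iff]
      constructor
      · rintro ⟨h, h'⟩; exact ⟨h, by omega⟩
      · rintro ⟨h, h'⟩; exact ⟨h, by omega⟩
    rw [h3] at h2
    have h4 := card_edges_addEdge_le (twoChains n p) ⟨0, hp0.trans hpn⟩ ⟨p, hpn⟩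
    have h5 := (isSGraph_iff.mp (isSGraph_longGraph (n := n) (by omega))).2.2
    omega
  · rintro a b c (⟨h1, h1'⟩ | ⟨h1, h1'⟩) (⟨h2, h2'⟩ | ⟨h2, h2'⟩)
    · exact Fin.ext (by omega)
    · exact absurd (congrArg Fin.val h2') h1'
    · exact absurd (congrArg Fin.val h1') h2'
    · rw [h1, h2]

end Trees

/-! ### The graph model and the shuffle quotient in a fixed weight -/

section Weight

variable {k : Type u} [Field k] {W : Type v} [AddCommGroup W] [Module k W]
  (𝒲 : ℤ → Submodule k W) [DirectSum.Decomposition 𝒲] {n : ℕ}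

/-- The class in the Harrison complex of the sum over all linear extensions. -/
def harrLE (G : Digraph (Fin n)) : (⨂[k] _ : Fin n, W) →ₗ[k] HarrWeight 𝒲 n :=
  (harrisonShuffles 𝒲 n).mkQ ∘ₗ leSum 𝒲 n G

theorem harrLE_of_not_conn {G : Digraph (Fin n)} (hG : ¬ Conn G) : harrLE 𝒲 G = 0 := by
  exact LinearMap.ext fun x => (Submodule.Quotient.mk_eq_zero _).mpr
    (leSum_mem_harrisonShuffles 𝒲 (Fintype.card_fin n) hG x)

/-- The two sides add up to the sum for `H`, which is disconnected and hence gives shuffles. -/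
theorem harrLE_addEdge_swap {H : Digraph (Fin n)} (hH : ¬ Conn H) {a b : Fin n} (hab : a ≠ b) :
    harrLE 𝒲 (addEdge H a b) = -harrLE 𝒲 (addEdge H b a) := by
  have h := harrLE_of_not_conn 𝒲 hH
  unfold harrLE at h ⊢
  rw [leSum_addEdge_add 𝒲 n H hab, LinearMap.comp_add] at h
  exact eq_neg_of_add_eq_zero_left h

theorem harrLE_fork (H : Digraph (Fin n)) {a b c : Fin n} (hbc : b ≠ c) :
    harrLE 𝒲 (addEdge (addEdge H a c) a b) =
      harrLE 𝒲 (addEdge (addEdge H a b) b c) + harrLE 𝒲 (addEdge (addEdge H a c) c b) := by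
  unfold harrLE
  rw [leSum_fork 𝒲 n H hbc, LinearMap.comp_add]

theorem not_adj_of_isSGraph_addEdge {H : Digraph (Fin n)} {a b : Fin n}
    (h : IsSGraph (addEdge H b a)) : ¬ H.Adj a b := by
  intro h1
  exact h.asymm (a := a) (b := b) (Or.inl h1) (Or.inr ⟨rfl, rfl⟩)

/-- If `H` contained `b → c` already, the third graph would contain the cycle `a → b → c → a`. This
excludes degenerate instances of the Arnold relation. -/
theorem not_adj_of_arnold {H : Digraph (Fin n)} {a b c : Fin n}
    (h₁ : IsSGraph (addEdge (addEdge H a b) b c)) (h₃ : IsSGraph (addEdge (addEdge H c a) a b)) :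
    ¬ (addEdge H a b).Adj b c := by
  rintro (h | h)
  · have hca : (addEdge (addEdge H c a) a b).Adj c a := Or.inl (Or.inr ⟨rfl, rfl⟩)
    obtain ⟨S, hS, hc, ha⟩ := h₃.exists_separating hca
    have hbc : b ≠ c := h₁.ne (Or.inr ⟨rfl, rfl⟩)
    have hac : a ≠ c := (h₃.ne hca).symm
    have h1 := hS a b ⟨Or.inr ⟨rfl, rfl⟩, fun h => hac h.1⟩
    have h2 := hS b c ⟨Or.inl (Or.inl h), fun h => hbc h.1⟩
    exact ha (h1.mpr (h2.mpr hc))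
  · have hab : a ≠ b := h₁.ne (Or.inl (Or.inr ⟨rfl, rfl⟩))
    exact hab h.1.symm

/-- Reversing arrows turns the second graph into the chain `a → c → b` (two signs) and the third
into the fork `a → b`, `a → c` (one sign); the relation then says that the fork is the sum of the
two chains. -/
theorem harrLE_arnold {H : Digraph (Fin n)} {a b c : Fin n}
    (h₁ : IsSGraph (addEdge (addEdge H a b) b c)) (h₂ : IsSGraph (addEdge (addEdge H b c) c a))
    (h₃ : IsSGraph (addEdge (addEdge H c a) a b)) :
    harrLE 𝒲 (addEdge (addEdge H a b) b c) + harrLE 𝒲 (addEdge (addEdge H b c) c a) +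
      harrLE 𝒲 (addEdge (addEdge H c a) a b) = 0 := by
  have hab : a ≠ b := h₁.ne (Or.inl (Or.inr ⟨rfl, rfl⟩))
  have hbc : b ≠ c := h₁.ne (Or.inr ⟨rfl, rfl⟩)
  have hca : c ≠ a := h₂.ne (Or.inr ⟨rfl, rfl⟩)
  have n1 : ¬ Conn (addEdge H a b) := h₁.not_conn (not_adj_of_arnold h₁ h₃)
  have n2 : ¬ Conn (addEdge H b c) := h₂.not_conn (not_adj_of_arnold h₂ h₁)
  have n3 : ¬ Conn (addEdge H c a) := h₃.not_conn (not_adj_of_arnold h₃ h₂)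
  rw [conn_addEdge_swap] at n3
  have e2 : harrLE 𝒲 (addEdge (addEdge H b c) c a) = harrLE 𝒲 (addEdge (addEdge H a c) c b) := by
    rw [harrLE_addEdge_swap 𝒲 n2 hca, addEdge_comm, harrLE_addEdge_swap 𝒲 n3 hbc, neg_neg]
  have e3 : harrLE 𝒲 (addEdge (addEdge H c a) a b) =
      -harrLE 𝒲 (addEdge (addEdge H a c) a b) := by
    rw [addEdge_comm, harrLE_addEdge_swap 𝒲 n1 hca, addEdge_comm]
  rw [e2, e3, harrLE_fork 𝒲 H hbc]
  abel

theorem harrLE_pullback (σ : Equiv.Perm (Fin n)) (G : Digraph (Fin n)) (x : ⨂[k] _ : Fin n, W) :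
    harrLE 𝒲 (pullback σ.symm G) (koszul 𝒲 σ x) = harrLE 𝒲 G x := by
  have h := leSum_koszul 𝒲 n σ (pullback σ.symm G)
  have h1 : pullback σ (pullback σ.symm G) = G := by
    ext a b
    simp [pullback]
  rw [h1] at h
  unfold harrLE
  rw [← h]
  rfl

/-- The map from the graph model to the shuffle quotient, by the sum over linear extensions. -/
def graphToHarr (n : ℕ) : EilWeight 𝒲 n →ₗ[k] HarrWeight 𝒲 n :=
  (eilRel 𝒲 n).liftQ (Finsupp.lsum k (fun G : SGr n => harrLE 𝒲 G.1)) (by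
    unfold eilRel
    refine sup_le (sup_le ?_ ?_) ?_ <;> refine Submodule.span_le.mpr ?_
    · rintro _ ⟨σ, G, G', x, hG, rfl⟩
      simp only [SetLike.mem_coe, LinearMap.mem_ker, map_sub, Finsupp.lsum_single]
      rw [hG, harrLE_pullback, sub_self]
    · rintro _ ⟨H, a, b, G, G', x, hG, hG', rfl⟩
      simp only [SetLike.mem_coe, LinearMap.mem_ker, map_add, Finsupp.lsum_single]
      have h1 := G.2
      have h2 := G'.2
      rw [hG] at h1 ⊢
      rw [hG'] at h2 ⊢
      rw [harrLE_addEdge_swap 𝒲 (h1.not_conn (not_adj_of_isSGraph_addEdge h2))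
        (h1.ne (Or.inr ⟨rfl, rfl⟩))]
      simp
    · rintro _ ⟨H, a, b, c, G₁, G₂, G₃, x, h₁, h₂, h₃, rfl⟩
      simp only [SetLike.mem_coe, LinearMap.mem_ker, map_add, Finsupp.lsum_single]
      have h1 := G₁.2
      have h2 := G₂.2
      have h3 := G₃.2
      rw [h₁] at h1 ⊢
      rw [h₂] at h2 ⊢
      rw [h₃] at h3 ⊢
      exact LinearMap.congr_fun (harrLE_arnold 𝒲 h1 h2 h3) x)

theorem eilWeightClass_apply {G : Digraph (Fin n)} (h : IsSGraph G) (x : ⨂[k] _ : Fin n, W) :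
    eilWeightClass 𝒲 n G x = (eilRel 𝒲 n).mkQ (Finsupp.single (⟨G, h⟩ : SGr n) x) := by
  unfold eilWeightClass
  rw [dif_pos h]
  rfl

theorem graphToHarr_eilWeightClass {G : Digraph (Fin n)} (h : IsSGraph G)
    (x : ⨂[k] _ : Fin n, W) : graphToHarr 𝒲 n (eilWeightClass 𝒲 n G x) = harrLE 𝒲 G x := by
  rw [eilWeightClass_apply 𝒲 h, graphToHarr, Submodule.mkQ_apply, Submodule.liftQ_apply,
    Finsupp.lsum_single]

theorem eilWeightClass_symm {G : Digraph (Fin n)} (h : IsSGraph G) (σ : Equiv.Perm (Fin n))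
    (x : ⨂[k] _ : Fin n, W) :
    eilWeightClass 𝒲 n (pullback σ.symm G) (koszul 𝒲 σ x) = eilWeightClass 𝒲 n G x := by
  rw [eilWeightClass_apply 𝒲 h, eilWeightClass_apply 𝒲 (h.pullback_equiv σ.symm), ← sub_eq_zero,
    ← map_sub]
  refine (Submodule.Quotient.mk_eq_zero _).mpr (Submodule.mem_sup_left (Submodule.mem_sup_left
    (Submodule.subset_span ⟨σ, ⟨G, h⟩, ⟨_, h.pullback_equiv σ.symm⟩, x, rfl, rfl⟩)))

theorem eilWeightClass_swap {H : Digraph (Fin n)} {a b : Fin n}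
    (h : IsSGraph (addEdge H a b)) (h' : IsSGraph (addEdge H b a)) :
    eilWeightClass 𝒲 n (addEdge H a b) = -eilWeightClass 𝒲 n (addEdge H b a) := by
  refine LinearMap.ext fun x => ?_
  rw [LinearMap.neg_apply, eilWeightClass_apply 𝒲 h, eilWeightClass_apply 𝒲 h',
    eq_neg_iff_add_eq_zero, ← map_add]
  exact (Submodule.Quotient.mk_eq_zero _).mpr (Submodule.mem_sup_left (Submodule.mem_sup_right
    (Submodule.subset_span ⟨H, a, b, ⟨_, h⟩, ⟨_, h'⟩, x, rfl, rfl, rfl⟩)))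

theorem eilWeightClass_arnold {H : Digraph (Fin n)} {a b c : Fin n}
    (h₁ : IsSGraph (addEdge (addEdge H a b) b c)) (h₂ : IsSGraph (addEdge (addEdge H b c) c a))
    (h₃ : IsSGraph (addEdge (addEdge H c a) a b)) :
    eilWeightClass 𝒲 n (addEdge (addEdge H a b) b c) +
      eilWeightClass 𝒲 n (addEdge (addEdge H b c) c a) +
      eilWeightClass 𝒲 n (addEdge (addEdge H c a) a b) = 0 := by
  refine LinearMap.ext fun x => ?_
  rw [LinearMap.add_apply, LinearMap.add_apply, eilWeightClass_apply 𝒲 h₁,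
    eilWeightClass_apply 𝒲 h₂, eilWeightClass_apply 𝒲 h₃, ← map_add, ← map_add]
  exact (Submodule.Quotient.mk_eq_zero _).mpr (Submodule.mem_sup_right
    (Submodule.subset_span ⟨H, a, b, c, ⟨_, h₁⟩, ⟨_, h₂⟩, ⟨_, h₃⟩, x, rfl, rfl, rfl, rfl⟩))

/-- The Arnold relation with two arrows reversed in the second graph and one in the third. The rest
of the argument checks that all graphs on the way are trees. -/
theorem eilWeightClass_fork {H : Digraph (Fin n)} {a b c : Fin n} (hab : ¬ H.Adj a b)
    (hac : ¬ H.Adj a c) (hbc : b ≠ c) (h : IsSGraph (addEdge (addEdge H a c) a b)) :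
    eilWeightClass 𝒲 n (addEdge (addEdge H a c) a b) =
      eilWeightClass 𝒲 n (addEdge (addEdge H a b) b c) +
      eilWeightClass 𝒲 n (addEdge (addEdge H a c) c b) := by
  have h' : IsSGraph (addEdge (addEdge H a b) a c) := by rwa [addEdge_comm]
  have n1 : ¬ (addEdge H a b).Adj a c := by
    rintro (h1 | h1)
    · exact hac h1
    · exact hbc h1.2.symm
  have h₁ : IsSGraph (addEdge (addEdge H a b) b c) := h.slide hab hac hbc
  have h₃' : IsSGraph (addEdge (addEdge H a b) c a) := h'.reverse n1
  have h₃ : IsSGraph (addEdge (addEdge H c a) a b) := by rwa [addEdge_comm]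
  have h₂' : IsSGraph (addEdge (addEdge H a c) c b) := h'.slide hac hab hbc.symm
  have hne1 : c ≠ b := hbc.symm
  have hasym : ¬ (addEdge H a c).Adj c b := by
    rintro (h1 | h1)
    · have := h₁.asymm (a := b) (b := c) (Or.inr ⟨rfl, rfl⟩)
      exact this (Or.inl (Or.inl h1))
    · exact h.ne (a := a) (b := c) (Or.inl (Or.inr ⟨rfl, rfl⟩)) h1.1.symm
  have h4 : IsSGraph (addEdge (addEdge H a c) b c) := h₂'.reverse hasym
  have h5 : IsSGraph (addEdge (addEdge H b c) a c) := by rwa [addEdge_comm]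
  have n2 : ¬ (addEdge H b c).Adj a c := by
    rintro (h1 | h1)
    · exact hac h1
    · exact h.ne (a := a) (b := b) (Or.inr ⟨rfl, rfl⟩) h1.1
  have h₂ : IsSGraph (addEdge (addEdge H b c) c a) := h5.reverse n2
  have key := eilWeightClass_arnold 𝒲 h₁ h₂ h₃
  rw [eilWeightClass_swap 𝒲 h₂ h5, addEdge_comm H b c a c, eilWeightClass_swap 𝒲 h4 h₂',
    addEdge_comm H c a a b, eilWeightClass_swap 𝒲 h₃' h', addEdge_comm H a b a c, neg_neg,
    ← sub_eq_add_neg, sub_eq_zero] at key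
  exact key.symm

theorem leSum_of_linear {D : Digraph (Fin n)} {π : Equiv.Perm (Fin n)}
    (h : D = pullback π (longGraph n)) : leSum 𝒲 n D = koszul 𝒲 π := by
  rw [h, ← leSum_koszul, leSum_longGraph, LinearMap.id_comp]

open scoped Classical in
/-- Every arborescence is the sum of the bar generators given by its linear extensions. -/
theorem eilWeightClass_of_isArborescence {D : Digraph (Fin n)} (hD : IsArborescence D) :
    eilWeightClass 𝒲 n D = bar 𝒲 n ∘ₗ leSum 𝒲 n D := by
  obtain ⟨N, hN⟩ : ∃ N, (Finset.univ.filter fun π : Fin n ≃ Fin n => IsLinExt D π).card = N :=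
    ⟨_, rfl⟩
  induction N using Nat.strong_induction_on generalizing D with
  | _ N ih =>
    -- At a branching the fork identity replaces `D` by two arborescences. They share out the linear
    -- extensions of `D`, and each has at least one, so each has fewer than `D`.
    by_cases hsib : ∃ a b c, b ≠ c ∧ D.Adj a b ∧ D.Adj a c
    · obtain ⟨a, b, c, hbc, hab, hac⟩ := hsib
      obtain ⟨H, hHb, hHc, rfl⟩ : ∃ H : Digraph (Fin n), ¬ H.Adj a b ∧ ¬ H.Adj a c ∧
          D = addEdge (addEdge H a c) a b := by
        refine ⟨delEdge (delEdge D a b) a c, fun h => h.1.2 ⟨rfl, rfl⟩, fun h => h.2 ⟨rfl, rfl⟩, ?_⟩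
        rw [addEdge_delEdge (show (delEdge D a b).Adj a c from ⟨hac, fun h => hbc h.2.symm⟩),
          addEdge_delEdge hab]
      have hD' : IsArborescence (addEdge (addEdge H a b) a c) := by rwa [addEdge_comm]
      have h1 := hD.slide hHb hHc hbc
      have h2 := hD'.slide hHc hHb hbc.symm
      have hcard : (Finset.univ.filter fun π : Fin n ≃ Fin n =>
          IsLinExt (addEdge (addEdge H a c) a b) π).card =
          (Finset.univ.filter fun π : Fin n ≃ Fin n =>
            IsLinExt (addEdge (addEdge H a b) b c) π).card +
          (Finset.univ.filter fun π : Fin n ≃ Fin n =>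
            IsLinExt (addEdge (addEdge H a c) c b) π).card := by
        rw [← Finset.card_union_of_disjoint]
        · congr 1
          ext π
          simp only [Finset.mem_filter, Finset.mem_union, Finset.mem_univ, true_and,
            isLinExt_fork_iff n H hbc π]
        · rw [Finset.disjoint_left]
          intro π h3
          simp only [Finset.mem_filter, Finset.mem_univ, true_and] at h3 ⊢
          exact not_isLinExt_fork n H π h3
      have hpos : ∀ {D : Digraph (Fin n)}, IsSGraph D →
          0 < (Finset.univ.filter fun π : Fin n ≃ Fin n => IsLinExt D π).card := by
        intro D hD
        obtain ⟨π, hπ⟩ := hD.exists_isLinExt (Fintype.card_fin n)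
        exact Finset.card_pos.mpr ⟨π, by simpa using hπ⟩
      have p1 := hpos h1.1
      have p2 := hpos h2.1
      rw [eilWeightClass_fork 𝒲 hHb hHc hbc hD.1, leSum_fork 𝒲 n H hbc, LinearMap.comp_add,
        ih _ (by omega) h1 rfl, ih _ (by omega) h2 rfl]
    -- Without branching, `D` is a relabelled long graph, and the symmetric group relation makes its
    -- class a bar generator.
    · have hout : ∀ a b c, D.Adj a b → D.Adj a c → b = c := by
        intro a b c hab hac
        by_contra hbc
        exact hsib ⟨a, b, c, hbc, hab, hac⟩
      obtain ⟨π, hπ⟩ := hD.1.exists_isLinExt (Fintype.card_fin n)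
      have h1 := hD.adj_iff_of_linear (Fintype.card_fin n) hout hπ
      have h2 : D = pullback π (longGraph n) := by
        ext a b
        exact h1 a b
      have h3 : longGraph n = pullback π.symm D := by
        rw [h2]
        ext a b
        simp [pullback]
      rw [leSum_of_linear 𝒲 h2]
      refine LinearMap.ext fun x => ?_
      rw [LinearMap.comp_apply, bar, h3, eilWeightClass_symm 𝒲 hD.1]

/-- Joining the first vertices of the two chains by an edge, in either direction, gives two
arborescences. Their expansions into bar generators add up to the shuffle, and their classes are
opposite by arrow reversal. -/
theorem bar_shuffleSum {p : ℕ} (hp : p ∈ Finset.Ioo 0 n) : bar 𝒲 n ∘ₗ shuffleSum 𝒲 n p = 0 := by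
  obtain ⟨hp0, hpn⟩ := Finset.mem_Ioo.mp hp
  have h1 := twoChains_addEdge_isArborescence hp0 hpn
  have hne : (⟨0, hp0.trans hpn⟩ : Fin n) ≠ ⟨p, hpn⟩ := by
    intro h
    exact hp0.ne (congrArg Fin.val h)
  have hna : ¬ (twoChains n p).Adj ⟨0, hp0.trans hpn⟩ ⟨p, hpn⟩ := fun h => h.2 rfl
  have h2 := h1.1.reverse hna
  have h3 : IsArborescence (addEdge (twoChains n p) ⟨p, hpn⟩ ⟨0, hp0.trans hpn⟩) := by
    refine ⟨h2, ?_⟩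
    rintro a b c (⟨ha, ha'⟩ | ⟨ha, ha'⟩) (⟨hb, hb'⟩ | ⟨hb, hb'⟩)
    · exact Fin.ext (by omega)
    · rw [hb'] at ha
      simp at ha
    · rw [ha'] at hb
      simp at hb
    · rw [ha, hb]
  rw [shuffleSum_eq_leSum, leSum_addEdge_add 𝒲 n _ hne, LinearMap.comp_add,
    ← eilWeightClass_of_isArborescence 𝒲 h1, ← eilWeightClass_of_isArborescence 𝒲 h3,
    eilWeightClass_swap 𝒲 h1.1 h2, neg_add_cancel]

/-- The class of a tree is determined up to sign by the underlying undirected tree. -/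
theorem eilWeightClass_eq_or_neg {G G' : Digraph (Fin n)} (h : IsSGraph G) (h' : IsSGraph G')
    (hGG' : G.toSimpleGraphInclusive = G'.toSimpleGraphInclusive) :
    eilWeightClass 𝒲 n G = eilWeightClass 𝒲 n G' ∨
      eilWeightClass 𝒲 n G = -eilWeightClass 𝒲 n G' := by
  classical
  -- Induction on the number of edges that point the wrong way.
  obtain ⟨N, hN⟩ : ∃ N, (edges G \ edges G').card = N := ⟨_, rfl⟩
  induction N generalizing G with
  | zero =>
    left
    have hsub : ∀ a b, G.Adj a b → G'.Adj a b := by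
      intro a b hab
      by_contra hab'
      have : (a, b) ∈ edges G \ edges G' := by simpa using ⟨hab, hab'⟩
      rw [Finset.card_eq_zero.mp hN] at this
      simp at this
    have : G = G' := by
      ext a b
      refine ⟨hsub a b, fun hab => ?_⟩
      have h1 : G.toSimpleGraphInclusive.Adj a b := by
        rw [hGG']
        exact ⟨h'.ne hab, Or.inl hab⟩
      rcases h1.2 with h2 | h2
      · exact h2
      · exact absurd (hsub _ _ h2) (h'.asymm hab)
    rw [this]
  | succ N ih =>
    obtain ⟨⟨a, b⟩, hab⟩ := Finset.card_pos.mp (by omega : 0 < (edges G \ edges G').card)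
    simp only [Finset.mem_sdiff, mem_edges] at hab
    have hba : G'.Adj b a := by
      have h1 : G'.toSimpleGraphInclusive.Adj a b := by
        rw [← hGG']
        exact ⟨h.ne hab.1, Or.inl hab.1⟩
      rcases h1.2 with h2 | h2
      · exact absurd h2 hab.2
      · exact h2
    have hG : addEdge (delEdge G a b) a b = G := addEdge_delEdge hab.1
    have hna : ¬ (delEdge G a b).Adj a b := fun h => h.2 ⟨rfl, rfl⟩
    have h1 : IsSGraph (addEdge (delEdge G a b) b a) := IsSGraph.reverse hna (by rwa [hG])
    have h2 : (addEdge (delEdge G a b) b a).toSimpleGraphInclusive = G'.toSimpleGraphInclusive := by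
      rw [← hGG']
      ext x y
      simp only [toSimpleGraphInclusive_adj, addEdge, delEdge]
      refine and_congr_right fun _ => ⟨?_, ?_⟩
      · rintro ((h | ⟨rfl, rfl⟩) | (h | ⟨rfl, rfl⟩))
        · exact Or.inl h.1
        · exact Or.inr hab.1
        · exact Or.inr h.1
        · exact Or.inl hab.1
      · rintro (h | h) <;> by_cases hxy : x = a ∧ y = b <;> by_cases hyx : y = a ∧ x = b <;>
          simp_all
    have h3 : (edges (addEdge (delEdge G a b) b a) \ edges G').card = N := by
      have h4 : edges (addEdge (delEdge G a b) b a) \ edges G' =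
          (edges G \ edges G').erase (a, b) := by
        ext ⟨x, y⟩
        simp only [Finset.mem_sdiff, mem_edges, Finset.mem_erase, addEdge, delEdge, ne_eq,
          Prod.mk.injEq]
        constructor
        · rintro ⟨h5 | ⟨rfl, rfl⟩, h6⟩
          · exact ⟨h5.2, h5.1, h6⟩
          · exact absurd hba h6
        · rintro ⟨h5, h6, h7⟩
          exact ⟨Or.inl ⟨h6, h5⟩, h7⟩
      rw [h4, Finset.card_erase_of_mem (by simpa using hab), hN]
      rfl
    have h4 := eilWeightClass_swap 𝒲 (a := a) (b := b) (by rwa [hG]) h1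
    rw [hG] at h4
    rw [h4]
    rcases ih h1 h2 h3 with h5 | h5
    · right; rw [h5]
    · left; rw [h5, neg_neg]

theorem harrisonShuffles_le_ker_bar : harrisonShuffles 𝒲 n ≤ LinearMap.ker (bar 𝒲 n) := by
  refine iSup₂_le fun p hp => ?_
  rintro _ ⟨x, rfl⟩
  exact LinearMap.congr_fun (bar_shuffleSum 𝒲 hp) x

/-- The long graph has the identity as its only linear extension. Thus `graphToHarr` is a left
inverse of the map induced by `bar`, which bounds the kernel of `bar`. -/
theorem graphToHarr_bar (hn : 1 ≤ n) (x : ⨂[k] _ : Fin n, W) :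
    graphToHarr 𝒲 n (bar 𝒲 n x) = (harrisonShuffles 𝒲 n).mkQ x := by
  rw [bar, graphToHarr_eilWeightClass 𝒲 (isSGraph_longGraph hn), harrLE, leSum_longGraph]
  rfl

theorem ker_bar (hn : 1 ≤ n) : LinearMap.ker (bar 𝒲 n) = harrisonShuffles 𝒲 n := by
  refine le_antisymm (fun x hx => ?_) (harrisonShuffles_le_ker_bar 𝒲)
  have h := graphToHarr_bar 𝒲 hn x
  rw [LinearMap.mem_ker.mp hx, map_zero] at h
  exact (Submodule.Quotient.mk_eq_zero _).mp h.symm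

/-- Up to sign, any tree may be reoriented away from one of its vertices, and the resulting
arborescence expands into bar generators. -/
theorem range_bar : LinearMap.range (bar 𝒲 n) = ⊤ := by
  rw [eq_top_iff]
  rintro y -
  obtain ⟨y, rfl⟩ := (eilRel 𝒲 n).mkQ_surjective y
  induction y using Finsupp.induction_linear with
  | zero => rw [map_zero]; exact Submodule.zero_mem _
  | add y z hy hz => rw [map_add]; exact Submodule.add_mem _ hy hz
  | single G x =>
    rw [← eilWeightClass_apply 𝒲 G.2 x]
    obtain ⟨⟨r⟩, _⟩ := isSGraph_iff.mp G.2
    have h1 := isArborescence_orientFrom G.2 r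
    have h2 := eilWeightClass_of_isArborescence 𝒲 h1
    rcases eilWeightClass_eq_or_neg 𝒲 G.2 h1.1 (toSimpleGraphInclusive_orientFrom G.2 r).symm
      with h3 | h3
    · rw [h3, h2]
      exact ⟨_, rfl⟩
    · rw [h3, h2]
      exact Submodule.neg_mem _ ⟨_, rfl⟩

/-- The isomorphism between the shuffle quotient and the graph model in weight `n`. -/
def harrEquivEilWeight (n : ℕ) (hn : 1 ≤ n) : HarrWeight 𝒲 n ≃ₗ[k] EilWeight 𝒲 n :=
  LinearEquiv.ofBijective ((harrisonShuffles 𝒲 n).liftQ (bar 𝒲 n) (harrisonShuffles_le_ker_bar 𝒲))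
    ⟨by
      rw [← LinearMap.ker_eq_bot, Submodule.ker_liftQ, ker_bar 𝒲 hn, Submodule.mkQ_map_self],
    by
      rw [← LinearMap.range_eq_top, Submodule.range_liftQ, range_bar]⟩

theorem harrEquivEilWeight_mkQ (hn : 1 ≤ n) (x : ⨂[k] _ : Fin n, W) :
    harrEquivEilWeight 𝒲 n hn ((harrisonShuffles 𝒲 n).mkQ x) = bar 𝒲 n x := rfl

/-- Since bar generators span, `graphToHarr` is inverse to the isomorphism induced by `bar`. So the
expansion holds for every tree, not only for arborescences, and operations on words can be compared
with operations on graphs. -/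
theorem eilWeightClass_eq_bar {G : Digraph (Fin n)} (hG : IsSGraph G) (x : ⨂[k] _ : Fin n, W) :
    eilWeightClass 𝒲 n G x = bar 𝒲 n (leSum 𝒲 n G x) := by
  have hn : 1 ≤ n := by
    obtain ⟨⟨r⟩, _⟩ := isSGraph_iff.mp hG
    exact lt_of_le_of_lt (Nat.zero_le _) r.2
  obtain ⟨y, hy⟩ : eilWeightClass 𝒲 n G x ∈ LinearMap.range (bar 𝒲 n) := by
    rw [range_bar]; trivial
  have h := congrArg (graphToHarr 𝒲 n) hy
  rw [graphToHarr_bar 𝒲 hn, graphToHarr_eilWeightClass 𝒲 hG] at h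
  rw [← hy, ← harrEquivEilWeight_mkQ 𝒲 hn, h]
  rfl

end Weight

/-! ### Contraction of edges and linear extensions -/

section Contract

variable {n : ℕ}

theorem expandPerm_injective : Function.Injective (expandPerm (n := n)) := by
  intro σ τ h
  have h0 : σ 0 = τ 0 := by
    have := congrArg (fun e : Equiv.Perm (Fin (n + 2)) => e 0) h
    simpa using this
  refine Equiv.ext fun j => ?_
  have := congrArg (fun e : Equiv.Perm (Fin (n + 2)) => e j.succ) h
  simpa [h0] using this

theorem exists_expandPerm {τ : Equiv.Perm (Fin (n + 2))} {i : Fin (n + 1)}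
    (h0 : τ 0 = i.castSucc) (h1 : τ 1 = i.succ) :
    ∃ σ : Equiv.Perm (Fin (n + 1)), σ 0 = i ∧ expandPerm σ = τ := by
  have h2 : ∀ j : Fin (n + 1), ∃ z, i.castSucc.succAbove z = τ j.succ := fun j =>
    Fin.exists_succAbove_eq (by
      rw [← h0]
      exact fun h => Fin.succ_ne_zero _ (τ.injective h))
  choose s hs using h2
  have hinj : Function.Injective s := by
    intro x y hxy
    have := hs x
    rw [hxy, hs y] at this
    exact (Fin.succ_injective _ (τ.injective this)).symm
  have hs0 : s 0 = i := by
    have := hs 0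
    rw [Fin.succ_zero_eq_one, h1, ← Fin.succAbove_castSucc_self] at this
    exact Fin.succAbove_right_injective this
  refine ⟨Equiv.ofBijective s (Finite.injective_iff_bijective.mp hinj), hs0, ?_⟩
  refine Equiv.ext fun j => ?_
  refine Fin.cases ?_ (fun j => ?_) j
  · rw [expandPerm_zero, h0]
    simp [hs0]
  · rw [expandPerm_succ, ← hs j]
    simp [hs0]

@[simp] theorem collapse_zero : collapse (0 : Fin (n + 2)) = 0 := rfl

@[simp] theorem collapse_succ (j : Fin (n + 1)) : collapse j.succ = j := by
  simp [collapse]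

theorem collapse_surjective : Function.Surjective (collapse (n := n)) :=
  fun j => ⟨j.succ, collapse_succ j⟩

theorem expandPerm_lt_iff (σ : Equiv.Perm (Fin (n + 1))) {x y : Fin (n + 2)}
    (h : collapse x ≠ collapse y) :
    expandPerm σ x < expandPerm σ y ↔ σ (collapse x) < σ (collapse y) := by
  induction x using Fin.cases with
  | zero =>
    induction y using Fin.cases with
    | zero => exact absurd rfl h
    | succ j =>
      rw [collapse_zero, collapse_succ] at h ⊢
      have h1 : σ 0 ≠ σ j := fun h' => h (σ.injective h')
      rw [expandPerm_zero, expandPerm_succ, Fin.lt_succAbove_iff_le_castSucc,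
        Fin.castSucc_le_castSucc_iff]
      exact h1.le_iff_lt
  | succ i =>
    induction y using Fin.cases with
    | zero =>
      rw [collapse_zero, collapse_succ] at h ⊢
      rw [expandPerm_zero, expandPerm_succ, Fin.succAbove_lt_iff_castSucc_lt,
        Fin.castSucc_lt_castSucc_iff]
    | succ j =>
      rw [collapse_succ, collapse_succ, expandPerm_succ, expandPerm_succ,
        Fin.succAbove_lt_succAbove_iff]

theorem eq_zero_one_of_collapse_eq {x y : Fin (n + 2)} (hxy : x ≠ y)
    (h : collapse x = collapse y) : (x = 0 ∧ y = 1) ∨ (x = 1 ∧ y = 0) := by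
  induction x using Fin.cases with
  | zero =>
    induction y using Fin.cases with
    | zero => exact absurd rfl hxy
    | succ j =>
      rw [collapse_zero, collapse_succ] at h
      subst h
      exact Or.inl ⟨rfl, rfl⟩
  | succ i =>
    induction y using Fin.cases with
    | zero =>
      rw [collapse_zero, collapse_succ] at h
      subst h
      exact Or.inr ⟨rfl, rfl⟩
    | succ j =>
      rw [collapse_succ, collapse_succ] at h
      exact absurd (congrArg Fin.succ h) hxy

theorem toFront_left {a b : Fin (n + 2)} (hab : a ≠ b) : toFront a b a = 0 := by
  have h1 : (0 : Fin (n + 2)) ≠ Equiv.swap 0 a b := by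
    intro h
    have := congrArg (Equiv.swap 0 a) h
    rw [Equiv.swap_apply_left, Equiv.swap_apply_self] at this
    exact hab this
  simp only [toFront, Equiv.Perm.mul_apply, Equiv.swap_apply_right]
  exact Equiv.swap_apply_of_ne_of_ne (by simp) h1

theorem toFront_right (a b : Fin (n + 2)) : toFront a b b = 1 := by
  simp [toFront]

/-- Linear extensions of the contracted graph are the linear extensions of `G` in which the ends of
the contracted edge are neighbours. The edge itself is respected because `expandPerm` puts `0`
directly before `1`. -/
theorem isLinExt_expandPerm_iff {G : Digraph (Fin (n + 2))}
    (hG : ∀ a b, G.Adj a b → ¬ G.Adj b a) {a b : Fin (n + 2)} (hab : G.Adj a b)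
    (σ : Equiv.Perm (Fin (n + 1))) :
    IsLinExt G ((toFront a b).trans (expandPerm σ)) ↔
      IsLinExt (pushforward (collapse ∘ toFront a b) G) σ := by
  have hne : a ≠ b := by
    rintro rfl
    exact hG a a hab hab
  constructor
  · rintro h _ _ ⟨hxy, x, y, hadj, rfl, rfl⟩
    exact (expandPerm_lt_iff σ hxy).mp (h x y hadj)
  · intro h x y hadj
    rw [Equiv.trans_apply, Equiv.trans_apply]
    by_cases hxy : collapse (toFront a b x) = collapse (toFront a b y)
    · have hne' : toFront a b x ≠ toFront a b y := by
        intro h'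
        obtain rfl := (toFront a b).injective h'
        exact hG x x hadj hadj
      rcases eq_zero_one_of_collapse_eq hne' hxy with ⟨h1, h2⟩ | ⟨h1, h2⟩
      · rw [h1, h2, expandPerm_zero, expandPerm_one]
        exact Fin.castSucc_lt_succ
      · rw [← toFront_right a b] at h1
        rw [← toFront_left hne] at h2
        rw [(toFront a b).injective h1, (toFront a b).injective h2] at hadj
        exact absurd hadj (hG _ _ hab)
    · exact (expandPerm_lt_iff σ hxy).mpr (h _ _ ⟨hxy, x, y, hadj, rfl, rfl⟩)

theorem swap_lt_swap_iff {i : Fin (n + 1)} {x y : Fin (n + 2)}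
    (h : ¬ (x = i.castSucc ∧ y = i.succ)) (hxy : x < y) :
    Equiv.swap i.castSucc i.succ x < Equiv.swap i.castSucc i.succ y := by
  simp only [Equiv.swap_apply_def]
  split_ifs <;> simp only [Fin.lt_def, Fin.ext_iff, Fin.val_castSucc, Fin.val_succ] at * <;> omega

variable {k : Type u} [Field k] {W : Type v} [AddCommGroup W] [Module k W]
  (𝒲 : ℤ → Submodule k W) [DirectSum.Decomposition 𝒲] {m : W →ₗ[k] W →ₗ[k] W}

/-- The bar differential of the sum over all linear extensions of a digraph: pairs of
neighbouring letters that are not joined by an edge cancel, the others correspond to the linear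
extensions of the contracted digraphs. -/
theorem sum_merge_leSum (hm : ∀ i j, ∀ x ∈ 𝒲 i, ∀ y ∈ 𝒲 j, m x y ∈ 𝒲 (i + j + 1))
    (hms : ∀ i j, ∀ x ∈ 𝒲 i, ∀ y ∈ 𝒲 j, m x y = -(ksign k i j • m y x))
    {G : Digraph (Fin (n + 2))} (hG : ∀ a b, G.Adj a b → ¬ G.Adj b a) :
    ∑ i : Fin (n + 1), merge (degInvol 𝒲) m i ∘ₗ leSum 𝒲 (n + 2) G =
      ∑ e ∈ edges G, leSum 𝒲 (n + 1) (pushforward (collapse ∘ toFront e.1 e.2) G) ∘ₗ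
        merge LinearMap.id m 0 ∘ₗ koszul 𝒲 (toFront e.1 e.2) := by
  classical
  -- At a fixed position `i`, linear extensions whose letters at `i` and `i + 1` are not joined by
  -- an edge come in pairs that differ by exchanging these letters; merging takes opposite values on
  -- each pair.
  have h1 : ∀ i : Fin (n + 1), merge (degInvol 𝒲) m i ∘ₗ leSum 𝒲 (n + 2) G =
      ∑ π ∈ Finset.univ.filter (fun π : Equiv.Perm (Fin (n + 2)) => IsLinExt G π ∧
        G.Adj (π.symm i.castSucc) (π.symm i.succ)), merge (degInvol 𝒲) m i ∘ₗ koszul 𝒲 π := by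
    intro i
    have h2 : merge (degInvol 𝒲) m i ∘ₗ leSum 𝒲 (n + 2) G =
        ∑ π ∈ Finset.univ.filter (fun π : Equiv.Perm (Fin (n + 2)) => IsLinExt G π),
          merge (degInvol 𝒲) m i ∘ₗ koszul 𝒲 π := by
      rw [leSum, ← Finset.sum_filter, linearMap_comp_sum]
    rw [h2, ← Finset.sum_filter_add_sum_filter_not _
      (fun π : Equiv.Perm (Fin (n + 2)) => G.Adj (π.symm i.castSucc) (π.symm i.succ)),
      Finset.filter_filter, Finset.filter_filter, add_eq_left]
    have hmem : ∀ π : Equiv.Perm (Fin (n + 2)),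
        π ∈ Finset.univ.filter (fun π : Equiv.Perm (Fin (n + 2)) => IsLinExt G π ∧
          ¬ G.Adj (π.symm i.castSucc) (π.symm i.succ)) →
        π.trans (Equiv.swap i.castSucc i.succ) ∈
          Finset.univ.filter (fun π : Equiv.Perm (Fin (n + 2)) => IsLinExt G π ∧
          ¬ G.Adj (π.symm i.castSucc) (π.symm i.succ)) := by
      intro π hπ
      simp only [Finset.mem_filter, Finset.mem_univ, true_and] at hπ ⊢
      refine ⟨fun x y hxy => ?_, ?_⟩
      · refine swap_lt_swap_iff ?_ (hπ.1 x y hxy)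
        rintro ⟨h3, h4⟩
        rw [← h3, ← h4, Equiv.symm_apply_apply, Equiv.symm_apply_apply] at hπ
        exact hπ.2 hxy
      · simp only [Equiv.symm_trans_apply, Equiv.symm_swap, Equiv.swap_apply_left,
          Equiv.swap_apply_right]
        intro h3
        have h4 := hπ.1 _ _ h3
        rw [Equiv.apply_symm_apply, Equiv.apply_symm_apply] at h4
        exact h4.asymm Fin.castSucc_lt_succ
    refine Finset.sum_involution
      (fun π _ => π.trans (Equiv.swap i.castSucc i.succ)) ?_ ?_ hmem ?_
    · intro π _
      rw [koszul_trans, ← LinearMap.comp_assoc, merge_koszul_swap 𝒲 hm hms]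
      simp only [LinearMap.neg_comp, add_neg_cancel]
    · intro π _ _ h3
      have h4 := congrArg (fun e : Equiv.Perm (Fin (n + 2)) => e (π.symm i.castSucc)) h3
      simp only [Equiv.trans_apply, Equiv.apply_symm_apply, Equiv.swap_apply_left] at h4
      exact (Fin.castSucc_lt_succ (i := i)).ne' h4
    · intro π _
      ext x
      simp
  rw [Finset.sum_congr rfl fun i _ => h1 i]
  have h2 : ∀ e : Fin (n + 2) × Fin (n + 2),
      leSum 𝒲 (n + 1) (pushforward (collapse ∘ toFront e.1 e.2) G) ∘ₗ
        merge LinearMap.id m 0 ∘ₗ koszul 𝒲 (toFront e.1 e.2) =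
      ∑ σ ∈ Finset.univ.filter (fun σ : Equiv.Perm (Fin (n + 1)) =>
        IsLinExt (pushforward (collapse ∘ toFront e.1 e.2) G) σ),
        koszul 𝒲 σ ∘ₗ merge LinearMap.id m 0 ∘ₗ koszul 𝒲 (toFront e.1 e.2) := by
    intro e
    rw [leSum, ← Finset.sum_filter, linearMap_sum_comp]
  rw [Finset.sum_congr rfl fun e _ => h2 e, Finset.sum_sigma', Finset.sum_sigma']
  symm
  -- An edge with a linear extension `σ` of its contraction corresponds to the linear extension of
  -- `G` that has this edge in the positions `σ 0` and `σ 0 + 1`.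
  refine Finset.sum_bij (fun x _ => ⟨x.2 0, (toFront x.1.1 x.1.2).trans (expandPerm x.2)⟩)
    ?_ ?_ ?_ ?_
  · rintro ⟨⟨a, b⟩, σ⟩ h
    simp only [Finset.mem_sigma, Finset.mem_filter, Finset.mem_univ, true_and, mem_edges] at h ⊢
    have hne : a ≠ b := by
      rintro rfl
      exact hG a a h.1 h.1
    refine ⟨(isLinExt_expandPerm_iff hG h.1 σ).mpr h.2, ?_⟩
    simp only [Equiv.symm_trans_apply]
    rw [← expandPerm_zero, ← expandPerm_one, Equiv.symm_apply_apply, Equiv.symm_apply_apply,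
      ← toFront_left hne, Equiv.symm_apply_apply, ← toFront_right a b, Equiv.symm_apply_apply]
    exact h.1
  · rintro ⟨⟨a, b⟩, σ⟩ h ⟨⟨c, d⟩, τ⟩ h' heq
    simp only [Finset.mem_sigma, Finset.mem_filter, Finset.mem_univ, true_and, mem_edges] at h h'
    have hne : a ≠ b := by
      rintro rfl
      exact hG a a h.1 h.1
    have hne' : c ≠ d := by
      rintro rfl
      exact hG c c h'.1 h'.1
    simp only [Sigma.mk.injEq, heq_eq_eq] at heq
    obtain ⟨h3, h4⟩ := heq
    have h5 := Equiv.congr_fun h4 a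
    have h6 := Equiv.congr_fun h4 b
    simp only [Equiv.trans_apply, toFront_left hne, toFront_right, expandPerm_zero,
      expandPerm_one, h3] at h5 h6
    rw [← expandPerm_zero, EmbeddingLike.apply_eq_iff_eq, ← toFront_left hne',
      EmbeddingLike.apply_eq_iff_eq] at h5
    rw [← expandPerm_one, EmbeddingLike.apply_eq_iff_eq, ← toFront_right c d,
      EmbeddingLike.apply_eq_iff_eq] at h6
    subst h5
    subst h6
    have h7 : expandPerm σ = expandPerm τ := by
      ext1 x
      have := Equiv.congr_fun h4 ((toFront c d).symm x)
      simpa using this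
    rw [expandPerm_injective h7]
  · rintro ⟨i, π⟩ h
    simp only [Finset.mem_sigma, Finset.mem_filter, Finset.mem_univ, true_and] at h
    set a := π.symm i.castSucc with ha
    set b := π.symm i.succ with hb
    have hne : a ≠ b := by
      intro h'
      rw [h'] at h
      exact hG b b h.2 h.2
    obtain ⟨σ, hσ, hσ'⟩ := exists_expandPerm (τ := (toFront a b).symm.trans π) (i := i)
      (by rw [Equiv.trans_apply, ← toFront_left hne, Equiv.symm_apply_apply, ha,
            Equiv.apply_symm_apply])
      (by rw [Equiv.trans_apply, ← toFront_right a b, Equiv.symm_apply_apply, hb,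
            Equiv.apply_symm_apply])
    have h3 : (toFront a b).trans (expandPerm σ) = π := by
      rw [hσ']
      ext x
      simp
    refine ⟨⟨(a, b), σ⟩, ?_, ?_⟩
    · simp only [Finset.mem_sigma, Finset.mem_filter, Finset.mem_univ, true_and, mem_edges]
      refine ⟨h.2, (isLinExt_expandPerm_iff hG h.2 σ).mp ?_⟩
      rw [h3]
      exact h.1
    · simp only [h3, hσ]
  · rintro ⟨⟨a, b⟩, σ⟩ h
    simp only
    symm
    rw [koszul_trans, ← LinearMap.comp_assoc, merge_koszul_expandPerm 𝒲 hm,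
      LinearMap.comp_assoc]

theorem isSGraph_contract {G : Digraph (Fin (n + 2))} (hG : IsSGraph G) {a b : Fin (n + 2)}
    (hab : G.Adj a b) : IsSGraph (pushforward (collapse ∘ toFront a b) G) := by
  refine hG.pushforward (collapse_surjective.comp (toFront a b).surjective) (by simp) hab ?_
  simp only [Function.comp_apply, toFront_left (hG.ne hab), toFront_right]
  rfl

/-- A separating set contains both or neither of `a` and `b`, so it is the full preimage of its
image, which separates the contracted graph. -/
theorem not_conn_contract {G : Digraph (Fin (n + 2))} (hG : ¬ Conn G) {a b : Fin (n + 2)}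
    (hab : G.Adj a b) (hne : a ≠ b) : ¬ Conn (pushforward (collapse ∘ toFront a b) G) := by
  intro h
  refine hG fun S hS hne' => ?_
  have hmem : ∀ x y, (collapse ∘ toFront a b) x = (collapse ∘ toFront a b) y → (x ∈ S ↔ y ∈ S) := by
    intro x y hxy
    rcases eq_or_ne x y with rfl | hxy'
    · rfl
    · have h1 := eq_zero_one_of_collapse_eq (fun h => hxy' ((toFront a b).injective h)) hxy
      rw [← toFront_left hne, ← toFront_right a b] at h1
      simp only [EmbeddingLike.apply_eq_iff_eq] at h1
      rcases h1 with ⟨rfl, rfl⟩ | ⟨rfl, rfl⟩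
      · exact hS _ _ hab
      · exact (hS _ _ hab).symm
  have h2 := h ((collapse ∘ toFront a b) '' S) ?_ (hne'.image _)
  · refine Set.eq_univ_of_forall fun x => ?_
    have h3 : (collapse ∘ toFront a b) x ∈ (collapse ∘ toFront a b) '' S := by rw [h2]; trivial
    obtain ⟨y, hy, hyx⟩ := h3
    exact (hmem y x hyx).mp hy
  · rintro _ _ ⟨_, x, y, hxy, rfl, rfl⟩
    have h3 : ∀ z, (collapse ∘ toFront a b) z ∈ (collapse ∘ toFront a b) '' S ↔ z ∈ S :=
      fun z => ⟨fun ⟨w, hw, hwz⟩ => (hmem w z hwz).mp hw, fun hz => ⟨z, hz, rfl⟩⟩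
    rw [h3, h3]
    exact hS x y hxy

end Contract

/-! ### Deconcatenation and linear extensions -/

section Cut

variable {k : Type u} [Field k] {W : Type v} [AddCommGroup W] [Module k W]
  (𝒲 : ℤ → Submodule k W) [DirectSum.Decomposition 𝒲]

/-- The class in the Harrison complex of a word of length `n`, zero for the empty word. -/
def harrClassNat : (n : ℕ) → (⨂[k] _ : Fin n, W) →ₗ[k] Harr 𝒲
  | 0 => 0
  | n + 1 => harrClass 𝒲 n.succPNat

theorem harrClassNat_coe : ∀ n : ℕ+, harrClassNat 𝒲 (n : ℕ) = harrClass 𝒲 n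
  | ⟨0, h⟩ => absurd h (lt_irrefl 0)
  | ⟨_ + 1, _⟩ => rfl

theorem harrClassNat_apply_eq_zero : ∀ (n : ℕ) (x : ⨂[k] _ : Fin n, W),
    x ∈ harrisonShuffles 𝒲 n → harrClassNat 𝒲 n x = 0
  | 0, _, _ => rfl
  | n + 1, x, hx => by
    exact (congrArg (harrIncl 𝒲 n.succPNat)
      ((Submodule.Quotient.mk_eq_zero (harrisonShuffles 𝒲 (n.succPNat : ℕ))).mpr hx)).trans
      (map_zero _)

variable {I J : Type} [Fintype I] [LinearOrder I] [Fintype J] [LinearOrder J]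

/-- The class in the Harrison complex of the sum over the linear extensions of a digraph. -/
def harrLEOf (G : Digraph I) (n : ℕ) : (⨂[k] _ : I, W) →ₗ[k] Harr 𝒲 :=
  harrClassNat 𝒲 n ∘ₗ leSum 𝒲 n G

theorem harrClassOf_eq : harrClassOf 𝒲 (I := J) = harrClassNat 𝒲 (Fintype.card J) ∘ₗ
    koszul 𝒲 (Fintype.orderIsoFinOfCardEq J rfl).symm.toEquiv := by
  rw [koszul_of_strictMono 𝒲 _ fun i j h => (Fintype.orderIsoFinOfCardEq J rfl).symm.lt_iff_lt.mpr h]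
  by_cases h : 0 < Fintype.card J
  · refine (dif_pos h).trans ?_
    exact congrArg (· ∘ₗ _) (harrClassNat_coe 𝒲 ⟨Fintype.card J, h⟩).symm
  · refine (dif_neg h).trans ?_
    have h0 : ∀ n : ℕ, ¬ 0 < n → harrClassNat 𝒲 n = 0
      | 0, _ => rfl
      | n + 1, h => absurd n.succ_pos h
    rw [h0 _ h, LinearMap.zero_comp]

-- Numbering `J` in its order turns linear extensions with values in `J` into those with values in
-- `Fin`.
open scoped Classical in
theorem sum_harrClassOf_koszul (G : Digraph I) :
    (∑ π : I ≃ J, if IsLinExt G π then harrClassOf 𝒲 ∘ₗ koszul 𝒲 π else 0) =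
      harrLEOf 𝒲 G (Nat.card J) := by
  rw [Nat.card_eq_fintype_card]
  unfold harrLEOf leSum
  rw [linearMap_comp_sum]
  let f := (Fintype.orderIsoFinOfCardEq J rfl).symm
  refine Fintype.sum_equiv ((Equiv.refl I).equivCongr f.toEquiv) _ _ fun π => ?_
  have h1 : (Equiv.refl I).equivCongr f.toEquiv π = π.trans f.toEquiv := by ext; simp
  have h2 : IsLinExt G (π.trans f.toEquiv) ↔ IsLinExt G π :=
    forall_congr' fun a => forall_congr' fun b => forall_congr' fun _ => f.lt_iff_lt
  rw [h1]
  simp only [h2, koszul_trans, harrClassOf_eq]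
  split_ifs
  · rfl
  · simp

theorem harrLEOf_of_card_ne (G : Digraph I) {n : ℕ} (h : Fintype.card I ≠ n) :
    harrLEOf 𝒲 G n = 0 := by
  unfold harrLEOf leSum
  have : IsEmpty (I ≃ Fin n) := ⟨fun e => h (by rw [Fintype.card_congr e, Fintype.card_fin])⟩
  simp

theorem harrLEOf_of_not_conn {G : Digraph I} (hG : ¬ Conn G) :
    harrLEOf 𝒲 G (Nat.card I) = 0 := by
  rw [Nat.card_eq_fintype_card]
  refine LinearMap.ext fun x => ?_
  exact harrClassNat_apply_eq_zero 𝒲 _ _ (leSum_mem_harrisonShuffles 𝒲 rfl hG x)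

theorem map_sum_sum_comp {k M N P Q R α β : Type*} [CommSemiring k] [AddCommMonoid M]
    [AddCommMonoid N] [AddCommMonoid P] [AddCommMonoid Q] [AddCommMonoid R] [Module k M]
    [Module k N] [Module k P] [Module k Q] [Module k R] [Fintype α] [Fintype β]
    (f : α → M →ₗ[k] P) (g : β → N →ₗ[k] Q) (u : R →ₗ[k] M ⊗[k] N) :
    TensorProduct.map (∑ a, f a) (∑ b, g b) ∘ₗ u =
      ∑ x : α × β, TensorProduct.map (f x.1) (g x.2) ∘ₗ u := by
  rw [← TensorProduct.mapBilinear_apply, Fintype.sum_prod_type, map_sum, Finset.sum_comm]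
  refine LinearMap.ext fun x => ?_
  simp only [map_sum, LinearMap.comp_apply, LinearMap.sum_apply, TensorProduct.mapBilinear_apply]

open scoped Classical in
/-- The part of the cobracket of the sum over linear extensions that separates the letters in `T`
from the others. -/
def cutTerm (G : Digraph I) (T : Set I) : (⨂[k] _ : I, W) →ₗ[k] Harr 𝒲 ⊗[k] Harr 𝒲 :=
  TensorProduct.map
      (harrLEOf 𝒲 (pullback (Subtype.val : {i // i ∈ T} → I) G) (Nat.card {i // i ∈ T}))
      (harrLEOf 𝒲 (pullback (Subtype.val : {i // ¬ i ∈ T} → I) G)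
        (Nat.card {i // ¬ i ∈ T})) ∘ₗ
    unshuffle 𝒲 T

/-- Used for a set and its double complement, which give different subtypes. -/
theorem conn_restrict_congr {I : Type} {P Q : I → Prop} (h : ∀ i, P i ↔ Q i) (G : Digraph I) :
    Conn (pullback (Subtype.val : {i // P i} → I) G) ↔
      Conn (pullback (Subtype.val : {i // Q i} → I) G) := by
  obtain rfl : P = Q := funext fun i => propext (h i)
  rfl

theorem isSGraph_restrict_congr {I : Type} {P Q : I → Prop} (h : ∀ i, P i ↔ Q i) (G : Digraph I) :
    IsSGraph (pullback (Subtype.val : {i // P i} → I) G) ↔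
      IsSGraph (pullback (Subtype.val : {i // Q i} → I) G) := by
  obtain rfl : P = Q := funext fun i => propext (h i)
  rfl

theorem cutTerm_of_not_conn {G : Digraph I} {T : Set I}
    (h : ¬ (Conn (pullback (Subtype.val : {i // i ∈ T} → I) G) ∧
      Conn (pullback (Subtype.val : {i // ¬ i ∈ T} → I) G))) :
    cutTerm 𝒲 G T = 0 := by
  classical
  rw [not_and_or] at h
  unfold cutTerm
  rcases h with h | h
  · rw [harrLEOf_of_not_conn 𝒲 h, TensorProduct.map_zero_left, LinearMap.zero_comp]
  · rw [harrLEOf_of_not_conn 𝒲 h, TensorProduct.map_zero_right, LinearMap.zero_comp]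

theorem cutTerm_compl_of_not_conn {G : Digraph I} {T : Set I}
    (h : ¬ (Conn (pullback (Subtype.val : {i // i ∈ T} → I) G) ∧
      Conn (pullback (Subtype.val : {i // ¬ i ∈ T} → I) G))) :
    cutTerm 𝒲 G Tᶜ = 0 := by
  refine cutTerm_of_not_conn 𝒲 fun h' => h ⟨?_, h'.1⟩
  exact (conn_restrict_congr (fun i => by simp) G).mp h'.2

-- A permutation that takes `T` to `S` is a pair of bijections, between the sets and between their
-- complements. By `hP`, being a linear extension is a condition on each member of the pair together
-- with a condition on `T`, so the sum factors.
open scoped Classical in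
theorem sum_harrSplit_koszul {n : ℕ} {G : Digraph (Fin n)} {S T : Set (Fin n)} {P : Prop}
    (hP : ∀ (π : Equiv.Perm (Fin n)) (h : ∀ i, i ∈ T ↔ π i ∈ S), IsLinExt G π ↔ P ∧
      IsLinExt (pullback (Subtype.val : {i // i ∈ T} → Fin n) G) (π.subtypeEquiv h) ∧
      IsLinExt (pullback (Subtype.val : {i // ¬ i ∈ T} → Fin n) G)
        (π.subtypeEquiv (q := fun j => ¬ j ∈ S) fun i => not_congr (h i))) :
    (∑ π : Equiv.Perm (Fin n), if IsLinExt G π ∧ ∀ i, i ∈ T ↔ π i ∈ S then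
      harrSplit 𝒲 S ∘ₗ koszul 𝒲 π else 0) =
    if P then TensorProduct.map
      (harrLEOf 𝒲 (pullback (Subtype.val : {i // i ∈ T} → Fin n) G)
        (Nat.card {i // i ∈ S}))
      (harrLEOf 𝒲 (pullback (Subtype.val : {i // ¬ i ∈ T} → Fin n) G)
        (Nat.card {i // ¬ i ∈ S})) ∘ₗ unshuffle 𝒲 T else 0 := by
  rw [← sum_harrClassOf_koszul, ← sum_harrClassOf_koszul, ← Finset.sum_filter, map_sum_sum_comp]
  have hR : ∀ x : ({i // i ∈ T} ≃ {i // i ∈ S}) × ({i // ¬ i ∈ T} ≃ {i // ¬ i ∈ S}),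
      TensorProduct.map
        (if IsLinExt (pullback (Subtype.val : {i // i ∈ T} → Fin n) G) x.1 then
          harrClassOf 𝒲 ∘ₗ koszul 𝒲 x.1 else 0)
        (if IsLinExt (pullback (Subtype.val : {i // ¬ i ∈ T} → Fin n) G) x.2 then
          harrClassOf 𝒲 ∘ₗ koszul 𝒲 x.2 else 0) ∘ₗ unshuffle 𝒲 T =
      if IsLinExt (pullback (Subtype.val : {i // i ∈ T} → Fin n) G) x.1 ∧
          IsLinExt (pullback (Subtype.val : {i // ¬ i ∈ T} → Fin n) G) x.2 then
        TensorProduct.map (harrClassOf 𝒲 ∘ₗ koszul 𝒲 x.1) (harrClassOf 𝒲 ∘ₗ koszul 𝒲 x.2) ∘ₗ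
          unshuffle 𝒲 T else 0 := by
    intro x
    by_cases h1 : IsLinExt (pullback (Subtype.val : {i // i ∈ T} → Fin n) G) x.1
    · by_cases h2 : IsLinExt (pullback (Subtype.val : {i // ¬ i ∈ T} → Fin n) G) x.2
      · rw [if_pos h1, if_pos h2, if_pos ⟨h1, h2⟩]
      · rw [if_neg h2, if_neg (fun h => h2 (And.right h)), TensorProduct.map_zero_right,
          LinearMap.zero_comp]
    · rw [if_neg h1, if_neg (fun h => h1 (And.left h)), TensorProduct.map_zero_left, LinearMap.zero_comp]
  rw [Finset.sum_congr rfl fun x _ => hR x, ← Finset.sum_filter]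
  by_cases hp : P
  · rw [if_pos hp]
    refine Finset.sum_bij'
      (fun π hπ => (π.subtypeEquiv (Finset.mem_filter.mp hπ).2.2,
        π.subtypeEquiv (q := fun j => ¬ j ∈ S) fun i =>
          not_congr ((Finset.mem_filter.mp hπ).2.2 i)))
      (fun x _ => Equiv.subtypeCongr x.1 x.2) ?_ ?_ ?_ ?_ ?_
    · intro π hπ
      have h1 := (Finset.mem_filter.mp hπ).2
      simp only [Finset.mem_filter, Finset.mem_univ, true_and]
      exact ((hP π h1.2).mp h1.1).2
    · rintro ⟨π₁, π₂⟩ hx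
      simp only [Finset.mem_filter, Finset.mem_univ, true_and] at hx ⊢
      have h1 : ∀ i, i ∈ T ↔ Equiv.subtypeCongr π₁ π₂ i ∈ S := by
        intro i
        by_cases hi : i ∈ T
        · simp [Equiv.subtypeCongr, hi]
        · simp only [Equiv.subtypeCongr, hi, Equiv.trans_apply, false_iff,
            Equiv.sumCompl_symm_apply_of_neg hi, Equiv.sumCongr_apply, Sum.map_inr,
            Equiv.sumCompl_apply_inr]
          exact (π₂ ⟨i, hi⟩).2
      refine ⟨(hP _ h1).mpr ⟨hp, ?_⟩, h1⟩
      have h2 : (Equiv.subtypeCongr π₁ π₂).subtypeEquiv h1 = π₁ := by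
        ext i
        simp [Equiv.subtypeCongr, i.2]
      have h3 : (Equiv.subtypeCongr π₁ π₂).subtypeEquiv (q := fun j => ¬ j ∈ S)
          (fun i => not_congr (h1 i)) = π₂ := by
        ext i
        simp [Equiv.subtypeCongr, i.2]
      rw [h2, h3]
      exact hx
    · intro π hπ
      ext i
      by_cases hi : i ∈ T <;> simp [Equiv.subtypeCongr, hi]
    · rintro ⟨π₁, π₂⟩ _
      refine Prod.ext ?_ ?_
      · ext i
        simp [Equiv.subtypeCongr, i.2]
      · ext i
        simp [Equiv.subtypeCongr, i.2]
    · intro π hπ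
      simp only
      rw [TensorProduct.map_comp, LinearMap.comp_assoc,
        ← unshuffle_koszul 𝒲 π (Finset.mem_filter.mp hπ).2.2, harrSplit, LinearMap.comp_assoc]
  · rw [if_neg hp]
    refine Finset.sum_eq_zero fun π hπ => ?_
    have h1 := (Finset.mem_filter.mp hπ).2
    exact absurd ((hP π h1.2).mp h1.1).1 hp

/-- No edge of `G` enters `T`. -/
def IsInitial {I : Type} (G : Digraph I) (T : Set I) : Prop := ∀ x y, G.Adj x y → y ∈ T → x ∈ T

/-- `T` is a nontrivial set of vertices that no edge of `G` enters. -/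
def IsCut {I : Type} (G : Digraph I) (T : Set I) : Prop :=
  T.Nonempty ∧ Tᶜ.Nonempty ∧ IsInitial G T

-- The linear extensions are sorted by the set `T` of vertices that they place in the positions `S`.
open scoped Classical in
theorem sum_harrSplit_leSum_aux {n : ℕ} {G : Digraph (Fin n)} (S : Set (Fin n))
    (P : Set (Fin n) → Prop)
    (hP : ∀ (T : Set (Fin n)) (π : Equiv.Perm (Fin n)) (h : ∀ i, i ∈ T ↔ π i ∈ S),
      IsLinExt G π ↔ P T ∧
      IsLinExt (pullback (Subtype.val : {i // i ∈ T} → Fin n) G) (π.subtypeEquiv h) ∧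
      IsLinExt (pullback (Subtype.val : {i // ¬ i ∈ T} → Fin n) G)
        (π.subtypeEquiv (q := fun j => ¬ j ∈ S) fun i => not_congr (h i))) :
    harrSplit 𝒲 S ∘ₗ leSum 𝒲 n G = ∑ T : Set (Fin n),
      if P T ∧ Nat.card {i // i ∈ T} = Nat.card {i // i ∈ S} then cutTerm 𝒲 G T else 0 := by
  have h1 : harrSplit 𝒲 S ∘ₗ leSum 𝒲 n G = ∑ T : Set (Fin n), ∑ π : Equiv.Perm (Fin n),
      if IsLinExt G π ∧ ∀ i, i ∈ T ↔ π i ∈ S then harrSplit 𝒲 S ∘ₗ koszul 𝒲 π else 0 := by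
    rw [Finset.sum_comm, leSum, linearMap_comp_sum]
    refine Finset.sum_congr rfl fun π _ => ?_
    rw [Finset.sum_eq_single (π ⁻¹' S)]
    · by_cases h : IsLinExt G π <;> simp [h]
    · intro T _ hT
      rw [if_neg]
      rintro ⟨_, h2⟩
      exact hT (Set.ext h2)
    · simp
  rw [h1]
  refine Finset.sum_congr rfl fun T _ => ?_
  rw [sum_harrSplit_koszul 𝒲 (hP T)]
  by_cases h2 : Nat.card {i // i ∈ T} = Nat.card {i // i ∈ S}
  · have h3 : Nat.card {i // ¬ i ∈ T} = Nat.card {i // ¬ i ∈ S} := by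
      have h4 := Nat.card_congr (Equiv.sumCompl fun i => i ∈ T)
      have h5 := Nat.card_congr (Equiv.sumCompl fun i => i ∈ S)
      rw [Nat.card_sum] at h4 h5
      omega
    simp only [h2, and_true, cutTerm, h3]
  · rw [harrLEOf_of_card_ne 𝒲 _ (by rwa [← Nat.card_eq_fintype_card]), TensorProduct.map_zero_left, LinearMap.zero_comp]
    rw [if_neg (c := P T ∧ _) fun h => h2 h.2]
    split_ifs <;> rfl

theorem card_subtype_lt {n p : ℕ} (hp : p ≤ n) :
    Nat.card {i // i ∈ {i : Fin n | (i : ℕ) < p}} = p := by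
  classical
  rw [Nat.card_eq_fintype_card, Fintype.card_subtype]
  exact Fin.card_filter_val_lt.trans (min_eq_right hp)

open scoped Classical in
/-- The cobracket of the sum over all linear extensions of a digraph. -/
theorem harrCobracket_leSum {n : ℕ} (G : Digraph (Fin n)) :
    harrCobracket 𝒲 n ∘ₗ leSum 𝒲 n G =
      ∑ T ∈ Finset.univ.filter (fun T : Set (Fin n) => IsCut G T),
        (cutTerm 𝒲 G T - cutTerm 𝒲 G Tᶜ) := by
  -- If `T` fills the first `p` positions, a linear extension consists of linear extensions of the
  -- two parts, provided that no edge enters `T`.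
  have h1 : ∀ p, harrSplit 𝒲 {i : Fin n | (i : ℕ) < p} ∘ₗ leSum 𝒲 n G = _ := fun p =>
    sum_harrSplit_leSum_aux 𝒲 {i : Fin n | (i : ℕ) < p}
      (fun T => IsInitial G T) (by
    intro T π h
    constructor
    · intro hπ
      refine ⟨fun x y hxy hy => ?_, fun x y hxy => hπ _ _ hxy, fun x y hxy => hπ _ _ hxy⟩
      have h1 := Fin.lt_def.mp (hπ x y hxy)
      have h2 := (h y).mp hy
      exact (h x).mpr (h1.trans h2)
    · rintro ⟨h1, h2, h3⟩ x y hxy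
      by_cases hx : x ∈ T <;> by_cases hy : y ∈ T
      · exact h2 ⟨x, hx⟩ ⟨y, hy⟩ hxy
      · have h4 := (h x).mp hx
        have h5 := mt (h y).mpr hy
        simp only [Set.mem_ofPred_eq] at h4 h5
        rw [Fin.lt_def]
        omega
      · exact absurd (h1 x y hxy hy) hx
      · exact h3 ⟨x, hx⟩ ⟨y, hy⟩ hxy)
  -- Here `T` fills the last positions, so the condition is that no edge enters its complement.
  have h2 : ∀ p, harrSplit 𝒲 {i : Fin n | (i : ℕ) < p}ᶜ ∘ₗ leSum 𝒲 n G = _ := fun p =>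
    sum_harrSplit_leSum_aux 𝒲 {i : Fin n | (i : ℕ) < p}ᶜ
      (fun T => IsInitial G Tᶜ) (by
    intro T π h
    constructor
    · intro hπ
      refine ⟨fun x y hxy hy hx => hy ?_, fun x y hxy => hπ _ _ hxy, fun x y hxy => hπ _ _ hxy⟩
      have h1 := Fin.lt_def.mp (hπ x y hxy)
      have h2 := (h x).mp hx
      refine (h y).mpr fun h3 => h2 ?_
      exact h1.trans h3
    · rintro ⟨h1, h2, h3⟩ x y hxy
      by_cases hx : x ∈ T <;> by_cases hy : y ∈ T
      · exact h2 ⟨x, hx⟩ ⟨y, hy⟩ hxy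
      · exact absurd hx (h1 x y hxy hy)
      · have h4 := mt (h x).mpr hx
        have h5 := (h y).mp hy
        simp only [Set.mem_compl_iff, Set.mem_ofPred_eq, not_not] at h4 h5
        rw [Fin.lt_def]
        omega
      · exact h3 ⟨x, hx⟩ ⟨y, hy⟩ hxy)
  unfold harrCobracket
  rw [linearMap_sum_comp]
  simp only [LinearMap.sub_comp, h1, h2]
  have hcompl : ∀ T : Set (Fin n), Nat.card {i // i ∈ Tᶜ} + Nat.card {i // i ∈ T} = n := by
    intro T
    have h4 := Nat.card_congr (Equiv.sumCompl fun i => i ∈ T)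
    rw [Nat.card_sum, Nat.card_fin, add_comm] at h4
    exact h4
  have hcut : ∀ T : Set (Fin n), IsCut G T ↔ IsInitial G T ∧
      Nat.card {i // i ∈ T} ∈ Finset.Ioo 0 n := by
    intro T
    have h3 : 0 < Nat.card {i // i ∈ T} ↔ T.Nonempty := by
      rw [Nat.card_pos_iff, Set.nonempty_coe_sort, and_iff_left (inferInstance : Finite _)]
    have h4 : 0 < Nat.card {i // i ∈ Tᶜ} ↔ Tᶜ.Nonempty := by
      rw [Nat.card_pos_iff, Set.nonempty_coe_sort, and_iff_left (inferInstance : Finite _)]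
    rw [IsCut, ← h3, ← h4, Finset.mem_Ioo]
    have := hcompl T
    constructor
    · rintro ⟨h5, h6, h7⟩
      exact ⟨h7, h5, by omega⟩
    · rintro ⟨h7, h5, h6⟩
      exact ⟨h5, by omega, h7⟩
  have hfin : ∀ (Q : Prop) (c : ℕ) (x : (⨂[k] _ : Fin n, W) →ₗ[k] Harr 𝒲 ⊗[k] Harr 𝒲),
      (∑ p ∈ Finset.Ioo 0 n, if Q ∧ c = p then x else 0) =
        if Q ∧ c ∈ Finset.Ioo 0 n then x else 0 := by
    intro Q c x
    by_cases hQ : Q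
    · simp only [hQ, true_and, Finset.sum_ite_eq]
    · simp [hQ]
  -- Passing to complements in the second sum lets both sums run over the same cuts; the sum over
  -- `p` then only removes the condition on their size.
  have h3 : ∀ p ∈ Finset.Ioo 0 n, ((∑ T : Set (Fin n),
      if IsInitial G T ∧ Nat.card {i // i ∈ T} =
        Nat.card {i // i ∈ {i : Fin n | (i : ℕ) < p}} then cutTerm 𝒲 G T else 0) -
      ∑ T : Set (Fin n), if IsInitial G Tᶜ ∧ Nat.card {i // i ∈ T} =
        Nat.card {i // i ∈ {i : Fin n | (i : ℕ) < p}ᶜ} then cutTerm 𝒲 G T else 0) =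
      ∑ T : Set (Fin n), if IsInitial G T ∧ Nat.card {i // i ∈ T} = p
        then (cutTerm 𝒲 G T - cutTerm 𝒲 G Tᶜ) else 0 := by
    intro p hp
    rw [Finset.mem_Ioo] at hp
    have h5 := card_subtype_lt hp.2.le
    have h6 := hcompl {i : Fin n | (i : ℕ) < p}
    rw [h5] at h6
    rw [h5, ← Equiv.sum_comp (Equiv.ofBijective (compl : Set (Fin n) → Set (Fin n))
      compl_bijective) (fun T : Set (Fin n) =>
        if IsInitial G Tᶜ ∧ Nat.card {i // i ∈ T} = _ then
          cutTerm 𝒲 G T else 0), ← Finset.sum_sub_distrib]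
    refine Finset.sum_congr rfl fun T _ => ?_
    have h7 := hcompl T
    simp only [Equiv.ofBijective_apply, compl_compl]
    have h8 : (Nat.card {i // i ∈ Tᶜ} =
        Nat.card {i // i ∈ {i : Fin n | (i : ℕ) < p}ᶜ}) ↔
        Nat.card {i // i ∈ T} = p := by omega
    simp only [h8]
    split_ifs <;> simp
  rw [Finset.sum_congr rfl h3, Finset.sum_comm, Finset.sum_filter]
  refine Finset.sum_congr rfl fun T _ => ?_
  rw [hfin]
  simp only [hcut]

/-- A cut with a disconnected part has a factor in the span of shuffles and contributes nothing. The
remaining cuts of a tree are given by its edges, as in the graph cobracket. -/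
theorem harrCobracket_leSum_of_isSGraph {n : ℕ} {G : Digraph (Fin n)} (hG : IsSGraph G) :
    harrCobracket 𝒲 n ∘ₗ leSum 𝒲 n G =
      ∑ e ∈ edges G, (cutTerm 𝒲 G (cutSide G e.1 e.2) - cutTerm 𝒲 G (cutSide G e.1 e.2)ᶜ) := by
  classical
  rw [harrCobracket_leSum]
  symm
  refine Finset.sum_of_injOn (fun e => cutSide G e.1 e.2) ?_ ?_ ?_ ?_
  · rintro ⟨a, b⟩ h ⟨c, d⟩ _ hcd
    simp only [Finset.mem_coe, mem_edges] at h
    obtain ⟨h1, h2⟩ := hG.cutSide_injective h hcd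
    exact Prod.ext h1 h2
  · rintro ⟨a, b⟩ h
    simp only [Finset.mem_coe, mem_edges, Finset.mem_filter, Finset.mem_univ, true_and] at h ⊢
    refine ⟨⟨a, mem_cutSide G a b⟩, ⟨b, hG.notMem_cutSide h⟩, fun x y hxy hy => ?_⟩
    by_contra hx
    obtain ⟨rfl, rfl⟩ := eq_of_cross (separating_cutSide G a b) hxy fun h => hx (h.mpr hy)
    exact hx (mem_cutSide G x y)
  · intro T hT hT'
    simp only [Finset.mem_filter, Finset.mem_univ, true_and] at hT
    obtain ⟨⟨a, ha⟩, ⟨b, hb⟩, hl⟩ := hT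
    have h1 : ¬ (Conn (pullback (Subtype.val : {i // i ∈ T} → Fin n) G) ∧
        Conn (pullback (Subtype.val : {i // ¬ i ∈ T} → Fin n) G)) := by
      rintro ⟨h2, h3⟩
      obtain ⟨x, y, hxy, rfl⟩ := hG.eq_cutSide ha hb hl h2 h3
      exact hT' ⟨(x, y), by simpa using hxy, rfl⟩
    rw [cutTerm_of_not_conn 𝒲 h1, cutTerm_compl_of_not_conn 𝒲 h1, sub_zero]
  · exact fun _ _ => rfl

theorem Conn.subset_or_subset_compl {I : Type} {G : Digraph I} {S T : Set I} (hS : Separating G S)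
    (hT : Conn (pullback (Subtype.val : {i // i ∈ T} → I) G)) : T ⊆ S ∨ T ⊆ Sᶜ := by
  by_cases h : ∃ x ∈ T, x ∈ S
  · left
    obtain ⟨x, hx, hxS⟩ := h
    have h1 := hT {v | (v : I) ∈ S} (fun a b hab => hS _ _ hab) ⟨⟨x, hx⟩, hxS⟩
    intro y hy
    have h2 : (⟨y, hy⟩ : {i // i ∈ T}) ∈ {v : {i // i ∈ T} | (v : I) ∈ S} := by rw [h1]; trivial
    exact h2
  · right
    exact fun x hx hxS => h ⟨x, hx, hxS⟩

/-- If `S` is a separating set, a cut into two connected parts can only be `S` or its complement.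
Both are cuts, and their contributions are opposite. -/
theorem harrCobracket_leSum_of_not_conn {n : ℕ} {G : Digraph (Fin n)} (hG : ¬ Conn G) :
    harrCobracket 𝒲 n ∘ₗ leSum 𝒲 n G = 0 := by
  classical
  simp only [Conn, not_forall] at hG
  obtain ⟨S, hS, hne, hS'⟩ := hG
  have hne' : Sᶜ.Nonempty := Set.nonempty_compl.mpr hS'
  have hSS : S ≠ Sᶜ := by
    obtain ⟨x, hx⟩ := hne
    intro h
    have : x ∈ Sᶜ := h ▸ hx
    exact this hx
  rw [harrCobracket_leSum]
  rw [← Finset.sum_subset (s₁ := {S, Sᶜ})]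
  · rw [Finset.sum_pair hSS, compl_compl, sub_add_sub_cancel, sub_self]
  · intro T hT
    simp only [Finset.mem_insert, Finset.mem_singleton] at hT
    simp only [Finset.mem_filter, Finset.mem_univ, true_and]
    rcases hT with rfl | rfl
    · exact ⟨hne, hne', fun x y hxy hy => (hS x y hxy).mpr hy⟩
    · exact ⟨hne', by rwa [compl_compl], fun x y hxy hy => (hS.compl x y hxy).mpr hy⟩
  · intro T hT hT'
    simp only [Finset.mem_filter, Finset.mem_univ, true_and] at hT
    simp only [Finset.mem_insert, Finset.mem_singleton, not_or] at hT'
    have h1 : ¬ (Conn (pullback (Subtype.val : {i // i ∈ T} → Fin n) G) ∧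
        Conn (pullback (Subtype.val : {i // ¬ i ∈ T} → Fin n) G)) := by
      rintro ⟨h2, h3⟩
      have h4 := h2.subset_or_subset_compl hS
      have h5 : Tᶜ ⊆ S ∨ Tᶜ ⊆ Sᶜ := Conn.subset_or_subset_compl (T := Tᶜ) hS h3
      rcases h4 with h4 | h4 <;> rcases h5 with h5 | h5
      · obtain ⟨x, hx⟩ := hne'
        by_cases hxT : x ∈ T
        · exact hx (h4 hxT)
        · exact hx (h5 hxT)
      · exact hT'.1 (Set.Subset.antisymm h4 (Set.compl_subset_compl.mp h5))
      · refine hT'.2 (Set.Subset.antisymm h4 ?_)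
        rw [← Set.compl_subset_compl, compl_compl]
        exact h5
      · obtain ⟨x, hx⟩ := hne
        by_cases hxT : x ∈ T
        · exact h4 hxT hx
        · exact h5 hxT hx
    rw [cutTerm_of_not_conn 𝒲 h1, cutTerm_compl_of_not_conn 𝒲 h1, sub_zero]

end Cut

/-! ### Differential graded Lie coalgebras from differential graded coalgebras -/

section Coalgebra

variable {k : Type u} [Field k] {W : Type v} [AddCommGroup W] [Module k W]
  (𝒲 : ℤ → Submodule k W) [DirectSum.Decomposition 𝒲]

theorem tmul_ext_homogeneous {N : Type*} [AddCommGroup N] [Module k N] {f g : W ⊗[k] W →ₗ[k] N}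
    (h : ∀ i, ∀ x ∈ 𝒲 i, ∀ j, ∀ y ∈ 𝒲 j, f (x ⊗ₜ y) = g (x ⊗ₜ y)) : f = g :=
  TensorProduct.ext (linearMap_ext_homogeneous 𝒲 fun i x hx =>
    linearMap_ext_homogeneous 𝒲 fun j y hy => h i x hx j y hy)

theorem tmul_ext_homogeneous₃ {N : Type*} [AddCommGroup N] [Module k N]
    {f g : W ⊗[k] (W ⊗[k] W) →ₗ[k] N}
    (h : ∀ i, ∀ x ∈ 𝒲 i, ∀ j, ∀ y ∈ 𝒲 j, ∀ l, ∀ z ∈ 𝒲 l,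
      f (x ⊗ₜ (y ⊗ₜ z)) = g (x ⊗ₜ (y ⊗ₜ z))) : f = g :=
  TensorProduct.ext (linearMap_ext_homogeneous 𝒲 fun i x hx =>
    tmul_ext_homogeneous 𝒲 fun j y hy l z hz => h i x hx j y hy l z hz)

theorem gradedSwap_tmul {i j : ℤ} {x y : W} (hx : x ∈ 𝒲 i) (hy : y ∈ 𝒲 j) :
    gradedSwap 𝒲 (x ⊗ₜ y) = ksign k i j • (y ⊗ₜ[k] x) := by
  unfold gradedSwap
  rw [LinearMap.sum_apply, Finset.sum_eq_single (i : ZMod 2)]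
  · rw [LinearMap.sum_apply, Finset.sum_eq_single (j : ZMod 2)]
    · rw [LinearMap.smul_apply, LinearMap.comp_apply, TensorProduct.map_tmul,
        parityProj_of_mem 𝒲 hx, parityProj_of_mem 𝒲 hy, if_pos rfl, if_pos rfl]
      rfl
    · intro δ _ hδ
      rw [LinearMap.smul_apply, LinearMap.comp_apply, TensorProduct.map_tmul,
        parityProj_of_mem 𝒲 hy, if_neg hδ.symm, TensorProduct.tmul_zero, map_zero, smul_zero]
    · simp
  · intro ε _ hε
    rw [LinearMap.sum_apply]
    refine Finset.sum_eq_zero fun δ _ => ?_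
    rw [LinearMap.smul_apply, LinearMap.comp_apply, TensorProduct.map_tmul,
      parityProj_of_mem 𝒲 hx, if_neg hε.symm, TensorProduct.zero_tmul, map_zero, smul_zero]
  · simp

theorem gradedSwap_gradedSwap : gradedSwap 𝒲 ∘ₗ gradedSwap 𝒲 = LinearMap.id := by
  refine tmul_ext_homogeneous 𝒲 fun i x hx j y hy => ?_
  rw [LinearMap.comp_apply, gradedSwap_tmul 𝒲 hx hy, map_smul, gradedSwap_tmul 𝒲 hy hx, smul_smul,
    ksign_comm k j, ksign_mul_self, one_smul, LinearMap.id_apply]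

theorem gradedCycle_tmul {i j l : ℤ} {x y z : W} (hx : x ∈ 𝒲 i) (hy : y ∈ 𝒲 j) (hz : z ∈ 𝒲 l) :
    gradedCycle 𝒲 (x ⊗ₜ (y ⊗ₜ z)) = (ksign k i j * ksign k i l) • (y ⊗ₜ[k] (z ⊗ₜ[k] x)) := by
  simp only [gradedCycle, LinearMap.comp_apply, LinearEquiv.coe_coe, TensorProduct.assoc_symm_tmul,
    TensorProduct.map_tmul, gradedSwap_tmul 𝒲 hx hy, LinearMap.id_apply, ← TensorProduct.smul_tmul',
    map_smul, TensorProduct.assoc_tmul, gradedSwap_tmul 𝒲 hx hz, TensorProduct.tmul_smul,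
    smul_smul]

theorem gradedCycle_cube :
    gradedCycle 𝒲 ∘ₗ gradedCycle 𝒲 ∘ₗ gradedCycle 𝒲 = LinearMap.id := by
  refine tmul_ext_homogeneous₃ 𝒲 fun i x hx j y hy l z hz => ?_
  simp only [LinearMap.comp_apply, gradedCycle_tmul 𝒲 hx hy hz, gradedCycle_tmul 𝒲 hy hz hx,
    gradedCycle_tmul 𝒲 hz hx hy, map_smul, smul_smul, LinearMap.id_apply]
  rw [ksign_comm k l i, ksign_comm k l j, ksign_comm k j i]
  have : ∀ a b c : k, a * a = 1 → b * b = 1 → c * c = 1 → a * b * (c * a) * (b * c) = 1 := by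
    intro a b c ha hb hc
    linear_combination b * b * c * c * ha + c * c * hb + hc
  rw [this _ _ _ (ksign_mul_self k _ _) (ksign_mul_self k _ _) (ksign_mul_self k _ _), one_smul]

/-- A relation between a transposition and a three-cycle in the symmetric group on three letters;
the Koszul signs respect it. -/
theorem map_gradedSwap_gradedCycle :
    TensorProduct.map LinearMap.id (gradedSwap 𝒲) ∘ₗ gradedCycle 𝒲 ∘ₗ gradedCycle 𝒲 =
      gradedCycle 𝒲 ∘ₗ TensorProduct.map LinearMap.id (gradedSwap 𝒲) := by
  refine tmul_ext_homogeneous₃ 𝒲 fun i x hx j y hy l z hz => ?_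
  simp only [LinearMap.comp_apply, gradedCycle_tmul 𝒲 hx hy hz, gradedCycle_tmul 𝒲 hy hz hx,
    map_smul, TensorProduct.map_tmul, gradedSwap_tmul 𝒲 hx hy, gradedSwap_tmul 𝒲 hy hz,
    LinearMap.id_apply, TensorProduct.tmul_smul, smul_smul, gradedCycle_tmul 𝒲 hx hz hy]
  rw [ksign_comm k j i]
  congr 1
  linear_combination (ksign k i l * ksign k j l * ksign k i j) * ksign_mul_self k (i : ZMod 2) j

/-- The degree `i` part of the tensor square of a graded vector space. -/
def tensorDegree {M : Type*} [AddCommGroup M] [Module k M] (gr : ℤ → Submodule k M) (i : ℤ) :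
    Submodule k (M ⊗[k] M) :=
  ⨆ p : ℤ, LinearMap.range (TensorProduct.map (gr p).subtype (gr (i - p)).subtype)

theorem tmul_mem_tensorDegree {gr : ℤ → Submodule k W} {i p q : ℤ} {x y : W} (hx : x ∈ gr p)
    (hy : y ∈ gr q) (h : p + q = i) : x ⊗ₜ[k] y ∈ tensorDegree gr i := by
  obtain rfl : q = i - p := by omega
  exact Submodule.mem_iSup_of_mem p ⟨⟨x, hx⟩ ⊗ₜ ⟨y, hy⟩, by simp⟩

theorem tensorDegree_le {gr : ℤ → Submodule k W} {i : ℤ} {S : Submodule k (W ⊗[k] W)}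
    (h : ∀ p q, p + q = i → ∀ x ∈ gr p, ∀ y ∈ gr q, x ⊗ₜ[k] y ∈ S) : tensorDegree gr i ≤ S := by
  refine iSup_le fun p => ?_
  rintro _ ⟨t, rfl⟩
  induction t using TensorProduct.induction_on with
  | zero => simp
  | tmul x y =>
    rw [TensorProduct.map_tmul]
    exact h p (i - p) (by omega) _ x.2 _ y.2
  | add a b ha hb =>
    rw [map_add]
    exact S.add_mem ha hb

theorem gradedSwap_mem {i : ℤ} {t : W ⊗[k] W} (ht : t ∈ tensorDegree 𝒲 i) :
    gradedSwap 𝒲 t ∈ tensorDegree 𝒲 i := by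
  have h : tensorDegree 𝒲 i ≤ (tensorDegree 𝒲 i).comap (gradedSwap 𝒲) := by
    refine tensorDegree_le fun p q hpq x hx y hy => ?_
    rw [Submodule.mem_comap, gradedSwap_tmul 𝒲 hx hy]
    exact Submodule.smul_mem _ _ (tmul_mem_tensorDegree hy hx (by omega))
  exact h ht

/-- Because `Δ` has degree zero, moving the first factor to the back and then splitting it gives the
same sign as splitting it first and moving both pieces. -/
theorem map_comp_gradedSwap {Δ : W →ₗ[k] W ⊗[k] W}
    (hΔ : ∀ i, ∀ x ∈ 𝒲 i, Δ x ∈ tensorDegree 𝒲 i) :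
    TensorProduct.map LinearMap.id Δ ∘ₗ gradedSwap 𝒲 =
      gradedCycle 𝒲 ∘ₗ gradedCycle 𝒲 ∘ₗ (TensorProduct.assoc k W W W).toLinearMap ∘ₗ
        TensorProduct.map Δ LinearMap.id := by
  refine tmul_ext_homogeneous 𝒲 fun i x hx j y hy => ?_
  rw [LinearMap.comp_apply, gradedSwap_tmul 𝒲 hx hy, map_smul, TensorProduct.map_tmul,
    LinearMap.id_apply]
  simp only [LinearMap.comp_apply, TensorProduct.map_tmul, LinearMap.id_apply, LinearEquiv.coe_coe]
  let f : W ⊗[k] W →ₗ[k] W ⊗[k] (W ⊗[k] W) := ksign k i j • TensorProduct.mk k W (W ⊗[k] W) y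
  let g : W ⊗[k] W →ₗ[k] W ⊗[k] (W ⊗[k] W) :=
    gradedCycle 𝒲 ∘ₗ gradedCycle 𝒲 ∘ₗ (TensorProduct.assoc k W W W).toLinearMap ∘ₗ
      (TensorProduct.mk k (W ⊗[k] W) W).flip y
  have h : tensorDegree 𝒲 i ≤ LinearMap.eqLocus f g := by
    refine tensorDegree_le fun p q hpq a ha b hb => ?_
    subst hpq
    simp only [LinearMap.mem_eqLocus, f, g, LinearMap.smul_apply, TensorProduct.mk_apply,
      LinearMap.comp_apply, LinearMap.flip_apply, LinearEquiv.coe_coe, TensorProduct.assoc_tmul,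
      gradedCycle_tmul 𝒲 ha hb hy, gradedCycle_tmul 𝒲 hb hy ha, map_smul, smul_smul]
    congr 1
    rw [Int.cast_add, ksign_add_left, ksign_comm k q p]
    linear_combination -(ksign k p j * ksign k q j) * ksign_mul_self k (p : ZMod 2) q
  exact h (hΔ i x hx)

/-- The anti-cocommutative coproduct of a graded coassociative coalgebra with a coderivation of
square zero and degree one gives a differential graded Lie coalgebra. -/
def DGLieCoalgebra.ofCoassoc (Δ : W →ₗ[k] W ⊗[k] W) (d : W →ₗ[k] W)
    (hΔ : ∀ i, ∀ x ∈ 𝒲 i, Δ x ∈ tensorDegree 𝒲 i)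
    (hcoassoc : (TensorProduct.assoc k W W W).toLinearMap ∘ₗ TensorProduct.map Δ LinearMap.id ∘ₗ Δ =
      TensorProduct.map LinearMap.id Δ ∘ₗ Δ)
    (hd : ∀ i, ∀ x ∈ 𝒲 i, d x ∈ 𝒲 (i + 1)) (hdd : d ∘ₗ d = 0)
    (hcod : Δ ∘ₗ d =
      (TensorProduct.map d LinearMap.id + TensorProduct.map (degInvol 𝒲) d) ∘ₗ Δ) :
    DGLieCoalgebra k W where
  gr := 𝒲
  decomp := inferInstance
  d := d
  cobracket := Δ - gradedSwap 𝒲 ∘ₗ Δ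
  d_mem := hd
  d_comp_d := hdd
  cobracket_mem i x hx := Submodule.sub_mem _ (hΔ i x hx) (gradedSwap_mem 𝒲 (hΔ i x hx))
  anticomm := by
    rw [LinearMap.comp_sub, ← LinearMap.comp_assoc, gradedSwap_gradedSwap, LinearMap.id_comp,
      neg_sub]
  coJacobi := by
    set c := gradedCycle 𝒲
    set t := TensorProduct.map (LinearMap.id : W →ₗ[k] W) (gradedSwap 𝒲)
    set A := TensorProduct.map LinearMap.id Δ ∘ₗ Δ
    have h1 : TensorProduct.map (LinearMap.id : W →ₗ[k] W) (Δ - gradedSwap 𝒲 ∘ₗ Δ) =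
        TensorProduct.map LinearMap.id Δ - t ∘ₗ TensorProduct.map LinearMap.id Δ := by
      refine TensorProduct.ext' fun x y => ?_
      simp [t, TensorProduct.tmul_sub]
    have h2 : TensorProduct.map LinearMap.id Δ ∘ₗ gradedSwap 𝒲 ∘ₗ Δ = c ∘ₗ c ∘ₗ A := by
      rw [← LinearMap.comp_assoc, map_comp_gradedSwap 𝒲 hΔ, ← hcoassoc]
      rfl
    -- By coassociativity, all four terms of the iterated cobracket are permutations of the iterated
    -- coproduct `A`.
    have h3 : TensorProduct.map (LinearMap.id : W →ₗ[k] W) (Δ - gradedSwap 𝒲 ∘ₗ Δ) ∘ₗ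
        (Δ - gradedSwap 𝒲 ∘ₗ Δ) = A - c ∘ₗ c ∘ₗ A - (t ∘ₗ A - c ∘ₗ t ∘ₗ A) := by
      have h4 : t ∘ₗ c ∘ₗ c ∘ₗ A = c ∘ₗ t ∘ₗ A := by
        have := congrArg (· ∘ₗ A) (map_gradedSwap_gradedCycle 𝒲)
        simpa only [LinearMap.comp_assoc] using this
      rw [h1, LinearMap.sub_comp, LinearMap.comp_sub, h2, LinearMap.comp_assoc, LinearMap.comp_sub,
        h2, LinearMap.comp_sub, h4]
    rw [h3]
    -- As `c` has order three, the cyclic sum of `A` equals that of `c (c A)`, and that of `t A`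
    -- equals that of `c (t A)`.
    have h5 : ∀ x, c (c (c x)) = x := fun x => LinearMap.congr_fun (gradedCycle_cube 𝒲) x
    refine LinearMap.ext fun x => ?_
    simp only [LinearMap.add_apply, LinearMap.comp_apply, LinearMap.sub_apply, LinearMap.id_apply,
      map_sub, h5, LinearMap.zero_apply]
    abel
  coLeibniz := by
    -- The twist commutes with the differential of the tensor square, so the coderivation rule
    -- passes from `Δ` to `τΔ`.
    have h : gradedSwap 𝒲 ∘ₗ
        (TensorProduct.map d LinearMap.id + TensorProduct.map (degInvol 𝒲) d) =
        (TensorProduct.map d LinearMap.id + TensorProduct.map (degInvol 𝒲) d) ∘ₗ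
          gradedSwap 𝒲 := by
      refine tmul_ext_homogeneous 𝒲 fun i x hx j y hy => ?_
      simp only [LinearMap.comp_apply, LinearMap.add_apply, TensorProduct.map_tmul,
        LinearMap.id_apply, degInvol_of_mem 𝒲 hx, map_add, ← TensorProduct.smul_tmul', map_smul,
        gradedSwap_tmul 𝒲 (hd i x hx) hy, gradedSwap_tmul 𝒲 hx (hd j y hy),
        gradedSwap_tmul 𝒲 hx hy, degInvol_of_mem 𝒲 hy, smul_add, smul_smul]
      rw [add_comm]
      congr 2
      · rw [Int.cast_add, Int.cast_one, ksign_add_right, ksign_comm k i 1]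
        linear_combination ksign k i j * ksign_mul_self k (1 : ZMod 2) i
      · rw [Int.cast_add, Int.cast_one, ksign_add_left, mul_comm]
    rw [LinearMap.sub_comp, LinearMap.comp_assoc, hcod, LinearMap.comp_sub, ← LinearMap.comp_assoc,
      h, LinearMap.comp_assoc]

theorem gradedSwap_comp_map {M N : Type*} [AddCommGroup M] [Module k M] [AddCommGroup N]
    [Module k N] (gr : ℤ → Submodule k M) (gr' : ℤ → Submodule k N) [DirectSum.Decomposition gr]
    [DirectSum.Decomposition gr'] (q : M →ₗ[k] N) (hq : ∀ i, ∀ x ∈ gr i, q x ∈ gr' i) :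
    gradedSwap gr' ∘ₗ TensorProduct.map q q = TensorProduct.map q q ∘ₗ gradedSwap gr :=
  tmul_ext_homogeneous gr fun i x hx j y hy => by
    rw [LinearMap.comp_apply, TensorProduct.map_tmul, gradedSwap_tmul gr' (hq _ _ hx) (hq _ _ hy),
      LinearMap.comp_apply, gradedSwap_tmul gr hx hy, map_smul, TensorProduct.map_tmul]

/-- Transport of a differential graded Lie coalgebra structure along a surjection. -/
def DGLieCoalgebra.map {M N : Type*} [AddCommGroup M] [Module k M] [AddCommGroup N] [Module k N]
    (L : DGLieCoalgebra k M) (q : M →ₗ[k] N) (hq : Function.Surjective q)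
    (gr : ℤ → Submodule k N) (decomp : DirectSum.Decomposition gr)
    (hgr : ∀ i, (L.gr i).map q = gr i) (d : N →ₗ[k] N) (hd : d ∘ₗ q = q ∘ₗ L.d)
    (cobracket : N →ₗ[k] N ⊗[k] N)
    (hc : cobracket ∘ₗ q = TensorProduct.map q q ∘ₗ L.cobracket) : DGLieCoalgebra k N :=
  letI := L.decomp
  have hmem : ∀ {i x}, x ∈ L.gr i → q x ∈ gr i := fun {i x} hx =>
    hgr i ▸ Submodule.mem_map_of_mem hx
  have hdeg : degInvol gr ∘ₗ q = q ∘ₗ degInvol L.gr :=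
    linearMap_ext_homogeneous L.gr fun i x hx => by
      rw [LinearMap.comp_apply, degInvol_of_mem gr (hmem hx), LinearMap.comp_apply,
        degInvol_of_mem L.gr hx, map_smul]
  have hswap := gradedSwap_comp_map L.gr gr q fun _ _ hx => hmem hx
  have hcyc : gradedCycle gr ∘ₗ TensorProduct.map q (TensorProduct.map q q) =
      TensorProduct.map q (TensorProduct.map q q) ∘ₗ gradedCycle L.gr :=
    tmul_ext_homogeneous₃ L.gr fun i x hx j y hy l z hz => by
      rw [LinearMap.comp_apply, TensorProduct.map_tmul, TensorProduct.map_tmul,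
        gradedCycle_tmul gr (hmem hx) (hmem hy) (hmem hz), LinearMap.comp_apply,
        gradedCycle_tmul L.gr hx hy hz, map_smul, TensorProduct.map_tmul, TensorProduct.map_tmul]
  { gr := gr
    decomp := decomp
    d := d
    cobracket := cobracket
    d_mem := by
      intro i x hx
      rw [← hgr] at hx
      obtain ⟨y, hy, rfl⟩ := hx
      have h : d (q y) = q (L.d y) := LinearMap.congr_fun hd y
      rw [h]
      exact hmem (L.d_mem i y hy)
    d_comp_d := by
      rw [← LinearMap.cancel_right hq, LinearMap.comp_assoc, hd, ← LinearMap.comp_assoc, hd,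
        LinearMap.comp_assoc, L.d_comp_d, LinearMap.comp_zero, LinearMap.zero_comp]
    cobracket_mem := by
      intro i x hx
      rw [← hgr] at hx
      obtain ⟨y, hy, rfl⟩ := hx
      have h : cobracket (q y) = TensorProduct.map q q (L.cobracket y) := LinearMap.congr_fun hc y
      have h1 : tensorDegree L.gr i ≤ (tensorDegree gr i).comap (TensorProduct.map q q) := by
        refine tensorDegree_le fun a b hab u hu v hv => ?_
        exact tmul_mem_tensorDegree (hmem hu) (hmem hv) hab
      rw [h]
      exact h1 (L.cobracket_mem i y hy)
    anticomm := by
      rw [← LinearMap.cancel_right hq, LinearMap.comp_assoc, hc, ← LinearMap.comp_assoc, hswap,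
        LinearMap.comp_assoc, L.anticomm, LinearMap.neg_comp, hc, LinearMap.comp_neg]
    coJacobi := by
      have h1 : TensorProduct.map LinearMap.id cobracket ∘ₗ TensorProduct.map q q =
          TensorProduct.map q (TensorProduct.map q q) ∘ₗ
            TensorProduct.map LinearMap.id L.cobracket := by
        rw [← TensorProduct.map_comp, ← TensorProduct.map_comp, hc, LinearMap.id_comp,
          LinearMap.comp_id]
      have h2 : (LinearMap.id + gradedCycle gr + gradedCycle gr ∘ₗ gradedCycle gr) ∘ₗ
          TensorProduct.map q (TensorProduct.map q q) =
          TensorProduct.map q (TensorProduct.map q q) ∘ₗ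
            (LinearMap.id + gradedCycle L.gr + gradedCycle L.gr ∘ₗ gradedCycle L.gr) := by
        simp only [LinearMap.add_comp, LinearMap.comp_add, LinearMap.id_comp, LinearMap.comp_id,
          LinearMap.comp_assoc, hcyc]
        rw [← LinearMap.comp_assoc, hcyc, LinearMap.comp_assoc]
      rw [← LinearMap.cancel_right hq, LinearMap.comp_assoc, LinearMap.comp_assoc, hc,
        ← LinearMap.comp_assoc L.cobracket, h1, LinearMap.comp_assoc, ← LinearMap.comp_assoc, h2,
        LinearMap.comp_assoc, L.coJacobi, LinearMap.comp_zero, LinearMap.zero_comp]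
    coLeibniz := by
      rw [← LinearMap.cancel_right hq, LinearMap.comp_assoc, hd, ← LinearMap.comp_assoc, hc,
        LinearMap.comp_assoc, L.coLeibniz, LinearMap.comp_assoc, hc]
      simp only [LinearMap.add_comp, LinearMap.comp_add, ← LinearMap.comp_assoc,
        ← TensorProduct.map_comp, hd, hdeg, LinearMap.id_comp, LinearMap.comp_id] }

end Coalgebra

/-! ### The bar construction on the tensor coalgebra -/

section TensorCoalgebra

variable {k : Type u} [Field k] {W : Type v} [AddCommGroup W] [Module k W]
  {M : Type*} [AddCommGroup M] [Module k M]

variable (k W) in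
/-- Prepending a letter to a tensor. -/
def consL : W →ₗ[k] TensorAlgebra k W →ₗ[k] TensorAlgebra k W :=
  LinearMap.mul k (TensorAlgebra k W) ∘ₗ TensorAlgebra.ι k

theorem consL_apply (x : W) (v : TensorAlgebra k W) : consL k W x v = TensorAlgebra.ι k x * v := rfl

theorem eq_top_of_consL_mem {S : Submodule k (TensorAlgebra k W)} (h1 : 1 ∈ S) (X : Set W)
    (hX : Submodule.span k X = ⊤) (h : ∀ x ∈ X, ∀ v ∈ S, consL k W x v ∈ S) : S = ⊤ := by
  have h' : ∀ x, ∀ v ∈ S, consL k W x v ∈ S := by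
    intro x v hv
    have hx : x ∈ Submodule.span k X := hX ▸ Submodule.mem_top
    have h2 : Submodule.span k X ≤ S.comap ((consL k W).flip v) :=
      Submodule.span_le.mpr fun y hy => h y hy v hv
    exact h2 hx
  have h2 : ∀ a : TensorAlgebra k W, ∀ v ∈ S, a * v ∈ S := by
    intro a
    induction a using TensorAlgebra.induction with
    | algebraMap r =>
      intro v hv
      rw [← Algebra.smul_def]
      exact S.smul_mem r hv
    | ι x => exact h' x
    | mul a b ha hb =>
      intro v hv
      rw [mul_assoc]
      exact ha _ (hb _ hv)
    | add a b ha hb =>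
      intro v hv
      rw [add_mul]
      exact S.add_mem (ha _ hv) (hb _ hv)
  rw [eq_top_iff]
  rintro a -
  simpa using h2 a 1 h1

theorem tensorAlgebra_ext {f g : TensorAlgebra k W →ₗ[k] M} (h1 : f 1 = g 1)
    (h : ∀ x v, f v = g v → f (consL k W x v) = g (consL k W x v)) : f = g := by
  have : LinearMap.eqLocus f g = ⊤ := eq_top_of_consL_mem h1 Set.univ Submodule.span_univ
    fun x _ v hv => h x v hv
  exact LinearMap.eqLocus_eq_top.mp this

/-- Definition of a linear map on the tensor algebra by recursion on the first letter. -/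
def tensorRec (m₀ : M) (φ : W →ₗ[k] TensorAlgebra k W × M →ₗ[k] M) : TensorAlgebra k W →ₗ[k] M :=
  -- The first component of the pair rebuilds the word, so that `φ` receives the tail along with the
  -- value on it.
  LinearMap.snd k (TensorAlgebra k W) M ∘ₗ LinearMap.applyₗ ((1 : TensorAlgebra k W), m₀) ∘ₗ
    (TensorAlgebra.lift k (A := Module.End k (TensorAlgebra k W × M))
      ((LinearMap.prodEquiv k).toLinearMap ∘ₗ
        LinearMap.prod (LinearMap.lcomp k _ (LinearMap.fst k _ _) ∘ₗ consL k W) φ)).toLinearMap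

theorem tensorRec_one (m₀ : M) (φ : W →ₗ[k] TensorAlgebra k W × M →ₗ[k] M) :
    tensorRec m₀ φ 1 = m₀ := by
  simp [tensorRec]

theorem tensorRec_consL (m₀ : M) (φ : W →ₗ[k] TensorAlgebra k W × M →ₗ[k] M) (x : W)
    (v : TensorAlgebra k W) : tensorRec m₀ φ (consL k W x v) = φ x (v, tensorRec m₀ φ v) := by
  set F := TensorAlgebra.lift k (A := Module.End k (TensorAlgebra k W × M))
      ((LinearMap.prodEquiv k).toLinearMap ∘ₗ
        LinearMap.prod (LinearMap.lcomp k _ (LinearMap.fst k _ _) ∘ₗ consL k W) φ) with hF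
  have h1 : ∀ a, (F a ((1 : TensorAlgebra k W), m₀)).1 = a := by
    have h : LinearMap.fst k (TensorAlgebra k W) M ∘ₗ
        LinearMap.applyₗ ((1 : TensorAlgebra k W), m₀) ∘ₗ F.toLinearMap = LinearMap.id := by
      refine tensorAlgebra_ext (by simp) fun x v hv => ?_
      simp only [LinearMap.comp_apply, LinearMap.applyₗ_apply_apply, AlgHom.toLinearMap_apply,
        LinearMap.id_apply, LinearMap.fst_apply] at hv ⊢
      rw [consL_apply, map_mul, Module.End.mul_apply, hF, TensorAlgebra.lift_ι_apply, ← hF]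
      simp [hv, consL_apply]
    exact fun a => LinearMap.congr_fun h a
  have h2 : tensorRec m₀ φ (consL k W x v) = (F (consL k W x v) (1, m₀)).2 := rfl
  rw [h2, consL_apply, map_mul, Module.End.mul_apply, hF, TensorAlgebra.lift_ι_apply, ← hF]
  change φ x (F v (1, m₀)) = _
  congr 1
  exact Prod.ext (h1 v) rfl

/-! #### Deconcatenation -/

variable (k W) in
/-- The deconcatenation coproduct of the tensor algebra. -/
def deconc : TensorAlgebra k W →ₗ[k] TensorAlgebra k W ⊗[k] TensorAlgebra k W :=
  tensorRec (1 ⊗ₜ 1)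
    (LinearMap.lcomp k _ (LinearMap.fst k _ _) ∘ₗ
        LinearMap.compRight k (TensorProduct.mk k (TensorAlgebra k W) (TensorAlgebra k W) 1) ∘ₗ
          consL k W +
      LinearMap.lcomp k _ (LinearMap.snd k _ _) ∘ₗ
        LinearMap.rTensorHom (TensorAlgebra k W) ∘ₗ consL k W)

theorem deconc_one : deconc k W 1 = 1 ⊗ₜ 1 := tensorRec_one _ _

theorem deconc_consL (x : W) (v : TensorAlgebra k W) :
    deconc k W (consL k W x v) =
      1 ⊗ₜ consL k W x v + TensorProduct.map (consL k W x) LinearMap.id (deconc k W v) :=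
  tensorRec_consL _ _ x v

theorem deconc_coassoc :
    (TensorProduct.assoc k _ _ _).toLinearMap ∘ₗ
        TensorProduct.map (deconc k W) LinearMap.id ∘ₗ deconc k W =
      TensorProduct.map LinearMap.id (deconc k W) ∘ₗ deconc k W := by
  refine tensorAlgebra_ext ?_ fun x v hv => ?_
  · simp [deconc_one]
  · have h1 : (TensorProduct.assoc k _ _ _).toLinearMap ∘ₗ
        TensorProduct.map (deconc k W) LinearMap.id ∘ₗ
          TensorProduct.map (consL k W x) LinearMap.id =
        TensorProduct.mk k (TensorAlgebra k W) (TensorAlgebra k W ⊗[k] TensorAlgebra k W) 1 ∘ₗ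
            TensorProduct.map (consL k W x) LinearMap.id +
          TensorProduct.map (consL k W x) LinearMap.id ∘ₗ
            (TensorProduct.assoc k _ _ _).toLinearMap ∘ₗ
              TensorProduct.map (deconc k W) LinearMap.id := by
      refine TensorProduct.ext' fun a b => ?_
      simp only [LinearMap.comp_apply, TensorProduct.map_tmul, LinearMap.id_apply, deconc_consL,
        LinearMap.add_apply, LinearEquiv.coe_coe, TensorProduct.add_tmul, map_add,
        TensorProduct.assoc_tmul, TensorProduct.mk_apply]
      congr 1
      induction deconc k W a using TensorProduct.induction_on with
      | zero => simp
      | tmul c d => simp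
      | add c d hc hd => simp only [map_add, TensorProduct.add_tmul, hc, hd]
    have h2 : TensorProduct.map (LinearMap.id : TensorAlgebra k W →ₗ[k] _) (deconc k W) ∘ₗ
        TensorProduct.map (consL k W x) LinearMap.id =
        TensorProduct.map (consL k W x) LinearMap.id ∘ₗ
          TensorProduct.map LinearMap.id (deconc k W) := by
      rw [← TensorProduct.map_comp, ← TensorProduct.map_comp]
      rfl
    have h3 := LinearMap.congr_fun h1 (deconc k W v)
    have h4 := LinearMap.congr_fun h2 (deconc k W v)
    simp only [LinearMap.comp_apply, LinearMap.add_apply, LinearEquiv.coe_coe] at h3 h4 hv ⊢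
    rw [deconc_consL, map_add, map_add, map_add, h3, h4, hv, TensorProduct.map_tmul,
      TensorProduct.map_tmul, deconc_one, deconc_consL]
    simp only [LinearMap.id_apply, TensorProduct.assoc_tmul, TensorProduct.mk_apply,
      TensorProduct.tmul_add]
    abel

/-! #### The grading -/

variable (𝒲 : ℤ → Submodule k W)

/-- The words with homogeneous letters of total degree `i`. -/
inductive IsWord : ℤ → TensorAlgebra k W → Prop
  | nil : IsWord 0 1
  | cons {i j : ℤ} {x : W} {v : TensorAlgebra k W} :
      x ∈ 𝒲 i → IsWord j v → IsWord (i + j) (consL k W x v)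

/-- The degree `i` part of the tensor coalgebra. -/
def wordDegree (i : ℤ) : Submodule k (TensorAlgebra k W) := Submodule.span k {v | IsWord 𝒲 i v}

variable {𝒲} in
theorem one_mem_wordDegree : (1 : TensorAlgebra k W) ∈ wordDegree 𝒲 0 :=
  Submodule.subset_span IsWord.nil

variable {𝒲} in
theorem consL_mem_wordDegree {i j l : ℤ} {x : W} {v : TensorAlgebra k W} (hx : x ∈ 𝒲 i)
    (hv : v ∈ wordDegree 𝒲 j) (h : i + j = l) : consL k W x v ∈ wordDegree 𝒲 l := by
  subst h
  have h1 : wordDegree 𝒲 j ≤ (wordDegree 𝒲 (i + j)).comap (consL k W x) :=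
    Submodule.span_le.mpr fun w hw => Submodule.subset_span (IsWord.cons hx hw)
  exact h1 hv

/-- A graded family of eigenspaces that spans is a decomposition. -/
theorem isInternal_of_eigen [CharZero k] (gr : ℤ → Submodule k M) (E : M →ₗ[k] M)
    (hE : ∀ i, ∀ x ∈ gr i, E x = (2 : k) ^ i • x) (htop : ⨆ i, gr i = ⊤) :
    DirectSum.IsInternal gr := by
  rw [DirectSum.isInternal_submodule_iff_iSupIndep_and_iSup_eq_top]
  refine ⟨?_, htop⟩
  -- Different degrees have different eigenvalues, since the powers of `2` are distinct in
  -- characteristic zero.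
  have h1 : Function.Injective fun i : ℤ => (2 : k) ^ i := by
    intro i j hij
    have h2 : ((2 : ℚ) ^ i : ℚ) = 2 ^ j := by
      have : (((2 : ℚ) ^ i : ℚ) : k) = ((2 ^ j : ℚ) : k) := by push_cast; exact hij
      exact_mod_cast this
    exact zpow_right_injective₀ (by norm_num) (by norm_num) h2
  refine ((Module.End.eigenspaces_iSupIndep E).comp h1).mono fun i x hx => ?_
  exact Module.End.mem_eigenspace_iff.mpr (hE i x hx)

theorem deconc_mem (i : ℤ) (x : TensorAlgebra k W) (hx : x ∈ wordDegree 𝒲 i) :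
    deconc k W x ∈ tensorDegree (wordDegree 𝒲) i := by
  have h : wordDegree 𝒲 i ≤ (tensorDegree (wordDegree 𝒲) i).comap (deconc k W) := by
    clear hx
    refine Submodule.span_le.mpr fun w hw => ?_
    simp only [SetLike.mem_coe, Submodule.mem_comap]
    induction hw with
    | nil =>
      rw [deconc_one]
      exact tmul_mem_tensorDegree one_mem_wordDegree one_mem_wordDegree rfl
    | @cons i j x v hx hv ih =>
      rw [deconc_consL]
      refine Submodule.add_mem _ (tmul_mem_tensorDegree one_mem_wordDegree
        (Submodule.subset_span (IsWord.cons hx hv)) (zero_add _)) ?_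
      have h1 : tensorDegree (wordDegree 𝒲) j ≤ (tensorDegree (wordDegree 𝒲) (i + j)).comap
          (TensorProduct.map (consL k W x) LinearMap.id) :=
        tensorDegree_le fun p q hpq a ha b hb =>
          tmul_mem_tensorDegree (consL_mem_wordDegree hx ha rfl) hb (by omega)
      exact h1 ih
  exact h hx

variable [DirectSum.Decomposition 𝒲]

/-- The operator that multiplies the elements of degree `i` by `2 ^ i`. -/
def scaleDegree : W →ₗ[k] W :=
  DirectSum.toModule k ℤ W (fun i => (2 : k) ^ i • (𝒲 i).subtype) ∘ₗ
    (DirectSum.decomposeLinearEquiv 𝒲).toLinearMap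

theorem scaleDegree_of_mem {i : ℤ} {x : W} (hx : x ∈ 𝒲 i) :
    scaleDegree 𝒲 x = (2 : k) ^ i • x := by
  unfold scaleDegree
  rw [LinearMap.comp_apply, LinearEquiv.coe_coe, DirectSum.decomposeLinearEquiv_apply,
    DirectSum.decompose_of_mem 𝒲 hx]
  erw [DirectSum.toModule_lof]
  rfl

theorem iSup_wordDegree : ⨆ i, wordDegree 𝒲 i = ⊤ := by
  refine eq_top_of_consL_mem (Submodule.mem_iSup_of_mem 0 one_mem_wordDegree) _
    (span_homogeneous 𝒲) ?_
  rintro _ ⟨x, rfl⟩ v hv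
  have h : ⨆ i, wordDegree 𝒲 i ≤ (⨆ i, wordDegree 𝒲 i).comap (consL k W (x.2 : W)) :=
    iSup_le fun i w hw => Submodule.mem_iSup_of_mem (x.1 + i)
      (consL_mem_wordDegree x.2.2 hw rfl)
  exact h hv

variable [CharZero k]

/-- The algebra endomorphism that extends `scaleDegree` multiplies words of total degree `i` by `2 ^
i`. -/
theorem isInternal_wordDegree : DirectSum.IsInternal (wordDegree 𝒲) := by
  refine isInternal_of_eigen _
    (TensorAlgebra.lift k (TensorAlgebra.ι k ∘ₗ scaleDegree 𝒲)).toLinearMap ?_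
    (iSup_wordDegree 𝒲)
  · intro i x hx
    have h : wordDegree 𝒲 i ≤ LinearMap.eqLocus
        (TensorAlgebra.lift k (TensorAlgebra.ι k ∘ₗ scaleDegree 𝒲)).toLinearMap
        ((2 : k) ^ i • LinearMap.id) := by
      clear hx
      refine Submodule.span_le.mpr fun w hw => ?_
      simp only [SetLike.mem_coe, LinearMap.mem_eqLocus, LinearMap.smul_apply, LinearMap.id_apply,
        AlgHom.toLinearMap_apply]
      induction hw with
      | nil => simp
      | cons hx _ ih =>
        rw [consL_apply, map_mul, TensorAlgebra.lift_ι_apply, ih, LinearMap.comp_apply,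
          scaleDegree_of_mem 𝒲 hx, map_smul, smul_mul_smul_comm, zpow_add₀ two_ne_zero]
    exact h hx

instance : DirectSum.Decomposition (wordDegree 𝒲) :=
  (isInternal_wordDegree 𝒲).chooseDecomposition

theorem degInvol_one : degInvol (wordDegree 𝒲) 1 = 1 := by
  rw [degInvol_of_mem _ one_mem_wordDegree]
  simp

theorem degInvol_consL (x : W) (v : TensorAlgebra k W) :
    degInvol (wordDegree 𝒲) (consL k W x v) =
      consL k W (degInvol 𝒲 x) (degInvol (wordDegree 𝒲) v) := by
  have h : (LinearMap.compRight k (degInvol (wordDegree 𝒲))) ∘ₗ consL k W =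
      LinearMap.lcomp k _ (degInvol (wordDegree 𝒲)) ∘ₗ consL k W ∘ₗ degInvol 𝒲 := by
    refine linearMap_ext_homogeneous 𝒲 fun i x hx =>
      linearMap_ext_homogeneous (wordDegree 𝒲) fun j v hv => ?_
    simp only [LinearMap.comp_apply, LinearMap.compRight_apply, LinearMap.lcomp_apply,
      degInvol_of_mem 𝒲 hx, degInvol_of_mem _ hv, map_smul, LinearMap.smul_apply,
      degInvol_of_mem _ (consL_mem_wordDegree hx hv rfl), smul_smul, Int.cast_add, ksign_add_right]
  exact LinearMap.congr_fun (LinearMap.congr_fun h x) v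

end TensorCoalgebra

/-! ### The bar differential as a coderivation of square zero -/

section Bar

variable {k : Type u} [Field k] {W : Type v} [AddCommGroup W] [Module k W]
  (𝒲 : ℤ → Submodule k W) (D : W →ₗ[k] W) (m : W →ₗ[k] W →ₗ[k] W)

/-- Merging of a letter with the first letter of a tensor. -/
def mergeHead : W →ₗ[k] TensorAlgebra k W →ₗ[k] TensorAlgebra k W :=
  (tensorRec (M := W →ₗ[k] TensorAlgebra k W) 0
    { toFun := fun y => (consL k W ∘ₗ m.flip y).flip ∘ₗ LinearMap.fst k _ _
      map_add' := fun y y' => by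
        ext <;> simp
      map_smul' := fun c y => by
        ext <;> simp }).flip

theorem mergeHead_one (x : W) : mergeHead m x 1 = 0 := by
  rw [mergeHead, LinearMap.flip_apply, tensorRec_one, LinearMap.zero_apply]

theorem mergeHead_consL (x y : W) (v : TensorAlgebra k W) :
    mergeHead m x (consL k W y v) = consL k W (m x y) v := by
  rw [mergeHead, LinearMap.flip_apply, tensorRec_consL]
  rfl

variable {𝒲 m} in
theorem mergeHead_mem (hm : ∀ i j, ∀ x ∈ 𝒲 i, ∀ y ∈ 𝒲 j, m x y ∈ 𝒲 (i + j + 1)) {i j : ℤ} {x : W}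
    {v : TensorAlgebra k W} (hx : x ∈ 𝒲 i) (hv : v ∈ wordDegree 𝒲 j) :
    mergeHead m x v ∈ wordDegree 𝒲 (i + j + 1) := by
  have h : wordDegree 𝒲 j ≤ (wordDegree 𝒲 (i + j + 1)).comap (mergeHead m x) := by
    refine Submodule.span_le.mpr fun w hw => ?_
    simp only [SetLike.mem_coe, Submodule.mem_comap]
    cases hw with
    | nil =>
      rw [mergeHead_one]
      exact Submodule.zero_mem _
    | @cons a b y u hy hu =>
      rw [mergeHead_consL]
      exact consL_mem_wordDegree (hm i a x hx y hy) (Submodule.subset_span hu) (by ring)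
  exact h hv

/-- A cut cannot pass through the merged letter: the cut of `v` in front of its first letter
disappears since `mergeHead m x 1 = 0`. -/
theorem deconc_mergeHead (x : W) (v : TensorAlgebra k W) :
    deconc k W (mergeHead m x v) =
      1 ⊗ₜ mergeHead m x v + TensorProduct.map (mergeHead m x) LinearMap.id (deconc k W v) := by
  have h : deconc k W ∘ₗ mergeHead m x = TensorProduct.mk k (TensorAlgebra k W) _ 1 ∘ₗ
      mergeHead m x + TensorProduct.map (mergeHead m x) LinearMap.id ∘ₗ deconc k W := by
    refine tensorAlgebra_ext ?_ fun y u _ => ?_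
    · simp [mergeHead_one, deconc_one]
    · have h1 : TensorProduct.map (mergeHead m x) LinearMap.id ∘ₗ
          TensorProduct.map (consL k W y) (LinearMap.id : TensorAlgebra k W →ₗ[k] _) =
          TensorProduct.map (consL k W (m x y)) LinearMap.id := by
        rw [← TensorProduct.map_comp, LinearMap.id_comp]
        congr 1
        exact LinearMap.ext fun v => mergeHead_consL m x y v
      have h2 := LinearMap.congr_fun h1 (deconc k W u)
      simp only [LinearMap.comp_apply, LinearMap.add_apply, TensorProduct.mk_apply] at h2 ⊢
      rw [mergeHead_consL, deconc_consL, deconc_consL, map_add, TensorProduct.map_tmul,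
        mergeHead_one, TensorProduct.zero_tmul, zero_add, h2]
  exact LinearMap.congr_fun h v

variable [DirectSum.Decomposition 𝒲]

/-- The bar differential: the sum of the termwise extension of `D` and of the merging of adjacent
letters by `m`, with Koszul signs. -/
def barD : TensorAlgebra k W →ₗ[k] TensorAlgebra k W :=
  tensorRec 0
    (LinearMap.lcomp k _ (LinearMap.fst k _ _) ∘ₗ (consL k W ∘ₗ D + mergeHead m) +
      LinearMap.lcomp k _ (LinearMap.snd k _ _) ∘ₗ consL k W ∘ₗ degInvol 𝒲)

theorem barD_one : barD 𝒲 D m 1 = 0 := tensorRec_one _ _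

theorem barD_consL (x : W) (v : TensorAlgebra k W) :
    barD 𝒲 D m (consL k W x v) =
      consL k W (D x) v + mergeHead m x v + consL k W (degInvol 𝒲 x) (barD 𝒲 D m v) :=
  tensorRec_consL _ _ x v

theorem deconc_barD [CharZero k] : deconc k W ∘ₗ barD 𝒲 D m =
    (TensorProduct.map (barD 𝒲 D m) LinearMap.id +
      TensorProduct.map (degInvol (wordDegree 𝒲)) (barD 𝒲 D m)) ∘ₗ deconc k W := by
  refine tensorAlgebra_ext (by simp [barD_one, deconc_one]) fun x v hv => ?_
  have h1 : TensorProduct.map (barD 𝒲 D m) LinearMap.id ∘ₗ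
      TensorProduct.map (consL k W x) (LinearMap.id : TensorAlgebra k W →ₗ[k] _) =
      TensorProduct.map (consL k W (D x)) LinearMap.id +
        TensorProduct.map (mergeHead m x) LinearMap.id +
        TensorProduct.map (consL k W (degInvol 𝒲 x)) LinearMap.id ∘ₗ
          TensorProduct.map (barD 𝒲 D m) LinearMap.id := by
    refine TensorProduct.ext' fun a b => ?_
    simp [barD_consL, TensorProduct.add_tmul]
  have h2 : TensorProduct.map (degInvol (wordDegree 𝒲)) (barD 𝒲 D m) ∘ₗ
      TensorProduct.map (consL k W x) (LinearMap.id : TensorAlgebra k W →ₗ[k] _) =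
      TensorProduct.map (consL k W (degInvol 𝒲 x)) LinearMap.id ∘ₗ
        TensorProduct.map (degInvol (wordDegree 𝒲)) (barD 𝒲 D m) := by
    refine TensorProduct.ext' fun a b => ?_
    simp [degInvol_consL]
  have h3 := LinearMap.congr_fun h1 (deconc k W v)
  have h4 := LinearMap.congr_fun h2 (deconc k W v)
  simp only [LinearMap.comp_apply, LinearMap.add_apply] at h3 h4 hv ⊢
  rw [barD_consL, map_add, map_add, deconc_consL, deconc_mergeHead, deconc_consL, deconc_consL, hv,
    map_add, map_add, map_add, h3, h4, TensorProduct.map_tmul, TensorProduct.map_tmul, barD_one,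
    degInvol_one, barD_consL]
  simp only [TensorProduct.tmul_add, TensorProduct.zero_tmul]
  abel

/-- The conditions on `D` and `m` under which the bar differential is a differential of degree
one. -/
structure IsBarData : Prop where
  D_mem : ∀ i, ∀ x ∈ 𝒲 i, D x ∈ 𝒲 (i + 1)
  m_mem : ∀ i j, ∀ x ∈ 𝒲 i, ∀ y ∈ 𝒲 j, m x y ∈ 𝒲 (i + j + 1)
  D_D : ∀ x, D (D x) = 0
  assoc : ∀ x y z, m (m x y) z + m (degInvol 𝒲 x) (m y z) = 0
  leibniz : ∀ x y, D (m x y) + m (D x) y + m (degInvol 𝒲 x) (D y) = 0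
  symm : ∀ i j, ∀ x ∈ 𝒲 i, ∀ y ∈ 𝒲 j, m x y = -(ksign k i j • m y x)

namespace IsBarData

variable {𝒲 D m}

theorem degInvol_D (h : IsBarData 𝒲 D m) (x : W) : degInvol 𝒲 (D x) + D (degInvol 𝒲 x) = 0 := by
  have h1 : degInvol 𝒲 ∘ₗ D + D ∘ₗ degInvol 𝒲 = 0 := by
    refine linearMap_ext_homogeneous 𝒲 fun i x hx => ?_
    simp only [LinearMap.add_apply, LinearMap.comp_apply, degInvol_of_mem 𝒲 hx,
      degInvol_of_mem 𝒲 (h.D_mem i x hx), map_smul, Int.cast_add, Int.cast_one, ksign_add_right,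
      ksign_one_one, mul_neg, mul_one, neg_smul, neg_add_cancel, LinearMap.zero_apply]
  exact LinearMap.congr_fun h1 x

theorem degInvol_m (h : IsBarData 𝒲 D m) (x y : W) :
    degInvol 𝒲 (m x y) + m (degInvol 𝒲 x) (degInvol 𝒲 y) = 0 := by
  have h1 : LinearMap.compRight k (degInvol 𝒲) ∘ₗ m +
      LinearMap.lcomp k _ (degInvol 𝒲) ∘ₗ m ∘ₗ degInvol 𝒲 = 0 := by
    refine linearMap_ext_homogeneous 𝒲 fun i x hx => linearMap_ext_homogeneous 𝒲 fun j y hy => ?_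
    simp only [LinearMap.add_apply, LinearMap.comp_apply, LinearMap.compRight_apply,
      LinearMap.lcomp_apply, degInvol_of_mem 𝒲 hx, degInvol_of_mem 𝒲 hy,
      degInvol_of_mem 𝒲 (h.m_mem i j x hx y hy), map_smul, LinearMap.smul_apply, Int.cast_add,
      Int.cast_one, ksign_add_right, ksign_one_one, mul_neg, mul_one, neg_smul, smul_smul,
      neg_add_cancel, LinearMap.zero_apply]
  exact LinearMap.congr_fun (LinearMap.congr_fun h1 x) y

theorem mergeHead_mergeHead (h : IsBarData 𝒲 D m) (x y : W) (v : TensorAlgebra k W) :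
    mergeHead m (m x y) v + mergeHead m (degInvol 𝒲 x) (mergeHead m y v) = 0 := by
  have h1 : mergeHead m (m x y) + mergeHead m (degInvol 𝒲 x) ∘ₗ mergeHead m y = 0 := by
    refine tensorAlgebra_ext (by simp [mergeHead_one]) fun z u _ => ?_
    have h2 := congrArg (fun w => consL k W w u) (h.assoc x y z)
    simpa [mergeHead_consL] using h2
  exact LinearMap.congr_fun h1 v

/-- On a word starting with `y`, the terms cancel by the Leibniz rule for `x` and `y`, by the degree
of `m`, and by associativity for `x`, `y` and the letter after `y`. -/
theorem barD_mergeHead (h : IsBarData 𝒲 D m) (x : W) (v : TensorAlgebra k W) :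
    mergeHead m (D x) v + barD 𝒲 D m (mergeHead m x v) +
      mergeHead m (degInvol 𝒲 x) (barD 𝒲 D m v) = 0 := by
  have h1 : mergeHead m (D x) + barD 𝒲 D m ∘ₗ mergeHead m x +
      mergeHead m (degInvol 𝒲 x) ∘ₗ barD 𝒲 D m = 0 := by
    refine tensorAlgebra_ext (by simp [mergeHead_one, barD_one]) fun y u _ => ?_
    simp only [LinearMap.add_apply, LinearMap.comp_apply, mergeHead_consL, barD_consL, map_add,
      LinearMap.zero_apply]
    have h2 := congrArg (fun w => consL k W w u) (h.leibniz x y)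
    have h3 := congrArg (fun w => consL k W w (barD 𝒲 D m u)) (h.degInvol_m x y)
    have h4 := h.mergeHead_mergeHead x y u
    simp only [map_add, LinearMap.add_apply, map_zero, LinearMap.zero_apply] at h2 h3
    linear_combination (norm := abel) h2 + h3 + h4
  exact LinearMap.congr_fun h1 v

/-- Recursion on the first letter `x`: terms that differentiate only `x` or only the tail vanish by
`D_D` and by induction, mixed ones because `D` is odd, and those that involve a merging with `x` by
`barD_mergeHead`. -/
theorem barD_barD (h : IsBarData 𝒲 D m) : barD 𝒲 D m ∘ₗ barD 𝒲 D m = 0 := by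
  refine tensorAlgebra_ext (by simp [barD_one]) fun x v hv => ?_
  simp only [LinearMap.comp_apply, LinearMap.zero_apply] at hv ⊢
  rw [barD_consL, map_add, map_add, barD_consL, barD_consL, h.D_D, hv]
  have h2 := congrArg (fun w => consL k W w (barD 𝒲 D m v)) (h.degInvol_D x)
  have h4 := h.barD_mergeHead x v
  simp only [map_add, LinearMap.add_apply, map_zero, LinearMap.zero_apply] at h2
  rw [map_zero, map_zero, LinearMap.zero_apply]
  linear_combination (norm := abel) h2 + h4

theorem barD_mem (h : IsBarData 𝒲 D m) (i : ℤ) (x : TensorAlgebra k W) (hx : x ∈ wordDegree 𝒲 i) :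
    barD 𝒲 D m x ∈ wordDegree 𝒲 (i + 1) := by
  have h1 : wordDegree 𝒲 i ≤ (wordDegree 𝒲 (i + 1)).comap (barD 𝒲 D m) := by
    clear hx
    refine Submodule.span_le.mpr fun w hw => ?_
    simp only [SetLike.mem_coe, Submodule.mem_comap]
    induction hw with
    | nil =>
      rw [barD_one]
      exact Submodule.zero_mem _
    | @cons i j x v hx hv ih =>
      rw [barD_consL]
      refine Submodule.add_mem _ (Submodule.add_mem _ ?_ ?_) ?_
      · exact consL_mem_wordDegree (h.D_mem i x hx) (Submodule.subset_span hv) (by ring)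
      · exact mergeHead_mem h.m_mem hx (Submodule.subset_span hv)
      · rw [degInvol_of_mem 𝒲 hx, map_smul, LinearMap.smul_apply]
        exact Submodule.smul_mem _ _ (consL_mem_wordDegree hx ih (by ring))
  exact h1 hx

end IsBarData

end Bar

/-! ### The Harrison complex as a quotient of the bar construction -/

section Harrison

variable {k : Type u} [Field k] {W : Type v} [AddCommGroup W] [Module k W]

variable (k W) in
theorem tprod_zero (w : Fin 0 → W) : TensorAlgebra.tprod k W 0 w = 1 := by
  simp [TensorAlgebra.tprod_apply]

theorem tprod_cons {n : ℕ} (x : W) (w : Fin n → W) :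
    TensorAlgebra.tprod k W (n + 1) (Fin.cons x w) = consL k W x (TensorAlgebra.tprod k W n w) := by
  simp [TensorAlgebra.tprod_apply, consL_apply, List.ofFn_succ]

theorem isWord_iff {𝒲 : ℤ → Submodule k W} {i : ℤ} {v : TensorAlgebra k W} :
    IsWord 𝒲 i v ↔ ∃ (n : ℕ) (p : Fin n → ℤ) (w : Fin n → W), (∀ j, w j ∈ 𝒲 (p j)) ∧
      ∑ j, p j = i ∧ v = TensorAlgebra.tprod k W n w := by
  constructor
  · intro h
    induction h with
    | nil => exact ⟨0, 0, 0, fun j => j.elim0, by simp, (tprod_zero k W _).symm⟩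
    | @cons i j x v hx _ ih =>
      obtain ⟨n, p, w, hw, rfl, rfl⟩ := ih
      refine ⟨n + 1, Fin.cons i p, Fin.cons x w, fun j => ?_, by simp [Fin.sum_univ_succ],
        (tprod_cons x w).symm⟩
      refine Fin.cases ?_ (fun j => ?_) j
      · simpa using hx
      · simpa using hw j
  · rintro ⟨n, p, w, hw, rfl, rfl⟩
    induction n with
    | zero =>
      rw [tprod_zero]
      simpa using IsWord.nil
    | succ n ih =>
      rw [← Fin.cons_self_tail w, tprod_cons, Fin.sum_univ_succ]
      exact IsWord.cons (hw 0) (ih (fun j => p j.succ) (Fin.tail w) fun j => hw j.succ)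

theorem tprod_induction {S : Submodule k (TensorAlgebra k W)} (𝒲 : ℤ → Submodule k W)
    [DirectSum.Decomposition 𝒲]
    (h : ∀ (n : ℕ) (p : Fin n → ℤ) (w : Fin n → W), (∀ j, w j ∈ 𝒲 (p j)) →
      TensorAlgebra.tprod k W n w ∈ S) : S = ⊤ := by
  have h1 : ⨆ i, wordDegree 𝒲 i ≤ S := iSup_le fun i => Submodule.span_le.mpr fun v hv => by
    obtain ⟨n, p, w, hw, _, rfl⟩ := isWord_iff.mp hv
    exact h n p w hw
  rw [eq_top_iff, ← iSup_wordDegree 𝒲]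
  exact h1

variable (𝒲 : ℤ → Submodule k W) [DirectSum.Decomposition 𝒲]

/-- The projection from the tensor coalgebra to the Harrison complex. -/
def harrProj : TensorAlgebra k W →ₗ[k] Harr 𝒲 :=
  DirectSum.toModule k ℕ (Harr 𝒲) (harrClassNat 𝒲) ∘ₗ
    (TensorAlgebra.toDirectSum (R := k) (M := W)).toLinearMap

theorem harrProj_tprod {n : ℕ} (w : Fin n → W) :
    harrProj 𝒲 (TensorAlgebra.tprod k W n w) = harrClassNat 𝒲 n (PiTensorProduct.tprod k w) := by
  rw [harrProj, LinearMap.comp_apply, AlgHom.toLinearMap_apply,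
    TensorAlgebra.toDirectSum_tensorPower_tprod]
  exact DirectSum.toModule_lof k n _

theorem harrProj_toTensorAlgebra {n : ℕ} (x : ⨂[k] _ : Fin n, W) :
    harrProj 𝒲 (TensorPower.toTensorAlgebra x) = harrClassNat 𝒲 n x := by
  have h : harrProj 𝒲 ∘ₗ TensorPower.toTensorAlgebra = harrClassNat 𝒲 n := by
    refine PiTensorProduct.ext (MultilinearMap.ext fun w => ?_)
    simp only [LinearMap.compMultilinearMap_apply, LinearMap.comp_apply,
      TensorPower.toTensorAlgebra_tprod, harrProj_tprod]
  exact LinearMap.congr_fun h x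

/-- The linear map on the Harrison complex induced by linear maps on words that vanish on
shuffles. -/
def harrLift {N : Type*} [AddCommGroup N] [Module k N]
    (f : ∀ n : ℕ+, (⨂[k] _ : Fin n, W) →ₗ[k] N)
    (hf : ∀ n : ℕ+, harrisonShuffles 𝒲 n ≤ LinearMap.ker (f n)) : Harr 𝒲 →ₗ[k] N :=
  DirectSum.toModule k ℕ+ N fun n => (harrisonShuffles 𝒲 n).liftQ (f n) (hf n)

theorem harrLift_harrClass {N : Type*} [AddCommGroup N] [Module k N]
    (f : ∀ n : ℕ+, (⨂[k] _ : Fin n, W) →ₗ[k] N)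
    (hf : ∀ n : ℕ+, harrisonShuffles 𝒲 n ≤ LinearMap.ker (f n)) (n : ℕ+)
    (x : ⨂[k] _ : Fin n, W) : harrLift 𝒲 f hf (harrClass 𝒲 n x) = f n x :=
  (DirectSum.toModule_lof k n _).trans (Submodule.liftQ_apply _ _ _)

theorem harr_ext {N : Type*} [AddCommGroup N] [Module k N] {f g : Harr 𝒲 →ₗ[k] N}
    (h : ∀ n x, f (harrClass 𝒲 n x) = g (harrClass 𝒲 n x)) : f = g := by
  refine DirectSum.linearMap_ext k fun n => ?_
  refine Submodule.linearMap_qext _ (LinearMap.ext fun x => ?_)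
  exact h n x

theorem harrProj_surjective : Function.Surjective (harrProj 𝒲) := by
  rw [← LinearMap.range_eq_top, ← (LinearMap.range (harrProj 𝒲)).ker_mkQ, LinearMap.ker_eq_top]
  refine harr_ext 𝒲 fun n x => ?_
  rw [LinearMap.zero_apply, Submodule.mkQ_apply, Submodule.Quotient.mk_eq_zero, ← harrClassNat_coe]
  exact ⟨_, harrProj_toTensorAlgebra 𝒲 x⟩

theorem map_harrProj_wordDegree (i : ℤ) :
    (wordDegree 𝒲 i).map (harrProj 𝒲) = harrDegree 𝒲 i := by
  rw [wordDegree, Submodule.map_span, harrDegree]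
  refine le_antisymm (Submodule.span_le.mpr ?_) (Submodule.span_le.mpr ?_)
  · rintro _ ⟨v, hv, rfl⟩
    obtain ⟨n, p, w, hw, hi, rfl⟩ := isWord_iff.mp hv
    rw [harrProj_tprod]
    cases n with
    | zero => exact Submodule.zero_mem _
    | succ n => exact Submodule.subset_span ⟨n.succPNat, p, w, hw, hi, rfl⟩
  · rintro _ ⟨n, p, w, hw, hi, rfl⟩
    refine Submodule.subset_span ⟨_, isWord_iff.mpr ⟨n, p, w, hw, hi, rfl⟩, ?_⟩
    rw [harrProj_tprod, harrClassNat_coe]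

theorem harrisonShuffles_le_ker {N : Type*} [AddCommGroup N] [Module k N] {n : ℕ}
    {f : (⨂[k] _ : Fin n, W) →ₗ[k] N} (hf : ∀ p ∈ Finset.Ioo 0 n, f ∘ₗ shuffleSum 𝒲 n p = 0) :
    harrisonShuffles 𝒲 n ≤ LinearMap.ker f :=
  iSup₂_le fun p hp => LinearMap.range_le_ker_iff.mpr (hf p hp)

theorem harrClassNat_shuffleSum {n p : ℕ} (hp : p ∈ Finset.Ioo 0 n) :
    harrClassNat 𝒲 n ∘ₗ shuffleSum 𝒲 n p = 0 := by
  refine LinearMap.ext fun x => harrClassNat_apply_eq_zero 𝒲 n _ ?_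
  exact (le_iSup₂_of_le (f := fun p _ => LinearMap.range (shuffleSum 𝒲 n p)) p hp le_rfl) ⟨x, rfl⟩

/-! #### The grading -/

theorem map_scaleDegree_tprod {n : ℕ} {p : Fin n → ℤ} {w : Fin n → W}
    (hw : ∀ j, w j ∈ 𝒲 (p j)) [NeZero (2 : k)] :
    PiTensorProduct.map (fun _ => scaleDegree 𝒲) (PiTensorProduct.tprod k w) =
      (2 : k) ^ (∑ j, p j) • PiTensorProduct.tprod k w := by
  rw [PiTensorProduct.map_tprod]
  simp only [scaleDegree_of_mem 𝒲 (hw _)]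
  rw [tprod_smul]
  congr 1
  induction (Finset.univ : Finset (Fin n)) using Finset.cons_induction with
  | empty => simp
  | cons a s ha ih => rw [Finset.prod_cons, Finset.sum_cons, zpow_add₀ two_ne_zero, ih]

theorem map_scaleDegree_koszul {n : ℕ} [NeZero (2 : k)] (σ : Equiv.Perm (Fin n)) :
    PiTensorProduct.map (fun _ => scaleDegree 𝒲) ∘ₗ koszul 𝒲 σ =
      koszul 𝒲 σ ∘ₗ PiTensorProduct.map (fun _ => scaleDegree 𝒲) := by
  refine tensor_ext_homogeneous 𝒲 fun p w hw => ?_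
  rw [LinearMap.comp_apply, LinearMap.comp_apply, map_scaleDegree_tprod 𝒲 hw, map_smul,
    koszul_tprod 𝒲 σ hw, map_smul, map_scaleDegree_tprod 𝒲 (p := fun j => p (σ.symm j))
    (fun j => hw _), Equiv.sum_comp σ.symm, smul_comm]

theorem map_scaleDegree_shuffleSum {n : ℕ} [NeZero (2 : k)] (p : ℕ) :
    PiTensorProduct.map (fun _ => scaleDegree 𝒲) ∘ₗ shuffleSum 𝒲 n p =
      shuffleSum 𝒲 n p ∘ₗ PiTensorProduct.map (fun _ => scaleDegree 𝒲) := by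
  rw [shuffleSum, linearMap_comp_sum, linearMap_sum_comp]
  exact Finset.sum_congr rfl fun σ _ => map_scaleDegree_koszul 𝒲 σ

/-- Scaling every letter by its degree commutes with reorderings and hence with shuffles, so it
descends to an operator that is `2 ^ i` on the part of degree `i`. -/
theorem isInternal_harrDegree [CharZero k] : DirectSum.IsInternal (harrDegree 𝒲) := by
  have hker : ∀ n : ℕ+, harrisonShuffles 𝒲 n ≤
      LinearMap.ker (harrClass 𝒲 n ∘ₗ PiTensorProduct.map (fun _ => scaleDegree 𝒲)) := by
    intro n
    refine harrisonShuffles_le_ker 𝒲 fun p hp => ?_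
    rw [LinearMap.comp_assoc, map_scaleDegree_shuffleSum, ← LinearMap.comp_assoc,
      ← harrClassNat_coe, harrClassNat_shuffleSum 𝒲 hp, LinearMap.zero_comp]
  refine isInternal_of_eigen _ (harrLift 𝒲 _ hker) (fun i x hx => ?_) ?_
  · have h : harrDegree 𝒲 i ≤ LinearMap.eqLocus (harrLift 𝒲 _ hker)
        ((2 : k) ^ i • LinearMap.id) := by
      refine Submodule.span_le.mpr ?_
      rintro _ ⟨n, p, w, hw, rfl, rfl⟩
      rw [SetLike.mem_coe, LinearMap.mem_eqLocus, harrLift_harrClass, LinearMap.comp_apply,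
        map_scaleDegree_tprod 𝒲 hw, map_smul]
      rfl
    exact h hx
  · simp only [← map_harrProj_wordDegree, ← Submodule.map_iSup]
    rw [iSup_wordDegree, Submodule.map_top, LinearMap.range_eq_top]
    exact harrProj_surjective 𝒲

/-! #### The differential -/

variable (D : W →ₗ[k] W) (m : W →ₗ[k] W →ₗ[k] W)

theorem toTensorAlgebra_termwise_cons {n : ℕ} (x : W) (w : Fin n → W) :
    TensorPower.toTensorAlgebra
        (termwise 𝒲 D (PiTensorProduct.tprod k (Fin.cons x w : Fin (n + 1) → W))) =
      consL k W (D x) (TensorAlgebra.tprod k W n w) +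
        consL k W (degInvol 𝒲 x)
          (TensorPower.toTensorAlgebra (termwise 𝒲 D (PiTensorProduct.tprod k w))) := by
  unfold termwise
  simp only [LinearMap.sum_apply, map_sum, PiTensorProduct.map_tprod,
    TensorPower.toTensorAlgebra_tprod]
  rw [Fin.sum_univ_succ]
  congr 1
  · rw [← tprod_cons]
    congr 1
    funext j
    refine Fin.cases ?_ (fun j => ?_) j
    · simp
    · simp
  · refine Finset.sum_congr rfl fun i _ => ?_
    rw [← tprod_cons]
    congr 1
    funext j
    refine Fin.cases ?_ (fun j => ?_) j
    · simp
    · simp [Fin.succ_lt_succ_iff]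

/-- The sum of all mergings of adjacent letters, as a map to the tensor algebra. -/
def mergeSum : (n : ℕ) → (⨂[k] _ : Fin n, W) →ₗ[k] TensorAlgebra k W
  | 0 => 0
  | 1 => 0
  | n + 2 => ∑ i : Fin (n + 1), TensorPower.toTensorAlgebra ∘ₗ merge (degInvol 𝒲) m i

theorem mergeFun_succ_cons (L : W →ₗ[k] W) {n : ℕ} (i : Fin (n + 1)) (x : W)
    (w : Fin (n + 2) → W) :
    mergeFun L m i.succ (Fin.cons x w : Fin (n + 3) → W) = Fin.cons (L x) (mergeFun L m i w) := by
  funext j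
  refine Fin.cases ?_ (fun j => ?_) j
  · simp [mergeFun]
  · simp [mergeFun]

/-- Either the first letter takes part in the merging, or it is passed by the operation and picks up
its degree sign. This matches the recursion that defines `barD`. -/
theorem mergeSum_cons : ∀ {n : ℕ} (x : W) (w : Fin n → W),
    mergeSum 𝒲 m (n + 1) (PiTensorProduct.tprod k (Fin.cons x w : Fin (n + 1) → W)) =
      mergeHead m x (TensorAlgebra.tprod k W n w) +
        consL k W (degInvol 𝒲 x) (mergeSum 𝒲 m n (PiTensorProduct.tprod k w))
  | 0, x, w => by
    rw [tprod_zero, mergeHead_one]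
    simp [mergeSum]
  | 1, x, w => by
    obtain ⟨y, u, rfl⟩ : ∃ (y : W) (u : Fin 0 → W), w = Fin.cons y u :=
      ⟨w 0, Fin.tail w, (Fin.cons_self_tail w).symm⟩
    rw [tprod_cons, mergeHead_consL, ← tprod_cons]
    simp only [mergeSum, LinearMap.zero_apply, map_zero, add_zero, LinearMap.sum_apply,
      LinearMap.comp_apply, merge_tprod, TensorPower.toTensorAlgebra_tprod]
    rw [Fin.sum_univ_succ, mergeFun_zero]
    simp only [Finset.univ_eq_empty, Finset.sum_empty, add_zero]
    congr 1
  | n + 2, x, w => by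
    obtain ⟨y, u, rfl⟩ : ∃ (y : W) (u : Fin (n + 1) → W), w = Fin.cons y u :=
      ⟨w 0, Fin.tail w, (Fin.cons_self_tail w).symm⟩
    rw [tprod_cons, mergeHead_consL, ← tprod_cons]
    simp only [mergeSum, LinearMap.sum_apply, LinearMap.comp_apply, merge_tprod,
      TensorPower.toTensorAlgebra_tprod, map_sum]
    rw [Fin.sum_univ_succ, mergeFun_zero]
    congr 1
    refine Finset.sum_congr rfl fun i _ => ?_
    rw [mergeFun_succ_cons, tprod_cons]

/-- Connects the recursive bar differential, for which the coalgebra identities are proved, with the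
explicit formula on words. -/
theorem barD_tprod {n : ℕ} (w : Fin n → W) :
    barD 𝒲 D m (TensorAlgebra.tprod k W n w) =
      TensorPower.toTensorAlgebra (termwise 𝒲 D (PiTensorProduct.tprod k w)) +
        mergeSum 𝒲 m n (PiTensorProduct.tprod k w) := by
  induction n with
  | zero =>
    rw [tprod_zero, barD_one]
    simp [mergeSum, termwise]
  | succ n ih =>
    rw [← Fin.cons_self_tail w, tprod_cons, barD_consL, toTensorAlgebra_termwise_cons,
      mergeSum_cons, ih, map_add]
    abel

theorem harrProj_mergeSum : ∀ (n : ℕ) (x : ⨂[k] _ : Fin n, W),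
    harrProj 𝒲 (mergeSum 𝒲 m n x) = harrContract 𝒲 m n x
  | 0, _ => map_zero _
  | 1, _ => map_zero _
  | n + 2, x => by
    simp only [mergeSum, harrContract, LinearMap.sum_apply, map_sum, LinearMap.comp_apply,
      harrProj_toTensorAlgebra]
    rfl

variable {𝒲 D m}

/-- A shuffle is the sum over linear extensions of two disjoint chains. By `sum_merge_leSum` its
contractions are such sums for contracted graphs, which are still disconnected and thus give
shuffles. -/
theorem IsBarData.harrContract_shuffleSum (h : IsBarData 𝒲 D m) : ∀ {n p : ℕ},
    p ∈ Finset.Ioo 0 n → harrContract 𝒲 m n ∘ₗ shuffleSum 𝒲 n p = 0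
  | 0, _, _ => LinearMap.zero_comp _
  | 1, _, _ => LinearMap.zero_comp _
  | n + 2, p, hp => by
    have h1 : harrContract 𝒲 m (n + 2) ∘ₗ shuffleSum 𝒲 (n + 2) p = harrClassNat 𝒲 (n + 1) ∘ₗ
        ∑ i : Fin (n + 1), merge (degInvol 𝒲) m i ∘ₗ leSum 𝒲 (n + 2) (twoChains (n + 2) p) := by
      rw [shuffleSum_eq_leSum, linearMap_comp_sum]
      exact linearMap_sum_comp _ _ _
    have hasymm : ∀ a b, (twoChains (n + 2) p).Adj a b → ¬ (twoChains (n + 2) p).Adj b a := by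
      rintro a b ⟨h2, _⟩ ⟨h3, _⟩
      omega
    rw [h1, sum_merge_leSum 𝒲 h.m_mem h.symm hasymm, linearMap_comp_sum]
    refine Finset.sum_eq_zero fun e he => LinearMap.ext fun x => ?_
    rw [mem_edges] at he
    rw [LinearMap.comp_apply, LinearMap.comp_apply]
    refine harrClassNat_apply_eq_zero 𝒲 _ _ (leSum_mem_harrisonShuffles 𝒲 (Fintype.card_fin _) ?_ _)
    refine not_conn_contract (not_conn_twoChains hp) he fun hne => ?_
    have := he.1
    rw [hne] at this
    omega

theorem IsBarData.harrisonShuffles_le_ker_d (h : IsBarData 𝒲 D m) (n : ℕ+) :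
    harrisonShuffles 𝒲 n ≤
      LinearMap.ker (harrClass 𝒲 n ∘ₗ termwise 𝒲 D + harrContract 𝒲 m n) := by
  refine harrisonShuffles_le_ker 𝒲 fun p hp => ?_
  have h1 : termwise 𝒲 D ∘ₗ shuffleSum 𝒲 n p = shuffleSum 𝒲 n p ∘ₗ termwise 𝒲 D := by
    rw [shuffleSum, linearMap_comp_sum, linearMap_sum_comp]
    exact Finset.sum_congr rfl fun σ _ => termwise_koszul 𝒲 D h.D_mem σ
  rw [LinearMap.add_comp, h.harrContract_shuffleSum hp, LinearMap.comp_assoc, h1,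
    ← LinearMap.comp_assoc, ← harrClassNat_coe, harrClassNat_shuffleSum 𝒲 hp, LinearMap.zero_comp,
    add_zero]

/-- The differential of the Harrison complex. -/
def IsBarData.harrDiff (h : IsBarData 𝒲 D m) : Harr 𝒲 →ₗ[k] Harr 𝒲 :=
  harrLift 𝒲 _ h.harrisonShuffles_le_ker_d

theorem IsBarData.harrDiff_harrClass (h : IsBarData 𝒲 D m) (n : ℕ+) (x : ⨂[k] _ : Fin n, W) :
    h.harrDiff (harrClass 𝒲 n x) =
      harrClass 𝒲 n (termwise 𝒲 D x) + harrContract 𝒲 m n x :=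
  harrLift_harrClass 𝒲 _ _ n x

theorem IsBarData.harrDiff_comp_harrProj (h : IsBarData 𝒲 D m) :
    h.harrDiff ∘ₗ harrProj 𝒲 = harrProj 𝒲 ∘ₗ barD 𝒲 D m := by
  rw [← LinearMap.eqLocus_eq_top]
  refine tprod_induction 𝒲 fun n p w hw => ?_
  rw [LinearMap.mem_eqLocus, LinearMap.comp_apply, LinearMap.comp_apply, barD_tprod, map_add,
    harrProj_toTensorAlgebra, harrProj_mergeSum, harrProj_tprod]
  cases n with
  | zero => simp [harrClassNat, harrContract]
  | succ n => exact h.harrDiff_harrClass n.succPNat _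

end Harrison

/-! ### The cobracket of the Harrison complex -/

section Cobracket

variable {k : Type u} [Field k] {W : Type v} [AddCommGroup W] [Module k W]

theorem deconc_list (l : List W) :
    deconc k W (l.map (TensorAlgebra.ι k)).prod = ∑ p ∈ Finset.range (l.length + 1),
      ((l.take p).map (TensorAlgebra.ι k)).prod ⊗ₜ[k] ((l.drop p).map (TensorAlgebra.ι k)).prod := by
  induction l with
  | nil => simp [deconc_one]
  | cons x l ih =>
    rw [List.map_cons, List.prod_cons, ← consL_apply, deconc_consL, ih, List.length_cons,
      Finset.sum_range_succ' _ (l.length + 1), add_comm, map_sum]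
    simp [consL_apply]

variable (𝒲 : ℤ → Submodule k W) [DirectSum.Decomposition 𝒲]

theorem harrClassOf_tprod {J : Type} [Fintype J] [LinearOrder J] {n : ℕ} (e : J ≃ Fin n)
    (he : ∀ i j, e i < e j ↔ i < j) (u : J → W) :
    harrClassOf 𝒲 (PiTensorProduct.tprod k u) =
      harrClassNat 𝒲 n (PiTensorProduct.tprod k (fun i => u (e.symm i))) := by
  obtain rfl : n = Fintype.card J := by rw [Fintype.card_congr e, Fintype.card_fin]
  have h : e = (Fintype.orderIsoFinOfCardEq J rfl).symm.toEquiv :=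
    equiv_eq_of_lt_iff fun a b => (he a b).trans
      (Fintype.orderIsoFinOfCardEq J rfl).symm.lt_iff_lt.symm
  rw [harrClassOf_eq, LinearMap.comp_apply, ← h,
    koszul_of_strictMono 𝒲 e fun i j h => (he i j).mpr h, LinearEquiv.coe_coe,
    PiTensorProduct.reindex_tprod]

/-- The order isomorphism between an initial segment of `Fin (p + q)` and `Fin p`. -/
def initialEquiv {p q : ℕ} {P : Fin (p + q) → Prop} (hP : ∀ i, P i ↔ (i : ℕ) < p) :
    {i // P i} ≃ Fin p where
  toFun i := ⟨i.1, (hP _).mp i.2⟩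
  invFun j := ⟨Fin.castAdd q j, (hP _).mpr j.2⟩
  left_inv _ := rfl
  right_inv _ := rfl

/-- The order isomorphism between a final segment of `Fin (p + q)` and `Fin q`. -/
def finalEquiv {p q : ℕ} {P : Fin (p + q) → Prop} (hP : ∀ i, P i ↔ p ≤ (i : ℕ)) :
    {i // P i} ≃ Fin q where
  toFun i := ⟨i.1 - p, by have := (hP _).mp i.2; have := i.1.2; omega⟩
  invFun j := ⟨Fin.natAdd p j, (hP _).mpr (by simp)⟩
  left_inv i := by
    have := (hP _).mp i.2
    refine Subtype.ext (Fin.ext ?_)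
    simp only [Fin.val_natAdd]
    omega
  right_inv j := by simp

theorem harrClassOf_initial {p q : ℕ} {P : Fin (p + q) → Prop} {_ : Fintype {i // P i}}
    (hP : ∀ i, P i ↔ (i : ℕ) < p) (w : Fin (p + q) → W) :
    harrClassOf 𝒲 (PiTensorProduct.tprod k (fun i : {i // P i} => w i)) =
      harrClassNat 𝒲 p (PiTensorProduct.tprod k (fun j => w (Fin.castAdd q j))) :=
  harrClassOf_tprod 𝒲 (initialEquiv hP) (fun _ _ => Iff.rfl) _

theorem harrClassOf_final {p q : ℕ} {P : Fin (p + q) → Prop} {_ : Fintype {i // P i}}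
    (hP : ∀ i, P i ↔ p ≤ (i : ℕ)) (w : Fin (p + q) → W) :
    harrClassOf 𝒲 (PiTensorProduct.tprod k (fun i : {i // P i} => w i)) =
      harrClassNat 𝒲 q (PiTensorProduct.tprod k (fun j => w (Fin.natAdd p j))) :=
  harrClassOf_tprod 𝒲 (finalEquiv hP) (fun i j => by
    have h1 := (hP _).mp i.2
    have h2 := (hP _).mp j.2
    simp only [finalEquiv, Equiv.coe_fn_mk, Fin.lt_def, ← Subtype.coe_lt_coe]
    omega) _

theorem harrSplit_initial {p q : ℕ} {d : Fin (p + q) → ℤ} {w : Fin (p + q) → W}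
    (hw : ∀ i, w i ∈ 𝒲 (d i)) :
    harrSplit 𝒲 {i : Fin (p + q) | (i : ℕ) < p} (PiTensorProduct.tprod k w) =
      harrClassNat 𝒲 p (PiTensorProduct.tprod k (fun j => w (Fin.castAdd q j))) ⊗ₜ
        harrClassNat 𝒲 q (PiTensorProduct.tprod k (fun j => w (Fin.natAdd p j))) := by
  classical
  have hs : (unshuffleSign {i : Fin (p + q) | (i : ℕ) < p} (fun i => (d i : ZMod 2)) : k) = 1 := by
    rw [unshuffleSign_eq]
    refine Finset.prod_eq_one fun i _ => Finset.prod_eq_one fun j _ => if_neg ?_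
    rintro ⟨h1, h2, h3⟩
    exact h3 ((Fin.lt_def.mp h1).trans h2)
  rw [harrSplit, LinearMap.comp_apply, unshuffle_tprod 𝒲 _ hw, hs, one_smul,
    TensorProduct.map_tmul]
  exact congrArg₂ _ (harrClassOf_initial 𝒲 (fun i => Iff.rfl) w)
    (harrClassOf_final 𝒲 (fun i => not_lt) w)

theorem harrSplit_initial_compl {p q : ℕ} {d : Fin (p + q) → ℤ} {w : Fin (p + q) → W}
    (hw : ∀ i, w i ∈ 𝒲 (d i)) :
    harrSplit 𝒲 {i : Fin (p + q) | (i : ℕ) < p}ᶜ (PiTensorProduct.tprod k w) =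
      ksign k (∑ j, d (Fin.castAdd q j) : ℤ) (∑ j, d (Fin.natAdd p j) : ℤ) •
      (harrClassNat 𝒲 q (PiTensorProduct.tprod k (fun j => w (Fin.natAdd p j))) ⊗ₜ[k]
        harrClassNat 𝒲 p (PiTensorProduct.tprod k (fun j => w (Fin.castAdd q j)))) := by
  classical
  have hs : (unshuffleSign {i : Fin (p + q) | (i : ℕ) < p}ᶜ (fun i => (d i : ZMod 2)) : k) =
      ksign k (∑ j, d (Fin.castAdd q j) : ℤ) (∑ j, d (Fin.natAdd p j) : ℤ) := by
    rw [unshuffleSign_eq, Int.cast_sum, Int.cast_sum, ksign_sum_left, Fin.prod_univ_add]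
    have h2 : ∀ (i : Fin q) (j : Fin (p + q)), ¬ (Fin.natAdd p i < j ∧
        j ∈ {i : Fin (p + q) | (i : ℕ) < p}ᶜ ∧ Fin.natAdd p i ∉ {i : Fin (p + q) | (i : ℕ) < p}ᶜ) := by
      rintro i j ⟨_, _, h⟩
      simp at h
    simp only [h2, if_false, Finset.prod_const_one, mul_one]
    refine Finset.prod_congr rfl fun i _ => ?_
    rw [ksign_sum_right, Fin.prod_univ_add]
    have h3 : ∀ j : Fin p, ¬ (Fin.castAdd q i < Fin.castAdd q j ∧
        Fin.castAdd q j ∈ {i : Fin (p + q) | (i : ℕ) < p}ᶜ ∧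
          Fin.castAdd q i ∉ {i : Fin (p + q) | (i : ℕ) < p}ᶜ) := by
      rintro j ⟨_, h, _⟩
      simp at h
    have h4 : ∀ j : Fin q, Fin.castAdd q i < Fin.natAdd p j ∧
        Fin.natAdd p j ∈ {i : Fin (p + q) | (i : ℕ) < p}ᶜ ∧
          Fin.castAdd q i ∉ {i : Fin (p + q) | (i : ℕ) < p}ᶜ := by
      intro j
      refine ⟨?_, by simp, by simp⟩
      rw [Fin.lt_def, Fin.val_castAdd, Fin.val_natAdd]
      omega
    simp only [h3, if_false, Finset.prod_const_one, one_mul]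
    exact Finset.prod_congr rfl fun j _ => if_pos (h4 j)
  rw [harrSplit, LinearMap.comp_apply, unshuffle_tprod 𝒲 _ hw, hs, map_smul,
    TensorProduct.map_tmul]
  exact congrArg _ (congrArg₂ _ (harrClassOf_final 𝒲 (fun i => by simp) w)
    (harrClassOf_initial 𝒲 (fun i => by simp) w))

theorem harrClassNat_mem {n : ℕ} {d : Fin n → ℤ} {w : Fin n → W} (hw : ∀ i, w i ∈ 𝒲 (d i)) :
    harrClassNat 𝒲 n (PiTensorProduct.tprod k w) ∈ harrDegree 𝒲 (∑ i, d i) := by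
  cases n with
  | zero => exact Submodule.zero_mem _
  | succ n => exact Submodule.subset_span ⟨n.succPNat, d, w, hw, rfl, rfl⟩

/-- The projection kills the empty word, so the terms `p = 0` and `p = n` of the full
deconcatenation drop out and the reduced one remains. -/
theorem map_harrProj_deconc {n : ℕ} {d : Fin n → ℤ} {w : Fin n → W} (hw : ∀ i, w i ∈ 𝒲 (d i)) :
    TensorProduct.map (harrProj 𝒲) (harrProj 𝒲) (deconc k W (TensorAlgebra.tprod k W n w)) =
      ∑ p ∈ Finset.Ioo 0 n,
        harrSplit 𝒲 {i : Fin n | (i : ℕ) < p} (PiTensorProduct.tprod k w) := by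
  have hterm : ∀ p ≤ n, TensorProduct.map (harrProj 𝒲) (harrProj 𝒲)
      ((((List.ofFn w).take p).map (TensorAlgebra.ι k)).prod ⊗ₜ[k]
        (((List.ofFn w).drop p).map (TensorAlgebra.ι k)).prod) =
      harrSplit 𝒲 {i : Fin n | (i : ℕ) < p} (PiTensorProduct.tprod k w) := by
    intro p hp
    obtain ⟨q, rfl⟩ := Nat.exists_eq_add_of_le hp
    rw [harrSplit_initial 𝒲 hw, TensorProduct.map_tmul, List.ofFn_add, List.take_left' (by simp),
      List.drop_left' (by simp), ← harrProj_tprod, ← harrProj_tprod, TensorAlgebra.tprod_apply,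
      TensorAlgebra.tprod_apply, List.map_ofFn, List.map_ofFn]
    rfl
  have hzero : harrSplit 𝒲 {i : Fin n | (i : ℕ) < 0} (PiTensorProduct.tprod k w) = 0 := by
    rw [← hterm 0 (Nat.zero_le n), TensorProduct.map_tmul, List.take_zero, List.map_nil,
      List.prod_nil, ← tprod_zero k W 0, harrProj_tprod]
    exact TensorProduct.zero_tmul _ _
  have hn : harrSplit 𝒲 {i : Fin n | (i : ℕ) < n} (PiTensorProduct.tprod k w) = 0 := by
    rw [← hterm n le_rfl, TensorProduct.map_tmul, List.drop_of_length_le (by simp), List.map_nil,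
      List.prod_nil, ← tprod_zero k W 0, harrProj_tprod]
    exact TensorProduct.tmul_zero _ _
  have h1 : TensorAlgebra.tprod k W n w = ((List.ofFn w).map (TensorAlgebra.ι k)).prod := by
    rw [TensorAlgebra.tprod_apply, List.map_ofFn]
    rfl
  rw [h1, deconc_list, map_sum, List.length_ofFn]
  rw [Finset.sum_congr rfl fun p hp => hterm p (Nat.lt_succ_iff.mp (Finset.mem_range.mp hp))]
  symm
  refine Finset.sum_subset (fun p hp => ?_) fun p hp hp' => ?_
  · rw [Finset.mem_Ioo] at hp
    rw [Finset.mem_range]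
    omega
  · rw [Finset.mem_range] at hp
    rw [Finset.mem_Ioo, not_and_or] at hp'
    obtain rfl | rfl : p = 0 ∨ p = n := by omega
    · exact hzero
    · exact hn

theorem harrisonShuffles_le_ker_harrCobracket (n : ℕ+) :
    harrisonShuffles 𝒲 n ≤ LinearMap.ker (harrCobracket 𝒲 n) :=
  harrisonShuffles_le_ker 𝒲 fun p hp => by
    rw [shuffleSum_eq_leSum, harrCobracket_leSum_of_not_conn 𝒲 (not_conn_twoChains hp)]

/-- The cobracket of the Harrison complex. -/
def harrLieCobracket : Harr 𝒲 →ₗ[k] Harr 𝒲 ⊗[k] Harr 𝒲 :=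
  harrLift 𝒲 (fun n => harrCobracket 𝒲 n) (harrisonShuffles_le_ker_harrCobracket 𝒲)

theorem harrLieCobracket_harrClass (n : ℕ+) (x : ⨂[k] _ : Fin n, W) :
    harrLieCobracket 𝒲 (harrClass 𝒲 n x) = harrCobracket 𝒲 n x :=
  harrLift_harrClass 𝒲 _ _ n x

theorem harrProj_mem (i : ℤ) (x : TensorAlgebra k W) (hx : x ∈ wordDegree 𝒲 i) :
    harrProj 𝒲 x ∈ harrDegree 𝒲 i :=
  map_harrProj_wordDegree 𝒲 i ▸ Submodule.mem_map_of_mem hx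

variable [CharZero k]

instance : DirectSum.Decomposition (harrDegree 𝒲) :=
  (isInternal_harrDegree 𝒲).chooseDecomposition

theorem harrSplit_compl_eq_gradedSwap {n p : ℕ} (hp : p ≤ n) :
    harrSplit 𝒲 {i : Fin n | (i : ℕ) < p}ᶜ =
      gradedSwap (harrDegree 𝒲) ∘ₗ harrSplit 𝒲 {i : Fin n | (i : ℕ) < p} := by
  obtain ⟨q, rfl⟩ := Nat.exists_eq_add_of_le hp
  refine tensor_ext_homogeneous 𝒲 fun d w hw => ?_
  rw [harrSplit_initial_compl 𝒲 hw, LinearMap.comp_apply, harrSplit_initial 𝒲 hw,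
    gradedSwap_tmul (harrDegree 𝒲) (harrClassNat_mem 𝒲 fun j => hw _)
      (harrClassNat_mem 𝒲 fun j => hw _)]

theorem harrCobracket_eq (n : ℕ) : harrCobracket 𝒲 n =
    (∑ p ∈ Finset.Ioo 0 n, harrSplit 𝒲 {i : Fin n | (i : ℕ) < p}) -
      gradedSwap (harrDegree 𝒲) ∘ₗ ∑ p ∈ Finset.Ioo 0 n, harrSplit 𝒲 {i : Fin n | (i : ℕ) < p} := by
  rw [harrCobracket, linearMap_comp_sum, ← Finset.sum_sub_distrib]
  refine Finset.sum_congr rfl fun p hp => ?_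
  rw [harrSplit_compl_eq_gradedSwap 𝒲 (Finset.mem_Ioo.mp hp).2.le]

/-- Exhibits the cobracket as the one induced by `Δ - τΔ`, so that the Lie coalgebra axioms can be
transported along the surjection `harrProj`. -/
theorem harrLieCobracket_comp_harrProj : harrLieCobracket 𝒲 ∘ₗ harrProj 𝒲 =
    TensorProduct.map (harrProj 𝒲) (harrProj 𝒲) ∘ₗ
      (deconc k W - gradedSwap (wordDegree 𝒲) ∘ₗ deconc k W) := by
  rw [LinearMap.comp_sub, ← LinearMap.comp_assoc,
    ← gradedSwap_comp_map (wordDegree 𝒲) (harrDegree 𝒲) _ (harrProj_mem 𝒲),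
    ← LinearMap.eqLocus_eq_top]
  refine tprod_induction 𝒲 fun n d w hw => ?_
  have h1 : harrLieCobracket 𝒲 (harrClassNat 𝒲 n (PiTensorProduct.tprod k w)) =
      harrCobracket 𝒲 n (PiTensorProduct.tprod k w) := by
    cases n with
    | zero => simp [harrClassNat, harrCobracket]
    | succ n => exact harrLieCobracket_harrClass 𝒲 n.succPNat _
  rw [LinearMap.mem_eqLocus, LinearMap.comp_apply, harrProj_tprod, h1, harrCobracket_eq]
  simp only [LinearMap.sub_apply, LinearMap.comp_apply, map_harrProj_deconc 𝒲 hw,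
    LinearMap.sum_apply]

variable {𝒲} {D : W →ₗ[k] W} {m : W →ₗ[k] W →ₗ[k] W}

/-- The Harrison complex as a differential graded Lie coalgebra. -/
def IsBarData.harrLieCoalgebra (h : IsBarData 𝒲 D m) : DGLieCoalgebra k (Harr 𝒲) :=
  (DGLieCoalgebra.ofCoassoc (wordDegree 𝒲) (deconc k W) (barD 𝒲 D m) (deconc_mem 𝒲)
    deconc_coassoc h.barD_mem h.barD_barD (deconc_barD 𝒲 D m)).map (harrProj 𝒲)
    (harrProj_surjective 𝒲) (harrDegree 𝒲) inferInstance (map_harrProj_wordDegree 𝒲) h.harrDiff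
    h.harrDiff_comp_harrProj (harrLieCobracket 𝒲) (harrLieCobracket_comp_harrProj 𝒲)

end Cobracket

/-! ### The augmentation ideal of a differential graded commutative algebra -/

section Augmentation

theorem negOnePow_smul_eq {k : Type u} [Field k] {A : Type v} [AddCommGroup A] [Module k A] (i : ℤ)
    (x : A) : i.negOnePow • x = ksign k 1 i • x := by
  rcases Int.even_or_odd' i with ⟨j, rfl | rfl⟩
  · rw [Int.negOnePow_two_mul, Int.cast_mul, show ((2 : ℤ) : ZMod 2) = 0 from rfl, zero_mul,
      ksign_zero_right, one_smul, one_smul]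
  · rw [Int.negOnePow_two_mul_add_one, Int.cast_add, Int.cast_mul,
      show ((2 : ℤ) : ZMod 2) = 0 from rfl, zero_mul, zero_add, Int.cast_one, ksign_one_one,
      neg_smul, one_smul, Units.neg_smul, one_smul]

theorem ksign_one_mul (k : Type u) [Field k] (ε δ : ZMod 2) :
    ksign k 1 (ε * δ) = ksign k ε δ := by
  have h : ∀ x : ZMod 2, x = 0 ∨ x = 1 := by decide
  rcases h ε with rfl | rfl <;> rcases h δ with rfl | rfl <;> simp

variable {k : Type u} [Field k] {A : Type v} [Ring A] [Algebra k A]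
  {𝒜 : ℤ → Submodule k A} [GradedAlgebra 𝒜] (S : AugCDGA 𝒜)

theorem AugCDGA.mem_desusp {i : ℤ} {x : S.augIdeal} : x ∈ S.desusp i ↔ (x : A) ∈ 𝒜 (i + 1) :=
  Iff.rfl

theorem AugCDGA.coe_desuspD (x : S.augIdeal) : (S.desuspD x : A) = -S.d x := rfl

theorem AugCDGA.coe_desuspMul (x y : S.augIdeal) :
    (S.desuspMul x y : A) = -((degInvol S.desusp x : A) * y) := rfl

theorem AugCDGA.coe_desuspMul_of_mem {i : ℤ} {x : S.augIdeal} (hx : x ∈ S.desusp i)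
    (y : S.augIdeal) : (S.desuspMul x y : A) = -(ksign k 1 i • ((x : A) * y)) := by
  rw [S.coe_desuspMul, degInvol_of_mem _ hx, Submodule.coe_smul, smul_mul_assoc]

theorem AugCDGA.desuspD_mem (i : ℤ) (x : S.augIdeal) (hx : x ∈ S.desusp i) :
    S.desuspD x ∈ S.desusp (i + 1) :=
  Submodule.neg_mem _ (S.d_mem _ _ hx)

theorem AugCDGA.desuspMul_mem (i j : ℤ) (x : S.augIdeal) (hx : x ∈ S.desusp i) (y : S.augIdeal)
    (hy : y ∈ S.desusp j) : S.desuspMul x y ∈ S.desusp (i + j + 1) := by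
  rw [S.mem_desusp, S.coe_desuspMul_of_mem hx]
  refine Submodule.neg_mem _ (Submodule.smul_mem _ _ ?_)
  have h := SetLike.mul_mem_graded (S.mem_desusp.mp hx) (S.mem_desusp.mp hy)
  rwa [show i + 1 + (j + 1) = i + j + 1 + 1 by ring] at h

/-- The desuspension signs turn `d` and the product into operations of degree one; associativity,
the Leibniz rule and graded commutativity then take the form required of bar data. -/
theorem AugCDGA.isBarData : IsBarData S.desusp S.desuspD S.desuspMul where
  D_mem := S.desuspD_mem
  m_mem := S.desuspMul_mem
  D_D x := by
    refine Subtype.ext ?_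
    rw [S.coe_desuspD, S.coe_desuspD, map_neg, neg_neg]
    exact LinearMap.congr_fun S.d_comp_d x
  assoc x y z := by
    induction x using DirectSum.Decomposition.inductionOn S.desusp with
    | zero => simp
    | add x x' hx hx' =>
      simp only [map_add, LinearMap.add_apply]
      linear_combination (norm := abel) hx + hx'
    | @homogeneous i x =>
      induction y using DirectSum.Decomposition.inductionOn S.desusp with
      | zero => simp
      | add y y' hy hy' =>
        simp only [map_add, LinearMap.add_apply] at hy hy' ⊢
        linear_combination (norm := abel) hy + hy'
      | @homogeneous j y =>
        refine Subtype.ext ?_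
        rw [Submodule.coe_add, S.coe_desuspMul_of_mem (S.desuspMul_mem i j _ x.2 _ y.2),
          S.coe_desuspMul_of_mem x.2, degInvol_of_mem _ x.2, map_smul, LinearMap.smul_apply,
          Submodule.coe_smul, S.coe_desuspMul_of_mem x.2, S.coe_desuspMul_of_mem y.2]
        simp only [Int.cast_add, Int.cast_one, ksign_add_right, ksign_one_one, neg_mul, mul_neg,
          smul_neg, neg_neg, smul_mul_assoc, mul_smul_comm, smul_smul, mul_assoc, mul_one, neg_smul,
          Submodule.coe_zero]
        match_scalars
        ring
  leibniz x y := by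
    induction x using DirectSum.Decomposition.inductionOn S.desusp with
    | zero => simp
    | add x x' hx hx' =>
      simp only [map_add, LinearMap.add_apply]
      linear_combination (norm := abel) hx + hx'
    | @homogeneous i x =>
      refine Subtype.ext ?_
      rw [Submodule.coe_add, Submodule.coe_add, S.coe_desuspD, S.coe_desuspMul_of_mem x.2,
        S.coe_desuspMul_of_mem (S.desuspD_mem i _ x.2), S.coe_desuspD, degInvol_of_mem _ x.2,
        map_smul, LinearMap.smul_apply, Submodule.coe_smul, S.coe_desuspMul_of_mem x.2,
        S.coe_desuspD, map_neg, map_smul, S.leibniz _ _ (S.mem_desusp.mp x.2), negOnePow_smul_eq (k := k)]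
      simp only [Int.cast_add, Int.cast_one, ksign_add_right, ksign_one_one, neg_mul, mul_neg,
        smul_neg, neg_neg, smul_smul, mul_one, neg_smul, ksign_mul_self, one_smul,
        Submodule.coe_zero, smul_add]
      abel
  symm i j x hx y hy := by
    refine Subtype.ext ?_
    rw [Submodule.coe_neg, Submodule.coe_smul, S.coe_desuspMul_of_mem hx, S.coe_desuspMul_of_mem hy,
      S.comm _ _ _ (S.mem_desusp.mp hx) _ (S.mem_desusp.mp hy), negOnePow_smul_eq (k := k),
      smul_neg, neg_neg, smul_smul, smul_smul, ← neg_smul]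
    congr 1
    rw [Int.cast_mul, ksign_one_mul]
    simp only [Int.cast_add, Int.cast_one, ksign_add_right, ksign_add_left, ksign_one_one]
    rw [ksign_comm k (i : ZMod 2) 1]
    linear_combination (ksign k (i : ZMod 2) j * ksign k 1 (j : ZMod 2)) *
      ksign_mul_self k 1 (i : ZMod 2)

end Augmentation

/-! ### Comparison of the Harrison complex with the graph model -/

section Comparison

variable {k : Type u} [Field k] {W : Type v} [AddCommGroup W] [Module k W]
  (𝒲 : ℤ → Submodule k W) [DirectSum.Decomposition 𝒲]

/-- The isomorphism from the Harrison complex to the graph model. -/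
def harrEquivEil : Harr 𝒲 ≃ₗ[k] Eil 𝒲 :=
  DFinsupp.mapRange.linearEquiv fun n : ℕ+ => harrEquivEilWeight 𝒲 (n : ℕ) n.2

theorem harrEquivEil_harrClass (n : ℕ+) (x : ⨂[k] _ : Fin n, W) :
    harrEquivEil 𝒲 (harrClass 𝒲 n x) = eilClass 𝒲 n (longGraph n) x :=
  DFinsupp.mapRange_single (f := fun n : ℕ+ => harrEquivEilWeight 𝒲 (n : ℕ) n.2)
    (hf := fun _ => map_zero _)

/-- Each graph representative is the image of an explicit word class. Through it, formulas on trees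
follow from formulas for sums over linear extensions. -/
theorem eilClass_eq (n : ℕ+) {G : Digraph (Fin n)} (hG : IsSGraph G) (x : ⨂[k] _ : Fin n, W) :
    eilClass 𝒲 n G x = harrEquivEil 𝒲 (harrClass 𝒲 n (leSum 𝒲 n G x)) := by
  rw [harrEquivEil_harrClass]
  exact congrArg (eilIncl 𝒲 n) (eilWeightClass_eq_bar 𝒲 hG x)

theorem eilClassOf_eq {I : Type} {_ : Fintype I} [LinearOrder I] {G : Digraph I} (hG : IsSGraph G)
    (x : ⨂[k] _ : I, W) :
    eilClassOf 𝒲 G x = harrEquivEil 𝒲 (harrLEOf 𝒲 G (Nat.card I) x) := by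
  have h : 0 < Fintype.card I := by
    obtain ⟨hI, _⟩ := isSGraph_iff.mp hG
    exact Fintype.card_pos
  set f := Fintype.orderIsoFinOfCardEq I rfl
  have h1 : eilClassOf 𝒲 G x = eilClass 𝒲 ⟨Fintype.card I, h⟩ (pullback f G)
      (PiTensorProduct.reindex k (fun _ : I => W) f.symm.toEquiv x) :=
    LinearMap.congr_fun (dif_pos h) x
  have h2 : IsSGraph (pullback f G) := hG.pullback_equiv f.toEquiv
  have h3 : leSum 𝒲 (Fintype.card I) (pullback f G) ∘ₗ koszul 𝒲 f.symm.toEquiv =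
      leSum 𝒲 (Fintype.card I) G := by
    rw [leSum_koszul]
    congr 1
    simp [pullback]
  rw [koszul_of_strictMono 𝒲 f.symm.toEquiv fun i j hij => f.symm.lt_iff_lt.mpr hij] at h3
  rw [h1, Nat.card_eq_fintype_card, harrLEOf, LinearMap.comp_apply, ← h3]
  exact (eilClass_eq 𝒲 ⟨Fintype.card I, h⟩ h2 _).trans
    (congrArg _ (LinearMap.congr_fun (harrClassNat_coe 𝒲 ⟨Fintype.card I, h⟩).symm _))

theorem map_harrDegree (i : ℤ) :
    (harrDegree 𝒲 i).map (harrEquivEil 𝒲).toLinearMap = eilDegree 𝒲 i := by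
  rw [harrDegree, Submodule.map_span, eilDegree]
  refine le_antisymm (Submodule.span_le.mpr ?_) (Submodule.span_le.mpr ?_)
  · rintro _ ⟨_, ⟨n, p, w, hw, hi, rfl⟩, rfl⟩
    exact Submodule.subset_span ⟨n, ⟨longGraph n, isSGraph_longGraph n.2⟩, p, w, hw, hi,
      harrEquivEil_harrClass 𝒲 n _⟩
  · rintro _ ⟨n, G, p, w, hw, rfl, rfl⟩
    classical
    -- Reorderings keep the total degree, so all terms of the expansion have degree `∑ j, p j`.
    rw [SetLike.mem_coe, eilClass_eq 𝒲 n G.2, leSum, LinearMap.sum_apply, map_sum, map_sum]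
    refine Submodule.sum_mem _ fun π _ => ?_
    split_ifs
    · rw [koszul_tprod 𝒲 π hw, map_smul, map_smul]
      exact Submodule.smul_mem _ _ (Submodule.subset_span ⟨_, ⟨n, fun j => p (π.symm j), _,
        fun j => hw _, Equiv.sum_comp π.symm p, rfl⟩, rfl⟩)
    · simp

theorem isInternal_eilDegree [CharZero k] : DirectSum.IsInternal (eilDegree 𝒲) := by
  have h := (DirectSum.isInternal_submodule_iff_iSupIndep_and_iSup_eq_top _).mp
    (isInternal_harrDegree 𝒲)
  have h1 : eilDegree 𝒲 = Submodule.orderIsoMapComap (harrEquivEil 𝒲) ∘ harrDegree 𝒲 :=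
    funext fun i => (map_harrDegree 𝒲 i).symm
  rw [DirectSum.isInternal_submodule_iff_iSupIndep_and_iSup_eq_top, h1]
  refine ⟨(iSupIndep_map_orderIso_iff _).mpr h.1, ?_⟩
  exact ((OrderIso.map_iSup _ _).symm.trans (congrArg _ h.2)).trans (OrderIso.map_top _)

variable {𝒲} {D : W →ₗ[k] W} {m : W →ₗ[k] W →ₗ[k] W}

/-- For a tree, the surviving terms of `sum_merge_leSum` are sums over linear extensions of
contracted trees, and these represent the classes of the contracted trees. -/
theorem IsBarData.harrEquivEil_harrContract_leSum (h : IsBarData 𝒲 D m) :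
    ∀ {n : ℕ} {G : Digraph (Fin n)}, IsSGraph G → ∀ x : ⨂[k] _ : Fin n, W,
      harrEquivEil 𝒲 (harrContract 𝒲 m n (leSum 𝒲 n G x)) = eilContract 𝒲 m n G x
  | 0, _, _, _ => map_zero _
  | 1, _, _, _ => map_zero _
  | n + 2, G, hG, x => by
    have h1 : harrContract 𝒲 m (n + 2) ∘ₗ leSum 𝒲 (n + 2) G = harrClassNat 𝒲 (n + 1) ∘ₗ
        ∑ i : Fin (n + 1), merge (degInvol 𝒲) m i ∘ₗ leSum 𝒲 (n + 2) G := by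
      rw [linearMap_comp_sum]
      exact linearMap_sum_comp _ _ _
    rw [← LinearMap.comp_apply, h1, sum_merge_leSum 𝒲 h.m_mem h.symm fun a b => hG.asymm]
    simp only [eilContract, LinearMap.sum_apply, map_sum, LinearMap.comp_apply]
    refine Finset.sum_congr rfl fun e he => ?_
    exact (eilClass_eq 𝒲 n.succPNat (isSGraph_contract hG (mem_edges.mp he)) _).symm

theorem IsBarData.harrEquivEil_harrDiff (h : IsBarData 𝒲 D m) (n : ℕ+) {G : Digraph (Fin n)}
    (hG : IsSGraph G) (x : ⨂[k] _ : Fin n, W) :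
    harrEquivEil 𝒲 (h.harrDiff (harrClass 𝒲 n (leSum 𝒲 n G x))) =
      eilClass 𝒲 n G (termwise 𝒲 D x) + eilContract 𝒲 m n G x := by
  have h1 : termwise 𝒲 D ∘ₗ leSum 𝒲 n G = leSum 𝒲 n G ∘ₗ termwise 𝒲 D := by
    classical
    rw [leSum, linearMap_comp_sum, linearMap_sum_comp]
    refine Finset.sum_congr rfl fun π _ => ?_
    split_ifs
    · exact termwise_koszul 𝒲 D h.D_mem π
    · simp
  have h2 := LinearMap.congr_fun h1 x
  simp only [LinearMap.comp_apply] at h2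
  rw [h.harrDiff_harrClass, map_add, h.harrEquivEil_harrContract_leSum hG, h2, eilClass_eq 𝒲 n hG]

variable (𝒲) in
theorem map_cutTerm {n : ℕ} {G : Digraph (Fin n)} {T : Set (Fin n)}
    (h1 : IsSGraph (pullback (Subtype.val : {i // i ∈ T} → Fin n) G))
    (h2 : IsSGraph (pullback (Subtype.val : {i // ¬ i ∈ T} → Fin n) G)) :
    TensorProduct.map (harrEquivEil 𝒲).toLinearMap (harrEquivEil 𝒲).toLinearMap ∘ₗ cutTerm 𝒲 G T =
      eilSplit 𝒲 G T := by
  rw [cutTerm, eilSplit, ← LinearMap.comp_assoc, ← TensorProduct.map_comp]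
  exact congrArg (· ∘ₗ _) (congrArg₂ TensorProduct.map
    (LinearMap.ext fun x => (eilClassOf_eq 𝒲 h1 x).symm)
    (LinearMap.ext fun x => (eilClassOf_eq 𝒲 h2 x).symm))

-- The cuts that survive for a tree are its edges, and both parts are again trees, so each factor is
-- the word form of a graph class.
variable (𝒲) in
theorem map_harrLieCobracket (n : ℕ+) {G : Digraph (Fin n)} (hG : IsSGraph G)
    (x : ⨂[k] _ : Fin n, W) :
    TensorProduct.map (harrEquivEil 𝒲).toLinearMap (harrEquivEil 𝒲).toLinearMap
      (harrLieCobracket 𝒲 (harrClass 𝒲 n (leSum 𝒲 n G x))) = eilCobracket 𝒲 G x := by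
  have h1 := congrArg
    (TensorProduct.map (harrEquivEil 𝒲).toLinearMap (harrEquivEil 𝒲).toLinearMap ∘ₗ ·)
    (harrCobracket_leSum_of_isSGraph 𝒲 hG)
  have h2 : TensorProduct.map (harrEquivEil 𝒲).toLinearMap (harrEquivEil 𝒲).toLinearMap ∘ₗ
      ∑ e ∈ edges G, (cutTerm 𝒲 G (cutSide G e.1 e.2) - cutTerm 𝒲 G (cutSide G e.1 e.2)ᶜ) =
      eilCobracket 𝒲 G := by
    rw [linearMap_comp_sum, eilCobracket]
    refine Finset.sum_congr rfl fun e he => ?_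
    obtain ⟨h3, h4⟩ := hG.isSGraph_cutSide (mem_edges.mp he)
    rw [LinearMap.comp_sub, map_cutTerm 𝒲 h3 h4, map_cutTerm 𝒲 (T := (cutSide G e.1 e.2)ᶜ) h4
      ((isSGraph_restrict_congr (fun i => by simp) G).mp h3)]
  rw [harrLieCobracket_harrClass]
  exact LinearMap.congr_fun (h1.trans h2) x

/-- The graph model as a differential graded Lie coalgebra. -/
def IsBarData.eilLieCoalgebra [CharZero k] (h : IsBarData 𝒲 D m) : DGLieCoalgebra k (Eil 𝒲) :=
  h.harrLieCoalgebra.map (harrEquivEil 𝒲).toLinearMap (harrEquivEil 𝒲).surjective (eilDegree 𝒲)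
    (isInternal_eilDegree 𝒲).chooseDecomposition (map_harrDegree 𝒲)
    ((harrEquivEil 𝒲).toLinearMap ∘ₗ h.harrDiff ∘ₗ (harrEquivEil 𝒲).symm.toLinearMap)
    (by
      refine LinearMap.ext fun x => ?_
      simp only [LinearMap.comp_apply, LinearEquiv.coe_coe, LinearEquiv.symm_apply_apply]
      rfl)
    (TensorProduct.map (harrEquivEil 𝒲).toLinearMap (harrEquivEil 𝒲).toLinearMap ∘ₗ
      harrLieCobracket 𝒲 ∘ₗ (harrEquivEil 𝒲).symm.toLinearMap)
    (by
      refine LinearMap.ext fun x => ?_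
      simp only [LinearMap.comp_apply, LinearEquiv.coe_coe, LinearEquiv.symm_apply_apply]
      rfl)

end Comparison

end GraphLie

end

/-! ### The proposition -/

theorem mainTheorem8 {k : Type*} [Field k] [CharZero k] :
    (∀ {W : Type*} [AddCommGroup W] [Module k W] (𝒲 : ℤ → Submodule k W)
        [DirectSum.Decomposition 𝒲] (n : ℕ), 1 ≤ n →
      LinearMap.range (GraphLie.bar 𝒲 n) = ⊤ ∧
      LinearMap.ker (GraphLie.bar 𝒲 n) = GraphLie.harrisonShuffles 𝒲 n) ∧
    (∀ {A : Type*} [Ring A] [Algebra k A] (𝒜 : ℤ → Submodule k A) [GradedAlgebra 𝒜]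
        (S : GraphLie.AugCDGA 𝒜),
      ∃ (LE : GraphLie.DGLieCoalgebra k (GraphLie.Eil S.desusp))
        (LH : GraphLie.DGLieCoalgebra k (GraphLie.Harr S.desusp)),
        (LE.gr = GraphLie.eilDegree S.desusp ∧
          ∀ (n : ℕ+) (G : GraphLie.SGr n) (x : ⨂[k] _ : Fin n, S.augIdeal),
            LE.d (GraphLie.eilClass S.desusp n G.1 x) = S.eilD n G.1 x ∧
            LE.cobracket (GraphLie.eilClass S.desusp n G.1 x) =
              GraphLie.eilCobracket S.desusp G.1 x) ∧
        (LH.gr = GraphLie.harrDegree S.desusp ∧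
          ∀ (n : ℕ+) (x : ⨂[k] _ : Fin n, S.augIdeal),
            LH.d (GraphLie.harrClass S.desusp n x) = S.harrD n x ∧
            LH.cobracket (GraphLie.harrClass S.desusp n x) =
              GraphLie.harrCobracket S.desusp n x) ∧
        ∃ φ : GraphLie.Harr S.desusp ≃ₗ[k] GraphLie.Eil S.desusp,
          (∀ (n : ℕ+) (x : ⨂[k] _ : Fin n, S.augIdeal),
            φ (GraphLie.harrClass S.desusp n x) =
              GraphLie.eilClass S.desusp n (GraphLie.longGraph n) x) ∧
          (∀ i, (LH.gr i).map φ.toLinearMap = LE.gr i) ∧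
          φ.toLinearMap ∘ₗ LH.d = LE.d ∘ₗ φ.toLinearMap ∧
          LE.cobracket ∘ₗ φ.toLinearMap =
            TensorProduct.map φ.toLinearMap φ.toLinearMap ∘ₗ LH.cobracket) := by
  refine ⟨fun 𝒲 _ n hn => ⟨GraphLie.range_bar 𝒲, GraphLie.ker_bar 𝒲 hn⟩, fun 𝒜 _ S => ?_⟩
  have h := S.isBarData
  -- The operations on the graph model are conjugates of those on the Harrison complex, so they are
  -- computed on images of word classes.
  have hd : ∀ y, h.eilLieCoalgebra.d (GraphLie.harrEquivEil S.desusp y) =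
      GraphLie.harrEquivEil S.desusp (h.harrDiff y) := fun y =>
    congrArg (fun z => GraphLie.harrEquivEil S.desusp (h.harrDiff z))
      (LinearEquiv.symm_apply_apply _ y)
  have hc : ∀ y, h.eilLieCoalgebra.cobracket (GraphLie.harrEquivEil S.desusp y) =
      TensorProduct.map (GraphLie.harrEquivEil S.desusp).toLinearMap
        (GraphLie.harrEquivEil S.desusp).toLinearMap (GraphLie.harrLieCobracket S.desusp y) :=
    fun y => congrArg (fun z => TensorProduct.map (GraphLie.harrEquivEil S.desusp).toLinearMap
        (GraphLie.harrEquivEil S.desusp).toLinearMap (GraphLie.harrLieCobracket S.desusp z))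
      (LinearEquiv.symm_apply_apply _ y)
  refine ⟨h.eilLieCoalgebra, h.harrLieCoalgebra, ⟨rfl, fun n G x => ⟨?_, ?_⟩⟩,
    ⟨rfl, fun n x => ⟨h.harrDiff_harrClass n x, GraphLie.harrLieCobracket_harrClass _ n x⟩⟩,
    GraphLie.harrEquivEil S.desusp, GraphLie.harrEquivEil_harrClass S.desusp,
    GraphLie.map_harrDegree S.desusp, LinearMap.ext fun y => (hd y).symm, LinearMap.ext hc⟩
  -- The formulas are verified for every tree `G`, which shows at the same time that the graph
  -- operations are compatible with the relations.
  · rw [GraphLie.eilClass_eq S.desusp n G.2, hd]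
    exact h.harrEquivEil_harrDiff n G.2 x
  · rw [GraphLie.eilClass_eq S.desusp n G.2, hc]
    exact GraphLie.map_harrLieCobracket S.desusp n G.2 x
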